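/- Let $\mathfrak g=\mathfrak{sl}_2(\mathbb C)$ with standard basis $e,h,f$, $\mathfrak n=\mathbb C e$, Weyl group $W=S_2=\{1,s\}$ and dot action $w\cdot\mu=w(\mu+\rho)-\rho$; identifying a weight with its value at $h$, one has $1\cdot 0=0$ and $s\cdot 0=-2$. Let $\mathcal O$ be the category of finitely generated $U(\mathfrak g)$-modules that are the direct sum of their weight spaces and are locally $\mathfrak n$-finite, and let $\mathcal O_0$ be its principal block, consisting of the modules in $\mathcal O$ all of whose composition factors are among the simple modules $L(w)$ of highest weight $w\cdot 0$, $w\in W$. Let $P(w)$ denote the indecomposable projective object of $\mathcal O_0$ that surjects onto $L(w)$. For $X,Y\in D^{\mathrm b}(\mathcal O_0)$ put $\operatorname{Hom}^n(X,Y)=\operatorname{Hom}_{D^{\mathrm b}(\mathcal O_0)}(X,Y[n])$ and $\operatorname{Hom}^*(X,Y)=\bigoplus_{n\in\mathbb Z}\operatorname{Hom}^n(X,Y)$. For an integer $d\ge 0$, an object $E\in D^{\mathrm b}(\mathcal O_0)$ is called $d$-spherical if 1. for every $F\in D^{\mathrm b}(\mathcal O_0)$ the spaces $\operatorname{Hom}^*(E,F)$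 and $\operatorname{Hom}^*(F,E)$ have finite total dimension over $\mathbb C$; 2. $\operatorname{Hom}^*(E,E)\cong\mathbb C[x]/(x^2)$ as graded algebras, where $x$ has degree $d$; 3. (Calabi–Yau property) for every $F\in D^{\mathrm b}(\mathcal O_0)$ and every $i\in\mathbb Z$ the composition pairing $$\operatorname{Hom}^i(F,E)\otimes\operatorname{Hom}^{d-i}(E,F)\longrightarrow\operatorname{Hom}^d(E,E)\longrightarrow\mathbb C x$$ is non-degenerate (in both arguments), where for $d=0$ the last map is the projection $\operatorname{Hom}^0(E,E)\to\operatorname{Hom}^0(E,E)/\mathbb C\,\mathrm{id}_E\cong\mathbb C x$. Then, regarding modules as complexes concentrated in degree $0$: the objects $P(s)$ and $L(1)$ (the trivial module, also written $L(e)$ with $e$ the unit of $W$) exist in $\mathcal O_0$, $P(s)$ is a $0$-spherical object of $D^{\mathrm b}(\mathcal O_0)$, and $L(1)$ is a $2$-spherical object of $D^{\mathrm b}(\mathcal O_0)$. -/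

import Mathlib

open CategoryTheory
open scoped DirectSum

section GradedHom

universe v u

/-- The degree `n` part `Hom^n(E, E) = Hom(E, E[n])` of the graded endomorphism algebra of an
object `E` of a category with shift. -/
def GradedEnd {T : Type u} [Category.{v} T] [HasShift T ℤ] (E : T) (n : ℤ) : Type v :=
  ShiftedHom E E n

namespace GradedEnd

variable {T : Type u} [Category.{v} T] [HasShift T ℤ]

/-- The product of `f` and `g` is the composition `f ∘ g`. -/
noncomputable instance gMul (E : T) : GradedMonoid.GMul (GradedEnd E) where
  mul {i j} f g := ShiftedHom.comp (X := E) (Y := E) (Z := E) (a := j) (b := i) g f rfl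

noncomputable instance gOne (E : T) : GradedMonoid.GOne (GradedEnd E) where
  one := ShiftedHom.mk₀ (0 : ℤ) rfl (𝟙 E)

theorem mk_mul_mk {E : T} {i j n : ℤ} (f : GradedEnd E i) (g : GradedEnd E j) (h : i + j = n) :
    GradedMonoid.mk i f * GradedMonoid.mk j g =
      GradedMonoid.mk (A := GradedEnd E) n
        (ShiftedHom.comp (X := E) (Y := E) (Z := E) (a := j) (b := i) g f h) := by
  subst h
  rfl

theorem one_eq (E : T) : (1 : GradedMonoid (GradedEnd E)) =
    GradedMonoid.mk (A := GradedEnd E) 0 (ShiftedHom.mk₀ (0 : ℤ) rfl (𝟙 E)) := rfl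

noncomputable instance gMonoid (E : T) : GradedMonoid.GMonoid (GradedEnd E) where
  one_mul := by
    rintro ⟨i, f⟩
    refine (mk_mul_mk _ f (zero_add i)).trans ?_
    exact congrArg (GradedMonoid.mk i) (ShiftedHom.comp_mk₀_id _ _ _)
  mul_one := by
    rintro ⟨i, f⟩
    refine (mk_mul_mk f _ (add_zero i)).trans ?_
    exact congrArg (GradedMonoid.mk i) (ShiftedHom.mk₀_id_comp _ _ _)
  mul_assoc := by
    rintro ⟨i, f⟩ ⟨j, g⟩ ⟨l, h⟩
    refine ((congrArg (· * GradedMonoid.mk l h) (mk_mul_mk f g rfl)).trans 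
      (mk_mul_mk _ h rfl)).trans ?_
    refine Eq.trans ?_ ((congrArg (GradedMonoid.mk i f * ·) (mk_mul_mk g h rfl)).trans 
      (mk_mul_mk f _ (add_assoc i j l).symm)).symm
    exact congrArg (GradedMonoid.mk _) (ShiftedHom.comp_assoc h g f rfl rfl rfl).symm

variable [Preadditive T]

noncomputable instance addCommGroup (E : T) (n : ℤ) : AddCommGroup (GradedEnd E n) :=
  inferInstanceAs (AddCommGroup (E ⟶ (shiftFunctor T n).obj E))

noncomputable instance gRing [∀ n : ℤ, (shiftFunctor T n).Additive] (E : T) :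
    DirectSum.GRing (GradedEnd E) where
  mul_zero f := ShiftedHom.zero_comp (X := E) (Y := E) (Z := E) _ f _
  zero_mul f := ShiftedHom.comp_zero (X := E) (Y := E) (Z := E) f _
  mul_add f g h := ShiftedHom.add_comp (X := E) (Y := E) (Z := E) g h f _
  add_mul f g h := ShiftedHom.comp_add (X := E) (Y := E) (Z := E) h f g _
  natCast n := n • (GradedMonoid.GOne.one : GradedEnd E 0)
  natCast_zero := zero_nsmul _
  natCast_succ n := succ_nsmul _ n
  intCast n := n • (GradedMonoid.GOne.one : GradedEnd E 0)
  intCast_ofNat n := natCast_zsmul _ n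
  intCast_negSucc_ofNat n := negSucc_zsmul _ n

variable (k : Type*) [Field k] [Linear k T]

noncomputable instance module (E : T) (n : ℤ) : Module k (GradedEnd E n) :=
  inferInstanceAs (Module k (E ⟶ (shiftFunctor T n).obj E))

noncomputable instance gAlgebra [∀ n : ℤ, (shiftFunctor T n).Additive]
    [∀ n : ℤ, (shiftFunctor T n).Linear k] (E : T) :
    DirectSum.GAlgebra k (GradedEnd E) where
  toFun := (LinearMap.toSpanSingleton k (GradedEnd E 0)
    (GradedMonoid.GOne.one : GradedEnd E 0)).toAddMonoidHom
  map_one := one_smul k _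
  map_mul r s := by
    refine Eq.trans ?_ (mk_mul_mk _ _ (add_zero 0)).symm
    refine congrArg (GradedMonoid.mk 0) ?_
    refine Eq.trans ?_ (ShiftedHom.smul_comp (X := E) (Y := E) (Z := E) s _ _ _).symm
    refine Eq.trans ?_ (congrArg (s • ·)
      (ShiftedHom.comp_smul (X := E) (Y := E) (Z := E) r _ _ _).symm)
    refine Eq.trans ?_ (congrArg (fun t => s • r • t) (ShiftedHom.mk₀_id_comp _ _ _).symm)
    exact (congrArg (· • _) (mul_comm r s)).trans (mul_smul s r _)
  commutes r := by
    rintro ⟨i, f⟩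
    refine (mk_mul_mk _ f (zero_add i)).trans (Eq.trans ?_ (mk_mul_mk f _ (add_zero i)).symm)
    refine congrArg (GradedMonoid.mk i) ?_
    refine (ShiftedHom.comp_smul (X := E) (Y := E) (Z := E) r _ _ _).trans
      (Eq.trans ?_ (ShiftedHom.smul_comp (X := E) (Y := E) (Z := E) r _ _ _).symm)
    exact congrArg (r • ·) ((ShiftedHom.comp_mk₀_id _ _ _).trans
      (ShiftedHom.mk₀_id_comp _ _ _).symm)
  smul_def r := by
    rintro ⟨i, f⟩
    refine Eq.trans ?_ (mk_mul_mk _ f (zero_add i)).symm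
    refine congrArg (GradedMonoid.mk i) ?_
    refine Eq.trans ?_ (ShiftedHom.comp_smul (X := E) (Y := E) (Z := E) r _ _ _).symm
    exact congrArg (r • ·) (ShiftedHom.comp_mk₀_id _ _ _).symm

end GradedEnd

/-- The degree `n` part of the algebra `k[x]/(x²)`, graded such that `x` has degree `d`. -/
noncomputable def truncPolyGrading (k : Type*) [Field k] (d n : ℤ) :
    Submodule k (Polynomial k ⧸ Ideal.span {(Polynomial.X ^ 2 : Polynomial k)}) :=
  Submodule.span k {y | (n = 0 ∧ y = 1) ∨ (n = d ∧ y = Ideal.Quotient.mk _ Polynomial.X)}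

variable (k : Type*) [Field k] {T : Type u} [Category.{v} T] [HasShift T ℤ]
  [Preadditive T] [Linear k T] [∀ n : ℤ, (shiftFunctor T n).Additive]
  [∀ n : ℤ, (shiftFunctor T n).Linear k]

/-- The composition of morphisms `Hom^i(F, E) × Hom^(d-i)(E, F) → Hom^d(E, E)`, `(f, g) ↦ f ∘ g`. -/
noncomputable def compositionMap (E F : T) (d i : ℤ) :
    ShiftedHom F E i →ₗ[k] ShiftedHom E F (d - i) →ₗ[k] ShiftedHom E E d :=
  LinearMap.mk₂ k (fun f g => g.comp f (by omega))
    (fun _ _ _ => ShiftedHom.comp_add _ _ _ _) (fun _ _ _ => ShiftedHom.comp_smul _ _ _ _)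
    (fun _ _ _ => ShiftedHom.add_comp _ _ _ _) (fun _ _ _ => ShiftedHom.smul_comp _ _ _ _)

/-- The subspace `k · id_E` of `Hom^d(E, E)` if `d = 0`, and the zero subspace if `d ≠ 0`. -/
noncomputable def identitySubspace (E : T) (d : ℤ) : Submodule k (ShiftedHom E E d) :=
  Submodule.span k {f | ∃ h : d = 0, f = ShiftedHom.mk₀ d h (𝟙 E)}

/-- The composition pairing `Hom^i(F, E) × Hom^(d-i)(E, F) → Hom^d(E, E) → k x`, where the second
map is the projection onto `Hom^d(E, E) / k · id_E` if `d = 0`. -/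
noncomputable def compositionPairing (E F : T) (d i : ℤ) :
    ShiftedHom F E i →ₗ[k] ShiftedHom E F (d - i) →ₗ[k]
      (ShiftedHom E E d ⧸ identitySubspace k E d) :=
  (compositionMap k E F d i).compr₂ (identitySubspace k E d).mkQ

end GradedHom

section Spherical

universe w v u

variable (k : Type*) [Field k] {C : Type u} [Category.{v} C] [Abelian C] [Linear k C]
  [HasDerivedCategory.{w} C]

/-- The objects of the bounded derived category `D^b(C)`, realised as the full subcategory of the
derived category on the complexes with bounded cohomology. -/
def IsBoundedComplex (F : DerivedCategory C) : Prop :=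
  (DerivedCategory.TStructure.t (C := C)).bounded F

/-- `E` is a `d`-spherelike object of `D^b(C)`. The graded space `Hom^*(X, Y)` has the components
`Hom^n(X, Y) = Hom(X, Y[n])`. -/
structure IsSpherelike (E : DerivedCategory C) (d : ℕ) : Prop where
  bounded : IsBoundedComplex E
  finite_from : ∀ F : DerivedCategory C, IsBoundedComplex F →
    Module.Finite k (⨁ n : ℤ, ShiftedHom E F n)
  finite_to : ∀ F : DerivedCategory C, IsBoundedComplex F →
    Module.Finite k (⨁ n : ℤ, ShiftedHom F E n)
  /-- `Hom^*(E, E)` and `k[x]/(x²)` are isomorphic as graded algebras. -/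
  endomorphisms : ∃ φ : (⨁ n : ℤ, GradedEnd E n) ≃ₐ[k]
      (Polynomial k ⧸ Ideal.span {(Polynomial.X ^ 2 : Polynomial k)}),
    ∀ n : ℤ, (LinearMap.range (DirectSum.lof k ℤ (GradedEnd E) n)).map φ.toLinearMap =
      truncPolyGrading k d n

/-- `E` is a `d`-spherical object of `D^b(C)`: it is `d`-spherelike and has the Calabi-Yau
property. -/
structure IsSpherical (E : DerivedCategory C) (d : ℕ) : Prop extends IsSpherelike k E d where
  calabiYau : ∀ F : DerivedCategory C, IsBoundedComplex F → ∀ i : ℤ,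
    (compositionPairing k E F d i).Nondegenerate

end Spherical

namespace SL2

/-- The complex Lie algebra `𝔰𝔩₂`. -/
abbrev sl2 := LieAlgebra.SpecialLinear.sl (Fin 2) ℂ

/-- The universal enveloping algebra `U(𝔰𝔩₂)`. -/
abbrev U := UniversalEnvelopingAlgebra ℂ sl2

/-- The standard basis of `𝔰𝔩₂`: `e` spans `𝔫`, `h` spans the Cartan subalgebra. -/
def matE : sl2 := ⟨!![0, 1; 0, 0], by
  simp [LieAlgebra.SpecialLinear.sl, Matrix.trace, Fin.sum_univ_two]⟩

def matH : sl2 := ⟨!![1, 0; 0, -1], by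
  simp [LieAlgebra.SpecialLinear.sl, Matrix.trace, Fin.sum_univ_two]⟩

def matF : sl2 := ⟨!![0, 0; 1, 0], by
  simp [LieAlgebra.SpecialLinear.sl, Matrix.trace, Fin.sum_univ_two]⟩

noncomputable def e : U := UniversalEnvelopingAlgebra.ι ℂ matE
noncomputable def h : U := UniversalEnvelopingAlgebra.ι ℂ matH
noncomputable def f : U := UniversalEnvelopingAlgebra.ι ℂ matF

attribute [local instance 100] LieRing.ofAssociativeRing

theorem h_mul_e : h * e = e * h + 2 • e := by
  have h1 : ⁅matH, matE⁆ = (2 : ℕ) • matE := by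
    ext i j
    fin_cases i <;> fin_cases j <;> norm_num [matH, matE, LieAlgebra.SpecialLinear.sl_bracket, Ring.lie_def]
  have h2 := congrArg (UniversalEnvelopingAlgebra.ι ℂ) h1
  rw [LieHom.map_lie, map_nsmul, Ring.lie_def] at h2
  rw [← sub_eq_iff_eq_add']; exact h2

theorem h_mul_f : h * f = f * h - 2 • f := by
  have h1 : ⁅matH, matF⁆ = -((2 : ℕ) • matF) := by
    ext i j
    fin_cases i <;> fin_cases j <;> norm_num [matH, matF, LieAlgebra.SpecialLinear.sl_bracket, Ring.lie_def]
  have h2 := congrArg (UniversalEnvelopingAlgebra.ι ℂ) h1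
  rw [LieHom.map_lie, map_neg, map_nsmul, Ring.lie_def] at h2
  rw [sub_eq_add_neg, ← sub_eq_iff_eq_add']; exact h2

theorem e_mul_f : e * f = f * e + h := by
  have h1 : ⁅matE, matF⁆ = matH := by
    ext i j
    fin_cases i <;> fin_cases j <;>
      norm_num [matH, matE, matF, LieAlgebra.SpecialLinear.sl_bracket, Ring.lie_def]
  have h2 := congrArg (UniversalEnvelopingAlgebra.ι ℂ) h1
  rw [LieHom.map_lie, Ring.lie_def] at h2
  rw [← sub_eq_iff_eq_add']; exact h2

theorem matrix_eq (x : sl2) : x = x.1 0 1 • matE + x.1 0 0 • matH + x.1 1 0 • matF := by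
  have hx : x.1 0 0 + x.1 1 1 = 0 := by
    have := x.2
    simpa [LieAlgebra.SpecialLinear.sl, Matrix.trace, Fin.sum_univ_two] using this
  ext i j
  fin_cases i <;> fin_cases j <;> simp [matE, matF, matH]
  linear_combination hx

theorem adjoin_range_ι :
    Algebra.adjoin ℂ (Set.range (UniversalEnvelopingAlgebra.ι ℂ : sl2 → U)) = ⊤ := by
  set S := Algebra.adjoin ℂ (Set.range (UniversalEnvelopingAlgebra.ι ℂ : sl2 → U)) with hS
  let g : sl2 →ₗ⁅ℂ⁆ S :=
    { toFun := fun x => ⟨UniversalEnvelopingAlgebra.ι ℂ x, Algebra.subset_adjoin ⟨x, rfl⟩⟩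
      map_add' := fun x y => by ext; simp
      map_smul' := fun c x => by ext; simp
      map_lie' := fun {x y} => by
        exact Subtype.ext (LieHom.map_lie (UniversalEnvelopingAlgebra.ι ℂ) x y) }
  have key : S.val.comp (UniversalEnvelopingAlgebra.lift ℂ g) = AlgHom.id ℂ U := by
    apply UniversalEnvelopingAlgebra.hom_ext
    ext x
    simp [g]
  rw [eq_top_iff]
  intro u _
  have := DFunLike.congr_fun key u
  rw [← show _ = u from this]
  exact (UniversalEnvelopingAlgebra.lift ℂ g u).2

section Modules

variable (M : Type) [AddCommGroup M] [Module ℂ M] [Module U M] [IsScalarTower ℂ U M]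

/-- The weight space `M_μ`; a weight of the Cartan subalgebra `ℂ h` is identified with its value
at `h`. -/
noncomputable def weightSpace (μ : ℂ) : Submodule ℂ M :=
  Module.End.eigenspace (Algebra.lsmul ℂ ℂ M h) μ

/-- `M` has a non-zero vector of weight `μ` that is annihilated by the subalgebra `𝔫 = ℂ e`. -/
def HasHighestWeightVector (μ : ℂ) : Prop :=
  ∃ v : M, v ≠ 0 ∧ v ∈ weightSpace M μ ∧ e • v = 0

/-- The `U(𝔰𝔩₂)`-module `M` belongs to category `𝓞`. As `U(𝔫) = ℂ[e]`, the space `U(𝔫) v` is spanned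
by the vectors `e ^ k v`. -/
structure IsInCategoryO : Prop where
  finitely_generated : Module.Finite U M
  weight_decomposition : DirectSum.IsInternal (weightSpace M)
  locally_n_finite : ∀ v : M,
    FiniteDimensional ℂ (Submodule.span ℂ (Set.range fun k : ℕ => e ^ k • v))

/-- The Weyl group `S₂ = {1, s}` of `𝔰𝔩₂`. -/
abbrev W := Equiv.Perm (Fin 2)

/-- The simple reflection. -/
def s : W := Equiv.swap 0 1

/-- The dot action `w · μ = w(μ + ρ) - ρ`; here `ρ(h) = 1`, and `s` acts on weights by `-1`. -/
def dotAction (w : W) (μ : ℂ) : ℂ := (Equiv.Perm.sign w : ℤ) * (μ + 1) - 1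

/-- `M` belongs to the principal block `𝓞₀`: it is a module in `𝓞` all of whose composition factors
(simple subquotients) are of highest weight `w · 0` for some `w ∈ W`. -/
structure IsInPrincipalBlock : Prop extends IsInCategoryO M where
  composition_factors : ∀ (N : Submodule U M) (K : Submodule U N), IsSimpleModule U (N ⧸ K) →
    ∃ w : W, HasHighestWeightVector (N ⧸ K) (dotAction w 0)

variable {M}

theorem mem_weightSpace {μ : ℂ} {v : M} : v ∈ weightSpace M μ ↔ h • v = μ • v := by
  simp [weightSpace]

theorem weightSpace_indep : iSupIndep (weightSpace M) :=
  Module.End.eigenspaces_iSupIndep _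

theorem isInternal_iff : DirectSum.IsInternal (weightSpace M) ↔ ⨆ μ, weightSpace M μ = ⊤ := by
  rw [DirectSum.isInternal_submodule_iff_iSupIndep_and_iSup_eq_top]
  exact ⟨fun hh => hh.2, fun hh => ⟨weightSpace_indep, hh⟩⟩

theorem eq_of_iSupIndep {ι : Type*} {s t : ι → Submodule ℂ M} (hs : iSupIndep s)
    (hts : ∀ i, t i ≤ s i) (ht : ⨆ i, t i = ⊤) (i : ι) : s i ≤ t i := by
  have h0 : t i ⊔ (⨆ (j) (_ : j ≠ i), t j) = ⊤ := by
    rw [eq_top_iff, ← ht]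
    refine iSup_le fun j => ?_
    by_cases hj : j = i
    · subst hj; exact le_sup_left
    · exact (le_iSup₂ (f := fun j (_ : j ≠ i) => t j) j hj).trans le_sup_right
  have h1 : s i = (t i ⊔ (⨆ (j) (_ : j ≠ i), t j)) ⊓ s i := by rw [h0, top_inf_eq]
  rw [h1, sup_inf_assoc_of_le _ (hts i)]
  refine sup_le le_rfl ?_
  have : (⨆ (j) (_ : j ≠ i), t j) ⊓ s i ≤ ⊥ := by
    refine le_trans (inf_le_inf_right _ (iSup₂_mono fun j _ => hts j)) ?_
    exact (hs i).symm.le_bot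
  exact this.trans bot_le

variable {M' : Type} [AddCommGroup M'] [Module ℂ M'] [Module U M'] [IsScalarTower ℂ U M']

theorem map_mem_weightSpace (g : M →ₗ[U] M') {μ : ℂ} {v : M} (hv : v ∈ weightSpace M μ) :
    g v ∈ weightSpace M' μ := by
  rw [mem_weightSpace] at *
  rw [← map_smul, hv]
  exact (g.restrictScalars ℂ).map_smul μ v

theorem map_iSup_weightSpace (hM : ⨆ μ, weightSpace M μ = ⊤) (g : M →ₗ[U] M')
    (hg : Function.Surjective g) :
    ⨆ μ, (weightSpace M μ).map (g.restrictScalars ℂ) = ⊤ := by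
  rw [← Submodule.map_iSup, hM, Submodule.map_top, LinearMap.range_eq_top]
  exact hg

theorem map_weightSpace_le (g : M →ₗ[U] M') (μ : ℂ) :
    (weightSpace M μ).map (g.restrictScalars ℂ) ≤ weightSpace M' μ := by
  rintro _ ⟨v, hv, rfl⟩
  exact map_mem_weightSpace g hv

theorem iSup_weightSpace_of_surjective (hM : ⨆ μ, weightSpace M μ = ⊤) (g : M →ₗ[U] M')
    (hg : Function.Surjective g) : ⨆ μ, weightSpace M' μ = ⊤ :=
  top_le_iff.1 ((map_iSup_weightSpace hM g hg).symm.le.trans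
    (iSup_mono fun μ => map_weightSpace_le g μ))

theorem exists_lift_weightSpace (hM : ⨆ μ, weightSpace M μ = ⊤) (g : M →ₗ[U] M')
    (hg : Function.Surjective g) {μ : ℂ} {q : M'} (hq : q ∈ weightSpace M' μ) :
    ∃ v ∈ weightSpace M μ, g v = q :=
  eq_of_iSupIndep weightSpace_indep (map_weightSpace_le g) (map_iSup_weightSpace hM g hg) μ hq

theorem iSup_weightSpace_of_injective (hM : ⨆ μ, weightSpace M μ = ⊤) (g : M' →ₗ[U] M)
    (hg : Function.Injective g) : ⨆ μ, weightSpace M' μ = ⊤ := by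
  rw [eq_top_iff]
  intro x _
  have hx : g x ∈ ⨆ μ, weightSpace M μ := by rw [hM]; trivial
  obtain ⟨m, hm, hsum⟩ := (Submodule.mem_iSup_iff_exists_finsupp _ _).1 hx
  have key := (iSupIndep_iff_finsetSum_eq_zero_imp_eq_zero
    (weightSpace (M ⧸ LinearMap.range g))).1 weightSpace_indep m.support
    (fun μ => (LinearMap.range g).mkQ (m μ))
    (fun μ _ => map_mem_weightSpace _ (hm μ)) (by
      rw [← map_sum]
      change (LinearMap.range g).mkQ (m.sum fun _ y => y) = 0
      rw [hsum]
      simp)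
  have hex : ∀ μ, ∃ y : M', g y = m μ := by
    intro μ
    by_cases hμ : μ ∈ m.support
    · have := key μ hμ
      rw [Submodule.mkQ_apply, Submodule.Quotient.mk_eq_zero] at this
      exact this
    · exact ⟨0, by simpa using (Finsupp.notMem_support_iff.1 hμ).symm⟩
  choose y hy using hex
  have hxy : x = ∑ μ ∈ m.support, y μ := by
    apply hg
    rw [map_sum]
    simp_rw [hy]
    exact hsum.symm
  rw [hxy]
  refine Submodule.sum_mem _ fun μ _ => Submodule.mem_iSup_of_mem μ ?_
  rw [mem_weightSpace]
  apply hg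
  have h1 := mem_weightSpace.1 (hm μ)
  rw [map_smul, hy, h1, ← hy]
  exact ((g.restrictScalars ℂ).map_smul μ (y μ)).symm

/-! Weight spaces of modules in category `𝓞` are finite dimensional. -/

theorem e_smul_mem {μ : ℂ} {v : M} (hv : v ∈ weightSpace M μ) :
    e • v ∈ weightSpace M (μ + 2) := by
  rw [mem_weightSpace] at *
  rw [← mul_smul, h_mul_e, add_smul, mul_smul, hv, smul_algebra_smul_comm, add_smul,
    smul_assoc]
  congr 1
  exact (ofNat_smul_eq_nsmul ℂ 2 (e • v)).symm

theorem f_smul_mem {μ : ℂ} {v : M} (hv : v ∈ weightSpace M μ) :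
    f • v ∈ weightSpace M (μ - 2) := by
  rw [mem_weightSpace] at *
  rw [← mul_smul, h_mul_f, sub_smul, mul_smul, hv, smul_algebra_smul_comm, sub_smul,
    smul_assoc]
  congr 1
  exact (ofNat_smul_eq_nsmul ℂ 2 (f • v)).symm

theorem e_pow_smul_mem {μ : ℂ} {v : M} (hv : v ∈ weightSpace M μ) (k : ℕ) :
    e ^ k • v ∈ weightSpace M (μ + 2 * k) := by
  induction k with
  | zero => simpa using hv
  | succ k ih =>
    rw [pow_succ', mul_smul]
    convert e_smul_mem ih using 1
    push_cast; ring_nf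

theorem f_pow_smul_mem {μ : ℂ} {v : M} (hv : v ∈ weightSpace M μ) (k : ℕ) :
    f ^ k • v ∈ weightSpace M (μ - 2 * k) := by
  induction k with
  | zero => simpa using hv
  | succ k ih =>
    rw [pow_succ', mul_smul]
    convert f_smul_mem ih using 1
    push_cast; ring_nf

theorem exists_e_pow_smul_eq_zero {μ : ℂ} {v : M} (hv : v ∈ weightSpace M μ)
    (hfin : FiniteDimensional ℂ (Submodule.span ℂ (Set.range fun k : ℕ => e ^ k • v))) :
    ∃ K : ℕ, ∀ k, K ≤ k → e ^ k • v = 0 := by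
  by_contra! hcon
  have hne : ∀ k : ℕ, e ^ k • v ≠ 0 := by
    intro k hk
    obtain ⟨l, hkl, hl⟩ := hcon k
    apply hl
    obtain ⟨j, rfl⟩ := Nat.exists_eq_add_of_le hkl
    rw [add_comm, pow_add, mul_smul, hk, smul_zero]
  have hli : LinearIndependent ℂ (fun k : ℕ => e ^ k • v) :=
    Module.End.eigenvectors_linearIndependent' (Algebra.lsmul ℂ ℂ M h) (fun k : ℕ => μ + 2 * k)
      (fun a b hab => by simpa using hab) _ (fun k => ⟨e_pow_smul_mem hv k, hne k⟩)
  have hli2 := linearIndependent_span hli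
  exact not_finite_iff_infinite.2 (inferInstance : Infinite ℕ) hli2.finite

theorem mem_of_stable (S : Submodule ℂ M) (he : ∀ v ∈ S, e • v ∈ S) (hh : ∀ v ∈ S, h • v ∈ S)
    (hf : ∀ v ∈ S, f • v ∈ S) (u : U) : ∀ v ∈ S, u • v ∈ S := by
  have hu : u ∈ Algebra.adjoin ℂ (Set.range (UniversalEnvelopingAlgebra.ι ℂ : sl2 → U)) := by
    rw [adjoin_range_ι]; trivial
  induction hu using Algebra.adjoin_induction with
  | mem x hx =>
    obtain ⟨y, rfl⟩ := hx
    intro v hv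
    rw [matrix_eq y]
    simp only [map_add, map_smul, add_smul, smul_assoc]
    exact S.add_mem (S.add_mem (S.smul_mem _ (he v hv)) (S.smul_mem _ (hh v hv)))
      (S.smul_mem _ (hf v hv))
  | algebraMap r => 
    intro v hv
    rw [algebraMap_smul]
    exact S.smul_mem _ hv
  | add x y _ _ hx hy => 
    intro v hv
    rw [add_smul]
    exact S.add_mem (hx v hv) (hy v hv)
  | mul x y _ _ hx hy => 
    intro v hv
    rw [mul_smul]
    exact hx _ (hy v hv)

theorem stable_span_pbw (T : Set M) (hT : ∀ v ∈ T, ∃ μ, v ∈ weightSpace M μ)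
    (u : U) : ∀ v ∈ Submodule.span ℂ {x : M | ∃ t ∈ T, ∃ a b : ℕ, x = f ^ a • e ^ b • t},
      u • v ∈ Submodule.span ℂ {x : M | ∃ t ∈ T, ∃ a b : ℕ, x = f ^ a • e ^ b • t} := by
  set X := {x : M | ∃ t ∈ T, ∃ a b : ℕ, x = f ^ a • e ^ b • t} with hX
  have hcomm : ∀ (y : U) (c : ℂ) (x : M), y • c • x = c • y • x := fun y c x =>
    smul_algebra_smul_comm c y x
  have aux : ∀ y : U, (∀ x ∈ X, y • x ∈ Submodule.span ℂ X) →
      ∀ x ∈ Submodule.span ℂ X, y • x ∈ Submodule.span ℂ X := by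
    intro y hy x hx
    induction hx using Submodule.span_induction with
    | mem x hx => exact hy x hx
    | zero => simp
    | add x z _ _ h1 h2 => rw [smul_add]; exact Submodule.add_mem _ h1 h2
    | smul c x _ h1 => rw [hcomm]; exact Submodule.smul_mem _ _ h1
  have hf1 : ∀ x ∈ X, f • x ∈ X := by
    rintro _ ⟨t, ht, a, b, rfl⟩
    exact ⟨t, ht, a + 1, b, by rw [← mul_smul, ← pow_succ']⟩
  have hh1 : ∀ x ∈ X, ∃ c : ℂ, h • x = c • x := by
    rintro _ ⟨t, ht, a, b, rfl⟩
    obtain ⟨μ, hμ⟩ := hT t ht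
    exact ⟨_, mem_weightSpace.1 (f_pow_smul_mem (e_pow_smul_mem hμ b) a)⟩
  have hF := aux f fun x hx => Submodule.subset_span (hf1 x hx)
  have hH := aux h fun x hx => by
    obtain ⟨c, hc⟩ := hh1 x hx
    rw [hc]
    exact Submodule.smul_mem _ _ (Submodule.subset_span hx)
  refine mem_of_stable _ (aux e ?_) hH hF u
  rintro _ ⟨t, ht, a, b, rfl⟩
  induction a with
  | zero => exact Submodule.subset_span ⟨t, ht, 0, b + 1, by simp [pow_succ', mul_smul]⟩
  | succ a ih =>
    rw [pow_succ', mul_smul, ← mul_smul e f, e_mul_f, add_smul, mul_smul]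
    exact Submodule.add_mem _ (hF _ ih) (hH _ (Submodule.subset_span ⟨t, ht, a, b, rfl⟩))

theorem exists_finite_weight_generators (hM : IsInCategoryO M) :
    ∃ T : Set M, T.Finite ∧ (∀ v ∈ T, ∃ μ, v ∈ weightSpace M μ) ∧ Submodule.span U T = ⊤ := by
  classical
  obtain ⟨G, hG⟩ := hM.finitely_generated.fg_top
  have hsup := isInternal_iff.1 hM.weight_decomposition
  have hex : ∀ x : M, ∃ m : ℂ →₀ M, (∀ μ, m μ ∈ weightSpace M μ) ∧ (m.sum fun _ y => y) = x :=
    fun x => (Submodule.mem_iSup_iff_exists_finsupp _ _).1 (hsup ▸ Submodule.mem_top)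
  choose m hm hsum using hex
  refine ⟨⋃ x ∈ G, (fun μ => m x μ) '' ((m x).support : Set ℂ),
    G.finite_toSet.biUnion fun x _ => ((m x).support.finite_toSet).image _, ?_, ?_⟩
  · intro v hv
    simp only [Set.mem_iUnion] at hv
    obtain ⟨x, _, μ, _, rfl⟩ := hv
    exact ⟨μ, hm x μ⟩
  · rw [eq_top_iff, ← hG, Submodule.span_le]
    intro x hx
    rw [← hsum x]
    refine Submodule.sum_mem _ fun μ hμ => Submodule.subset_span ?_
    simp only [Set.mem_iUnion]
    exact ⟨x, hx, μ, hμ, rfl⟩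

theorem finiteDimensional_weightSpace (hM : IsInCategoryO M) (μ : ℂ) :
    FiniteDimensional ℂ (weightSpace M μ) := by
  classical
  obtain ⟨T, hTfin, hTw, hTspan⟩ := exists_finite_weight_generators hM
  set X := {x : M | ∃ t ∈ T, ∃ a b : ℕ, x = f ^ a • e ^ b • t} with hX
  have hspan : Submodule.span ℂ X = ⊤ := by
    rw [eq_top_iff]
    intro x _
    have hx : x ∈ Submodule.span U T := by rw [hTspan]; trivial
    induction hx using Submodule.span_induction with
    | mem x hx => exact Submodule.subset_span ⟨x, hx, 0, 0, by simp⟩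
    | zero => exact Submodule.zero_mem _
    | add x z _ _ h1 h2 => exact Submodule.add_mem _ (h1 trivial) (h2 trivial)
    | smul c x _ h1 => exact stable_span_pbw T hTw c x (h1 trivial)
  have hXw : ∀ x ∈ X, ∃ ν, x ∈ weightSpace M ν := by
    rintro _ ⟨t, ht, a, b, rfl⟩
    obtain ⟨ν, hν⟩ := hTw t ht
    exact ⟨_, f_pow_smul_mem (e_pow_smul_mem hν b) a⟩
  have hle : weightSpace M μ ≤ Submodule.span ℂ (X ∩ weightSpace M μ) := by
    refine eq_of_iSupIndep (t := fun ν => Submodule.span ℂ (X ∩ weightSpace M ν))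
      weightSpace_indep (fun ν => Submodule.span_le.2 Set.inter_subset_right) ?_ μ
    rw [eq_top_iff, ← hspan, Submodule.span_le]
    intro x hx
    obtain ⟨ν, hν⟩ := hXw x hx
    exact Submodule.mem_iSup_of_mem ν (Submodule.subset_span ⟨hx, hν⟩)
  choose! wt hwt using hTw
  have hK : ∀ t ∈ T, ∃ K : ℕ, ∀ k, K ≤ k → e ^ k • t = 0 := fun t ht =>
    exists_e_pow_smul_eq_zero (hwt t ht) (hM.locally_n_finite t)
  choose! K hK using hK
  have hfin : (X ∩ weightSpace M μ).Finite := by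
    have hbig : (⋃ t ∈ T, ⋃ b ∈ Set.Iio (K t),
        (fun a : ℕ => f ^ a • e ^ b • t) '' {a : ℕ | wt t + 2 * b - 2 * a = μ}).Finite := by
      refine hTfin.biUnion fun t _ => (Set.finite_Iio _).biUnion fun b _ => Set.Finite.image _ ?_
      refine Set.Subsingleton.finite fun a ha a' ha' => ?_
      have : (a : ℂ) = a' := by
        have h1 : wt t + 2 * b - 2 * a = μ := ha
        have h2 : wt t + 2 * b - 2 * a' = μ := ha'
        linear_combination (h2 - h1) / 2
      exact_mod_cast this
    refine (hbig.union (Set.finite_singleton (0 : M))).subset ?_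
    rintro _ ⟨⟨t, ht, a, b, rfl⟩, hx⟩
    by_cases hz : f ^ a • e ^ b • t = 0
    · exact Or.inr hz
    · left
      simp only [Set.mem_iUnion]
      refine ⟨t, ht, b, ?_, a, ?_, rfl⟩
      · by_contra hb
        rw [hK t ht b (not_lt.1 hb), smul_zero] at hz
        exact hz rfl
      · have h1 := mem_weightSpace.1 (f_pow_smul_mem (e_pow_smul_mem (hwt t ht) b) a)
        have h2 := mem_weightSpace.1 hx
        exact smul_left_injective ℂ hz (h1.symm.trans h2)
  have := FiniteDimensional.span_of_finite ℂ hfin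
  exact Submodule.finiteDimensional_of_le hle

theorem HasHighestWeightVector.of_equiv {μ : ℂ} (hM : HasHighestWeightVector M μ)
    (g : M ≃ₗ[U] M') : HasHighestWeightVector M' μ := by
  obtain ⟨v, hv0, hv, hev⟩ := hM
  refine ⟨g v, by simpa using hv0, map_mem_weightSpace g.toLinearMap hv, ?_⟩
  rw [← map_smul, hev, map_zero]

theorem IsInPrincipalBlock.of_subquotient (hM : IsInPrincipalBlock M)
    {N : Type} [AddCommGroup N] [Module U N]
    {S : Type} [AddCommGroup S] [Module ℂ S] [Module U S] [IsScalarTower ℂ U S]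
    (hS : IsSimpleModule U S) (g : N →ₗ[U] M) (hg : Function.Injective g)
    (p : N →ₗ[U] S) (hp : Function.Surjective p) :
    ∃ w : W, HasHighestWeightVector S (dotAction w 0) := by
  let i := LinearEquiv.ofInjective g hg
  let q : LinearMap.range g →ₗ[U] S := p.comp i.symm.toLinearMap
  have hq : Function.Surjective q := hp.comp i.symm.surjective
  let j := q.quotKerEquivOfSurjective hq
  obtain ⟨w, hw⟩ := hM.composition_factors (LinearMap.range g) (LinearMap.ker q)
    (IsSimpleModule.congr j)
  exact ⟨w, hw.of_equiv j⟩

theorem IsInPrincipalBlock.isNoetherian (hM : IsInPrincipalBlock M) : IsNoetherian U M := by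
  have hsup := isInternal_iff.1 hM.weight_decomposition
  let Z : Submodule ℂ M := ⨆ w : W, weightSpace M (dotAction w 0)
  have hZ : FiniteDimensional ℂ Z := by
    have := fun w : W => finiteDimensional_weightSpace hM.toIsInCategoryO (dotAction w 0)
    exact Submodule.finite_iSup _
  let φ : Submodule U M → Submodule ℂ Z := fun A => (A.restrictScalars ℂ).comap Z.subtype
  have hφ : StrictMono φ := by
    intro A B hAB
    refine lt_of_le_of_ne (fun x hx => hAB.le hx) fun heq => ?_
    obtain ⟨b, hbB, hbA⟩ := Set.exists_of_ssubset hAB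
    let N : Submodule U M := Submodule.span U {b}
    have hNB : N ≤ B := Submodule.span_le.2 (by simpa using hbB)
    have hfinN : Module.Finite U N := Module.Finite.of_fg (Submodule.fg_span_singleton b)
    have hne : A.comap N.subtype ≠ ⊤ := by
      intro htop
      have : (⟨b, Submodule.mem_span_singleton_self b⟩ : N) ∈ A.comap N.subtype := by
        rw [htop]; trivial
      exact hbA this
    obtain ⟨K, hK, hAK⟩ := (eq_top_or_exists_le_coatom (A.comap N.subtype)).resolve_left hne
    obtain ⟨w, q, hq0, hq, -⟩ := hM.composition_factors N K (isSimpleModule_iff_isCoatom.2 hK)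
    obtain ⟨v, hv, rfl⟩ := exists_lift_weightSpace
      (iSup_weightSpace_of_injective hsup N.subtype N.injective_subtype) K.mkQ K.mkQ_surjective hq
    have hvZ : (v : M) ∈ Z := Submodule.mem_iSup_of_mem w (map_mem_weightSpace N.subtype hv)
    have hvφ : (⟨v, hvZ⟩ : Z) ∈ φ B := hNB v.2
    rw [← heq] at hvφ
    apply hq0
    rw [Submodule.mkQ_apply, Submodule.Quotient.mk_eq_zero]
    exact hAK hvφ
  rw [isNoetherian_iff']
  exact hφ.wellFoundedGT

theorem IsInPrincipalBlock.of_surjective (hM : IsInPrincipalBlock M) (g : M →ₗ[U] M')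
    (hg : Function.Surjective g) : IsInPrincipalBlock M' where
  finitely_generated := by
    have := hM.finitely_generated
    exact Module.Finite.of_surjective g hg
  weight_decomposition := isInternal_iff.2
    (iSup_weightSpace_of_surjective (isInternal_iff.1 hM.weight_decomposition) g hg)
  locally_n_finite v := by
    obtain ⟨v, rfl⟩ := hg v
    have := hM.locally_n_finite v
    have h1 : (Set.range fun k : ℕ => e ^ k • g v) =
        (g.restrictScalars ℂ) '' (Set.range fun k : ℕ => e ^ k • v) := by
      rw [← Set.range_comp]
      congr 1
      ext k
      simp
    rw [h1, ← Submodule.map_span]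
    infer_instance
  composition_factors N K hNK := by
    refine hM.of_subquotient (N := N.comap g) hNK (N.comap g).subtype
      (N.comap g).injective_subtype (K.mkQ.comp (g.restrict (q := N) (p := N.comap g) fun x hx => hx))
      (K.mkQ_surjective.comp ?_)
    rintro ⟨y, hy⟩
    obtain ⟨x, rfl⟩ := hg y
    exact ⟨⟨x, hy⟩, rfl⟩

theorem locally_n_finite_of_injective (hM : ∀ v : M,
      FiniteDimensional ℂ (Submodule.span ℂ (Set.range fun k : ℕ => e ^ k • v)))
    (g : M' →ₗ[U] M) (hg : Function.Injective g) (v : M') :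
    FiniteDimensional ℂ (Submodule.span ℂ (Set.range fun k : ℕ => e ^ k • v)) := by
  have := hM (g v)
  have h1 : (Set.range fun k : ℕ => e ^ k • g v) =
      (g.restrictScalars ℂ) '' (Set.range fun k : ℕ => e ^ k • v) := by
    rw [← Set.range_comp]
    congr 1
    ext k
    simp
  rw [h1, ← Submodule.map_span] at this
  exact (Submodule.equivMapOfInjective (g.restrictScalars ℂ) hg _).symm.finiteDimensional

theorem IsInPrincipalBlock.of_injective (hM : IsInPrincipalBlock M) (g : M' →ₗ[U] M)
    (hg : Function.Injective g) : IsInPrincipalBlock M' where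
  finitely_generated := by
    have := hM.isNoetherian
    exact Module.Finite.of_injective g hg
  weight_decomposition := isInternal_iff.2
    (iSup_weightSpace_of_injective (isInternal_iff.1 hM.weight_decomposition) g hg)
  locally_n_finite := locally_n_finite_of_injective hM.locally_n_finite g hg
  composition_factors N K hNK :=
    hM.of_subquotient (N := N) hNK (g.comp N.subtype) (hg.comp N.injective_subtype) K.mkQ
      K.mkQ_surjective

theorem IsInPrincipalBlock.prod (hM : IsInPrincipalBlock M) (hM' : IsInPrincipalBlock M') :
    IsInPrincipalBlock (M × M') where
  finitely_generated := by
    have := hM.finitely_generated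
    have := hM'.finitely_generated
    infer_instance
  weight_decomposition := by
    rw [isInternal_iff, eq_top_iff]
    rintro ⟨x, y⟩ -
    have hx : x ∈ ⨆ μ, weightSpace M μ := by
      rw [isInternal_iff.1 hM.weight_decomposition]; trivial
    have hy : y ∈ ⨆ μ, weightSpace M' μ := by
      rw [isInternal_iff.1 hM'.weight_decomposition]; trivial
    have h1 := Submodule.mem_map_of_mem (f := (LinearMap.inl U M M').restrictScalars ℂ) hx
    have h2 := Submodule.mem_map_of_mem (f := (LinearMap.inr U M M').restrictScalars ℂ) hy
    rw [Submodule.map_iSup] at h1 h2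
    have h3 := Submodule.add_mem _
      (iSup_mono (fun μ => map_weightSpace_le (LinearMap.inl U M M') μ) h1)
      (iSup_mono (fun μ => map_weightSpace_le (LinearMap.inr U M M') μ) h2)
    simpa using h3
  locally_n_finite := by
    rintro ⟨x, y⟩
    have hfg : FiniteDimensional ℂ ((Submodule.span ℂ (Set.range fun k : ℕ => e ^ k • x)).prod
        (Submodule.span ℂ (Set.range fun k : ℕ => e ^ k • y))) := Module.Finite.of_fg
      (Submodule.FG.prod (Module.Finite.iff_fg.1 (hM.locally_n_finite x))
        (Module.Finite.iff_fg.1 (hM'.locally_n_finite y)))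
    refine Submodule.finiteDimensional_of_le
      (S₂ := (Submodule.span ℂ (Set.range fun k : ℕ => e ^ k • x)).prod
        (Submodule.span ℂ (Set.range fun k : ℕ => e ^ k • y))) (Submodule.span_le.2 ?_)
    rintro _ ⟨k, rfl⟩
    exact ⟨Submodule.subset_span ⟨k, rfl⟩, Submodule.subset_span ⟨k, rfl⟩⟩
  composition_factors N K hNK := by
    let r : N →ₗ[U] M' := (LinearMap.snd U M M').comp N.subtype
    let p := K.mkQ.comp (LinearMap.ker r).subtype
    have hp : Function.Surjective p ∨ p = 0 := by
      rcases eq_bot_or_eq_top (LinearMap.range p) with hp | hp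
      · exact Or.inr (LinearMap.range_eq_bot.1 hp)
      · exact Or.inl (LinearMap.range_eq_top.1 hp)
    rcases hp with hp | hp
    · refine hM.of_subquotient (N := LinearMap.ker r) hNK (((LinearMap.fst U M M').comp N.subtype).comp
        (LinearMap.ker r).subtype) ?_ p hp
      rintro ⟨⟨⟨x, y⟩, hxy⟩, hy⟩ ⟨⟨⟨x', y'⟩, hxy'⟩, hy'⟩ (hh : x = x')
      have h1 : y = 0 := hy
      have h2 : y' = 0 := hy'
      subst hh h1 h2
      rfl
    · have hker : LinearMap.ker r ≤ LinearMap.ker K.mkQ := fun x hx =>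
        DFunLike.congr_fun hp (⟨x, hx⟩ : LinearMap.ker r)
      refine hM'.of_subquotient hNK ((LinearMap.ker r).liftQ r le_rfl)
        (LinearMap.ker_eq_bot.1 (Submodule.ker_liftQ_eq_bot _ _ _ le_rfl))
        ((LinearMap.ker r).liftQ K.mkQ hker) ?_
      intro x
      obtain ⟨y, rfl⟩ := K.mkQ_surjective x
      exact ⟨(LinearMap.ker r).mkQ y, rfl⟩

theorem isInPrincipalBlock_of_subsingleton [Subsingleton M] : IsInPrincipalBlock M where
  finitely_generated := inferInstance
  weight_decomposition := isInternal_iff.2 (Subsingleton.elim _ _)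
  locally_n_finite _ := inferInstance
  composition_factors N K hNK := by
    have := hNK.nontrivial
    exact (not_subsingleton (N ⧸ K) inferInstance).elim

end Modules

section Category

universe v

open scoped ModuleCat
open CategoryTheory.Limits

/-- The principal block `𝓞₀` as a property of `U(𝔰𝔩₂)`-modules. -/
def principalBlock : ObjectProperty (ModuleCat.{0} U) := fun M => IsInPrincipalBlock M

instance : principalBlock.IsClosedUnderSubobjects where
  prop_of_mono g _ hY := IsInPrincipalBlock.of_injective hY g.hom
    ((ModuleCat.mono_iff_injective g).1 inferInstance)

instance : principalBlock.IsClosedUnderQuotients where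
  prop_of_epi g _ hX := IsInPrincipalBlock.of_surjective hX g.hom
    ((ModuleCat.epi_iff_surjective g).1 inferInstance)

instance : principalBlock.ContainsZero where
  exists_zero := ⟨ModuleCat.of U PUnit, ModuleCat.isZero_of_subsingleton _,
    isInPrincipalBlock_of_subsingleton (M := PUnit)⟩

instance : principalBlock.IsClosedUnderBinaryProducts where
  limitsOfShape_le := by
    rintro X ⟨L⟩
    let A := L.diag.obj ⟨WalkingPair.left⟩
    let B := L.diag.obj ⟨WalkingPair.right⟩
    have hA : IsInPrincipalBlock A := L.prop_diag_obj _
    have hB : IsInPrincipalBlock B := L.prop_diag_obj _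
    refine IsInPrincipalBlock.of_injective (hA.prod hB)
      ((L.π.app ⟨WalkingPair.left⟩).hom.prod (L.π.app ⟨WalkingPair.right⟩).hom) ?_
    rw [injective_iff_map_eq_zero]
    intro z hz
    have h1 : ModuleCat.ofHom (LinearMap.toSpanSingleton U X z) = 0 := by
      refine L.isLimit.hom_ext ?_
      rintro ⟨_ | _⟩
      · ext
        simpa using congrArg Prod.fst hz
      · ext
        simpa using congrArg Prod.snd hz
    have h2 := congrArg (fun t => t.hom (1 : U)) h1
    simpa using h2

instance : principalBlock.IsClosedUnderFiniteProducts := .mk'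

/-- The principal block `𝓞₀` of category `𝓞` of `𝔰𝔩₂`, a `ℂ`-linear abelian category. -/
abbrev O₀ := principalBlock.FullSubcategory

/-- `L` is the simple module `L(w)` of highest weight `w · 0`. -/
def IsSimpleObject (w : W) (L : O₀) : Prop :=
  IsSimpleModule U L.obj ∧ HasHighestWeightVector L.obj (dotAction w 0)

/-- `P` is the indecomposable projective `P(w)`, i.e. the one that surjects onto `L(w)`. -/
def IsIndecomposableProjective (w : W) (P : O₀) : Prop :=
  Projective P ∧ Indecomposable P ∧ ∃ L : O₀, IsSimpleObject w L ∧ ∃ π : P ⟶ L, Epi π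

/-- A module in `𝓞₀`, regarded as a complex concentrated in degree zero. -/
noncomputable abbrev asComplex [HasDerivedCategory.{v} O₀] (M : O₀) : DerivedCategory O₀ :=
  (DerivedCategory.singleFunctor O₀ 0).obj M

end Category

end SL2

universe w₀

/-! ### Duality along a linear form, and its stability under triangles. -/

section Duality

open Limits Pretriangulated ZeroObject

universe v u

variable (k : Type*) [Field k] {T : Type u} [Category.{v} T] [Preadditive T] [Linear k T]

/-! The Calabi–Yau property and the finiteness conditions are combined into one property that
propagates through triangles. Fix a linear form φ on Hom(E, E[d]) whose kernel is the identity
subspace, and consider the objects F such that every Hom(E, F[n]) is finite dimensional, almost all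
of them vanish, and φ identifies Hom(F[n], E[d]) with the dual of Hom(E, F[n]). By the five lemma
these objects form a triangulated subcategory (`dualObjects_of_distinguished`). Membership of F
gives nondegeneracy of the pairing and finiteness of both graded Hom spaces, so it suffices to test
generators of the bounded derived category.

Let A = L(1), let S = L(s), which is the Verma module of highest weight -2, let V = P(1), the Verma
module of highest weight 0, and let P = P(s). The block is controlled by the short exact sequences 0
→ S → V → A → 0 and 0 → V → P → S → 0, with maps i, π and j, q. Truncation reduces bounded complexes
to modules (`prop_of_isBoundedComplex`), dévissage reduces modules to A and S, and the two sequences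
reduce these to V and P (`BlockData.dualObjects_single`).

For E = P, everything is in degree 0. Here End(P) is spanned by the identity and ξ = q i j with ξ² =
0; Hom(P, V) and Hom(V, P) are spanned by q i and j, whose composite is ξ. A form vanishing on the
identity but not on ξ is therefore perfect on both generators.

For E = A, the long exact sequences give Hom^*(A, P) = 0 and show that Hom^*(A, V) is concentrated
in degree 2 and spanned by the product ε of the two connecting morphisms. Composing ε with π gives
γ, which is nonzero and spans Hom²(A, A). Hence V pairs perfectly with A, and both sides vanish for
P.

The inputs about 𝔰𝔩₂ come from explicit models (`exists_blockData`). The module `Big` is generated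
by a vector v of weight -2 with e² v = 0. The square of the Casimir element kills it, which puts it
in the principal block. In that block no vector has weight 2, so weight vectors of weight 0 and -2
automatically satisfy the defining relations of V and `Big`; lifting weight vectors proves
projectivity. The kernel of the projection from `Big` to S is superfluous
(`surjective_of_bigToVerma_comp_surjective`), which yields indecomposability and uniqueness of P(s).
-/

/-- The map `Hom(G, X) → Hom(E, G)^*` induced by composition and a linear form on `Hom(E, X)`. -/
noncomputable def homToDual {E X : T} (φ : (E ⟶ X) →ₗ[k] k) (G : T) :
    (G ⟶ X) →ₗ[k] Module.Dual k (E ⟶ G) :=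
  LinearMap.mk₂ k (fun f g => φ (g ≫ f)) (by simp) (by simp) (by simp) (by simp)

/-- `Hom(G, X)` is the dual of the finite dimensional space `Hom(E, G)`. -/
structure IsDualAt {E X : T} (φ : (E ⟶ X) →ₗ[k] k) (G : T) : Prop where
  finite : Module.Finite k (E ⟶ G)
  bijective : Function.Bijective (homToDual k φ G)

variable {k}

@[simp]
theorem homToDual_apply {E X : T} (φ : (E ⟶ X) →ₗ[k] k) (G : T) (f : G ⟶ X) (g : E ⟶ G) :
    homToDual k φ G f g = φ (g ≫ f) := rfl

theorem dualMap_exact {V₁ V₂ V₃ : Type*} [AddCommGroup V₁] [AddCommGroup V₂] [AddCommGroup V₃]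
    [Module k V₁] [Module k V₂] [Module k V₃] {a : V₁ →ₗ[k] V₂} {b : V₂ →ₗ[k] V₃}
    (hab : Function.Exact a b) : Function.Exact b.dualMap a.dualMap := by
  rw [LinearMap.exact_iff] at *
  rw [LinearMap.ker_dualMap_eq_dualAnnihilator_range,
    LinearMap.range_dualMap_eq_dualAnnihilator_ker, hab]

theorem IsDualAt.of_iso {E X : T} {φ : (E ⟶ X) →ₗ[k] k} {G G' : T} (hG : IsDualAt k φ G)
    (i : G ≅ G') : IsDualAt k φ G' := by
  have := hG.finite
  refine ⟨Module.Finite.equiv (Linear.homCongr k (Iso.refl E) i), ?_⟩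
  have h1 : homToDual k φ G' = (Linear.homCongr k (Iso.refl E) i.symm).dualMap.toLinearMap ∘ₗ
      homToDual k φ G ∘ₗ (Linear.homCongr k i.symm (Iso.refl X)).toLinearMap := by
    ext f g
    simp [homToDual, Linear.homCongr]
  rw [h1]
  exact (LinearEquiv.bijective (Linear.homCongr k (Iso.refl E) i.symm).dualMap).comp
    (hG.bijective.comp (Linear.homCongr k i.symm (Iso.refl X)).bijective)

variable [HasShift T ℤ]

/-- The objects `F` such that `Hom(F[n], X)` is the dual of the finite dimensional space
`Hom(E, F[n])` for all `n`, and such that these spaces vanish for almost all `n`. -/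
def dualObjects {E X : T} (φ : (E ⟶ X) →ₗ[k] k) : ObjectProperty T := fun F =>
  (∀ n : ℤ, IsDualAt k φ (F⟦n⟧)) ∧ {n : ℤ | ¬ Subsingleton (E ⟶ F⟦n⟧)}.Finite

theorem dualObjects_shift {E X : T} (φ : (E ⟶ X) →ₗ[k] k) {F : T} (hF : dualObjects φ F) (a : ℤ) :
    dualObjects φ (F⟦a⟧) := by
  refine ⟨fun n => (hF.1 (a + n)).of_iso ((shiftFunctorAdd T a n).app F), ?_⟩
  refine (hF.2.preimage (f := fun n => a + n) (add_right_injective a).injOn).subset fun n hn hs => ?_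
  exact hn ((Linear.homCongr k (Iso.refl E) ((shiftFunctorAdd T a n).app F)).symm.injective.subsingleton)

variable [∀ n : ℤ, (shiftFunctor T n).Additive]

theorem dualObjects_zero {E X : T} (φ : (E ⟶ X) →ₗ[k] k) {F : T} (hF : IsZero F) :
    dualObjects φ F := by
  have h0 : ∀ n : ℤ, IsZero (F⟦n⟧) := fun n => (shiftFunctor T n).map_isZero hF
  have h1 : ∀ n : ℤ, Subsingleton (E ⟶ F⟦n⟧) := fun n => ⟨fun _ _ => (h0 n).eq_of_tgt _ _⟩
  have h2 : ∀ n : ℤ, Subsingleton (F⟦n⟧ ⟶ X) := fun n => ⟨fun _ _ => (h0 n).eq_of_src _ _⟩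
  refine ⟨fun n => ⟨inferInstance, ⟨fun _ _ _ => Subsingleton.elim _ _, fun y => ⟨0, ?_⟩⟩⟩, ?_⟩
  · ext g
    simp [Subsingleton.elim g 0]
  · simp [h1]

variable [HasZeroObject T] [Pretriangulated T]

theorem rightComp_exact (E : T) (Δ : Triangle T) (hΔ : Δ ∈ distTriang T) :
    Function.Exact (Linear.rightComp k E Δ.mor₁) (Linear.rightComp k E Δ.mor₂) := by
  intro f
  constructor
  · intro hf
    obtain ⟨g, hg⟩ := Triangle.coyoneda_exact₂ Δ hΔ f hf
    exact ⟨g, hg.symm⟩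
  · rintro ⟨g, rfl⟩
    simp [comp_distTriang_mor_zero₁₂ _ hΔ]

theorem leftComp_exact (X : T) (Δ : Triangle T) (hΔ : Δ ∈ distTriang T) :
    Function.Exact (Linear.leftComp k X Δ.mor₂) (Linear.leftComp k X Δ.mor₁) := by
  intro f
  constructor
  · intro hf
    obtain ⟨g, hg⟩ := Triangle.yoneda_exact₂ Δ hΔ f hf
    exact ⟨g, hg.symm⟩
  · rintro ⟨g, rfl⟩
    simp [comp_distTriang_mor_zero₁₂_assoc _ hΔ]

/-- The image in the third Hom space is finite dimensional, and the kernel of that map is the image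
of the first Hom space. -/
theorem finite_hom_of_distinguished (E : T) (Δ : Triangle T) (hΔ : Δ ∈ distTriang T)
    (h₁ : Module.Finite k (E ⟶ Δ.obj₁)) (h₃ : Module.Finite k (E ⟶ Δ.obj₃)) :
    Module.Finite k (E ⟶ Δ.obj₂) := by
  have hex := LinearMap.exact_iff.1 (rightComp_exact (k := k) E Δ hΔ)
  refine ⟨Submodule.fg_of_fg_map_of_fg_inf_ker (Linear.rightComp k E Δ.mor₂)
    (IsNoetherian.noetherian _) ?_⟩
  rw [top_inf_eq, hex, LinearMap.range_eq_map]
  exact Module.Finite.fg_top.map _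

/-- Five lemma for the contravariant long exact sequence into X and the dual of the covariant one
out of E; the squares commute by associativity of composition. The outer terms involve the third
object shifted by -1 and the first shifted by 1. -/
theorem IsDualAt.of_distinguished {E X : T} {φ : (E ⟶ X) →ₗ[k] k} (Δ : Triangle T)
    (hΔ : Δ ∈ distTriang T) (h₁ : IsDualAt k φ Δ.obj₁) (h₃ : IsDualAt k φ Δ.obj₃)
    (h₀ : IsDualAt k φ (Δ.obj₃⟦(-1 : ℤ)⟧)) (h₄ : IsDualAt k φ (Δ.obj₁⟦(1 : ℤ)⟧)) :
    IsDualAt k φ Δ.obj₂ := by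
  refine ⟨finite_hom_of_distinguished E Δ hΔ h₁.finite h₃.finite, ?_⟩
  refine LinearMap.bijective_of_surjective_of_bijective_of_bijective_of_injective
    (Linear.leftComp k X Δ.mor₃) (Linear.leftComp k X Δ.mor₂) (Linear.leftComp k X Δ.mor₁)
    (Linear.leftComp k X Δ.invRotate.mor₁)
    (Linear.rightComp k E Δ.mor₃).dualMap (Linear.rightComp k E Δ.mor₂).dualMap
    (Linear.rightComp k E Δ.mor₁).dualMap (Linear.rightComp k E Δ.invRotate.mor₁).dualMap
    (homToDual k φ _) (homToDual k φ _) (homToDual k φ _) (homToDual k φ _) (homToDual k φ _)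
    ?_ ?_ ?_ ?_ ?_ ?_ ?_ ?_ ?_ ?_ h₄.bijective.2 h₃.bijective h₁.bijective h₀.bijective.1
  · ext; simp
  · ext; simp
  · ext; simp
  · ext f g
    exact congrArg φ (Category.assoc _ _ _)
  · exact leftComp_exact X _ (rot_of_distTriang _ hΔ)
  · exact leftComp_exact X _ hΔ
  · exact leftComp_exact X _ (inv_rot_of_distTriang _ hΔ)
  · exact dualMap_exact (rightComp_exact E _ (rot_of_distTriang _ hΔ))
  · exact dualMap_exact (rightComp_exact E _ hΔ)
  · exact dualMap_exact (rightComp_exact E _ (inv_rot_of_distTriang _ hΔ))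

theorem dualObjects_of_distinguished {E X : T} (φ : (E ⟶ X) →ₗ[k] k) (Δ : Triangle T)
    (hΔ : Δ ∈ distTriang T) (h₁ : dualObjects φ Δ.obj₁) (h₃ : dualObjects φ Δ.obj₃) :
    dualObjects φ Δ.obj₂ := by
  refine ⟨fun n => ?_, (h₁.2.union h₃.2).subset fun n hn => ?_⟩
  -- The two outer terms of the five lemma are again shifts of the given objects, which is why
  -- membership quantifies over all shifts.
  · exact IsDualAt.of_distinguished _ (Δ.shift_distinguished hΔ n) (h₁.1 n) (h₃.1 n)
      ((dualObjects_shift φ h₃ n).1 (-1)) ((dualObjects_shift φ h₁ n).1 1)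
  · by_contra hcon
    simp only [Set.mem_union, Set.mem_ofPred_eq, not_or, not_not] at hcon
    obtain ⟨h1, h3⟩ := hcon
    refine hn ⟨fun a b => ?_⟩
    have key : ∀ a : E ⟶ Δ.obj₂⟦n⟧, a = 0 := fun a => by
      obtain ⟨g, hg⟩ := Triangle.coyoneda_exact₂ _ (Δ.shift_distinguished hΔ n) a
        (h3.elim _ _)
      rw [hg]
      exact (congrArg (· ≫ _) (h1.elim g 0)).trans zero_comp
    rw [key a, key b]

instance {E X : T} (φ : (E ⟶ X) →ₗ[k] k) : (dualObjects φ).IsClosedUnderIsomorphisms where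
  of_iso {F F'} i hF := by
    refine ⟨fun n => (hF.1 n).of_iso ((shiftFunctor T n).mapIso i), hF.2.subset fun n hn hs => hn ?_⟩
    exact (Linear.homCongr k (Iso.refl E) ((shiftFunctor T n).mapIso i)).symm.injective.subsingleton

instance {E X : T} (φ : (E ⟶ X) →ₗ[k] k) : (dualObjects φ).IsTriangulated where
  exists_zero := ⟨0, isZero_zero T, dualObjects_zero φ (isZero_zero T)⟩
  isStableUnderShiftBy a := ⟨fun _ hF => dualObjects_shift φ hF a⟩
  toIsTriangulatedClosed₂ := .mk' fun Δ hΔ h₁ h₃ => dualObjects_of_distinguished φ Δ hΔ h₁ h₃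

end Duality

/-! ### The algebra of dual numbers and finite direct sums. -/

section Algebra

open Polynomial

variable {k : Type*} [Field k]

theorem aeval_eq_of_sq_eq_zero {B : Type*} [Ring B] [Algebra k B] {x : B} (hx : x * x = 0)
    (p : k[X]) : aeval x p = p.coeff 0 • (1 : B) + p.coeff 1 • x := by
  conv_lhs => rw [← p.divX_mul_X_add, ← p.divX.divX_mul_X_add]
  simp [add_mul, mul_assoc, hx, Algebra.algebraMap_eq_smul_one, add_comm]

/-- An algebra with basis `1, x` and `x² = 0` is isomorphic to `k[X]/(X²)`. -/
theorem exists_algEquiv_truncPoly {B : Type*} [Ring B] [Algebra k B] {x : B} (hx : x * x = 0)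
    (hli : ∀ a b : k, a • (1 : B) + b • x = 0 → a = 0 ∧ b = 0)
    (hspan : ∀ y : B, ∃ a b : k, y = a • (1 : B) + b • x) :
    ∃ ψ : B ≃ₐ[k] (k[X] ⧸ Ideal.span {(X ^ 2 : k[X])}), ψ x = Ideal.Quotient.mk _ X := by
  -- The inverse is easier to construct: evaluation at x descends to the quotient because x² = 0.
  let θ : (k[X] ⧸ Ideal.span {(X ^ 2 : k[X])}) →ₐ[k] B :=
    Ideal.Quotient.liftₐ _ (aeval x) (by
      intro p hp
      obtain ⟨q, rfl⟩ := Ideal.mem_span_singleton.1 hp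
      simp [pow_two, hx])
  have hθ : ∀ p : k[X], θ (Ideal.Quotient.mk _ p) = aeval x p := fun p => rfl
  have hbij : Function.Bijective θ := by
    constructor
    · rw [injective_iff_map_eq_zero]
      intro p hp
      obtain ⟨p, rfl⟩ := Ideal.Quotient.mk_surjective p
      rw [hθ, aeval_eq_of_sq_eq_zero hx] at hp
      obtain ⟨h0, h1⟩ := hli _ _ hp
      rw [Ideal.Quotient.eq_zero_iff_mem, Ideal.mem_span_singleton, X_pow_dvd_iff]
      intro d hd
      interval_cases d <;> assumption
    · intro y
      obtain ⟨a, b, rfl⟩ := hspan y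
      refine ⟨Ideal.Quotient.mk _ (C a + C b * X), ?_⟩
      rw [hθ]
      simp [Algebra.algebraMap_eq_smul_one]
  refine ⟨(AlgEquiv.ofBijective θ hbij).symm, ?_⟩
  rw [AlgEquiv.symm_apply_eq]
  exact ((hθ X).trans (aeval_X x)).symm

theorem finite_directSum {ι : Type*} [DecidableEq ι] (M : ι → Type*) [∀ i, AddCommGroup (M i)]
    [∀ i, Module k (M i)] (h : ∀ i, Module.Finite k (M i)) (hs : {i | ¬ Subsingleton (M i)}.Finite) :
    Module.Finite k (⨁ i, M i) := by
  have := hs.to_subtype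
  let r : (⨁ i, M i) →ₗ[k] (∀ i : {i | ¬ Subsingleton (M i)}, M i) :=
    LinearMap.pi fun i => DirectSum.component k ι M i
  refine Module.Finite.of_injective r fun a b hab => ?_
  refine DFinsupp.ext fun i => ?_
  by_cases hi : Subsingleton (M i)
  · exact Subsingleton.elim _ _
  · exact congrFun hab ⟨i, hi⟩

end Algebra

/-! ### From duality to sphericity, and reduction to modules. -/

section Spherical

open Limits Pretriangulated

universe w v u

variable {k : Type*} [Field k]

section

variable {T : Type u} [Category.{v} T] [HasShift T ℤ]
  [Preadditive T] [Linear k T]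

theorem finite_hom_from {E F : T} {d : ℤ} {φ : ShiftedHom E E d →ₗ[k] k} (hF : dualObjects φ F) : Module.Finite k (⨁ n : ℤ, ShiftedHom E F n) :=
  finite_directSum _ (fun n => (hF.1 n).finite) hF.2

variable [∀ n : ℤ, (shiftFunctor T n).Additive] [∀ n : ℤ, (shiftFunctor T n).Linear k]

variable (k) in
/-- `Hom(F, E[i]) ≅ Hom(F[a], E[d])` for `i + a = d`. -/
noncomputable def shiftHomEquiv (F E : T) (i a d : ℤ) (h : i + a = d) :
    ShiftedHom F E i ≃ₗ[k] (F⟦a⟧ ⟶ E⟦d⟧) :=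
  LinearEquiv.ofBijective ((shiftFunctor T a).mapLinearMap k)
    ⟨(shiftFunctor T a).map_injective, (shiftFunctor T a).map_surjective⟩ ≪≫ₗ
    Linear.homCongr k (Iso.refl _) ((shiftFunctorAdd' T i a d h).symm.app E)

/-- This identifies the graded composition pairing with the ungraded one used by `homToDual`, at a
shift of F. -/
theorem comp_shiftHomEquiv {F E : T} {i a d : ℤ} (h : i + a = d) (f : ShiftedHom F E i)
    (g : ShiftedHom E F a) : g ≫ shiftHomEquiv k F E i a d h f = g.comp f h := by
  simp [shiftHomEquiv, ShiftedHom.comp, Linear.homCongr]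
  rfl

variable {E F : T} {d : ℤ} {φ : ShiftedHom E E d →ₗ[k] k}

/-- After replacing F by F[d - i], injectivity of `homToDual` gives nondegeneracy in one argument.
Its surjectivity gives the other, since linear functionals separate vectors. -/
theorem compositionPairing_nondegenerate (hφ : LinearMap.ker φ = identitySubspace k E d)
    (hF : dualObjects φ F) (i : ℤ) : (compositionPairing k E F d i).Nondegenerate := by
  have key : ∀ f g, compositionPairing k E F d i f g = 0 ↔
      homToDual k φ (F⟦d - i⟧) (shiftHomEquiv k F E i (d - i) d (by omega) f) g = 0 := by
    intro f g
    rw [homToDual_apply, comp_shiftHomEquiv, ← LinearMap.mem_ker (f := φ), hφ]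
    exact Submodule.Quotient.mk_eq_zero _
  have hbij := (hF.1 (d - i)).bijective
  constructor
  · intro f hf
    have h0 : homToDual k φ (F⟦d - i⟧) (shiftHomEquiv k F E i (d - i) d (by omega) f) = 0 :=
      LinearMap.ext fun g => (key f g).1 (hf g)
    have h1 := hbij.1 (h0.trans (map_zero _).symm)
    exact (LinearEquiv.map_eq_zero_iff _).1 h1
  · intro g hg
    refine (Module.forall_dual_apply_eq_zero_iff k g).1 fun ψ => ?_
    obtain ⟨f', rfl⟩ := hbij.2 ψ
    obtain ⟨f, rfl⟩ := (shiftHomEquiv k F E i (d - i) d (by omega)).surjective f'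
    exact (key f g).1 (hg f)

/-- Hom(F, E[n]) is the dual of Hom(E, F[d - n]), so finiteness on one side transfers to the other.
-/
theorem finite_hom_to (hF : dualObjects φ F) : Module.Finite k (⨁ n : ℤ, ShiftedHom F E n) := by
  let e : ∀ n : ℤ, ShiftedHom F E n ≃ₗ[k] Module.Dual k (E ⟶ F⟦d - n⟧) := fun n =>
    shiftHomEquiv k F E n (d - n) d (by omega) ≪≫ₗ
      LinearEquiv.ofBijective _ (hF.1 (d - n)).bijective
  refine finite_directSum _ (fun n => ?_) ?_
  · have := (hF.1 (d - n)).finite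
    exact Module.Finite.equiv (e n).symm
  · refine (hF.2.preimage (f := fun n => d - n) (sub_right_injective).injOn).subset fun n hn hs => ?_
    have hs' : Subsingleton (E ⟶ F⟦d - n⟧) := hs
    exact hn (e n).injective.subsingleton

/-- The graded endomorphism algebra is `k[x]/(x²)` if the graded pieces are spanned by `1` and `x`. -/
theorem exists_algEquiv_gradedEnd (x : GradedEnd E d)
    (hx : DirectSum.lof k ℤ (GradedEnd E) d x * DirectSum.lof k ℤ (GradedEnd E) d x = 0)
    (hli : ∀ a b : k, a • (1 : ⨁ n : ℤ, GradedEnd E n) + b • DirectSum.lof k ℤ (GradedEnd E) d x = 0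
      → a = 0 ∧ b = 0)
    (hspan : ∀ n : ℤ, LinearMap.range (DirectSum.lof k ℤ (GradedEnd E) n) =
      Submodule.span k {y | (n = 0 ∧ y = 1) ∨ (n = d ∧ y = DirectSum.lof k ℤ (GradedEnd E) d x)}) :
    ∃ ψ : (⨁ n : ℤ, GradedEnd E n) ≃ₐ[k]
      (Polynomial k ⧸ Ideal.span {(Polynomial.X ^ 2 : Polynomial k)}),
    ∀ n : ℤ, (LinearMap.range (DirectSum.lof k ℤ (GradedEnd E) n)).map ψ.toLinearMap =
      truncPolyGrading k d n := by
  obtain ⟨ψ, hψ⟩ := exists_algEquiv_truncPoly hx hli fun y => by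
    have hy : y ∈ Submodule.span k {1, DirectSum.lof k ℤ (GradedEnd E) d x} := by
      induction y using DirectSum.induction_on with
      | zero => exact Submodule.zero_mem _
      | of n z =>
        have hz : DirectSum.lof k ℤ (GradedEnd E) n z ∈
          LinearMap.range (DirectSum.lof k ℤ (GradedEnd E) n) := ⟨z, rfl⟩
        rw [hspan] at hz
        refine Submodule.span_mono ?_ hz
        rintro _ (⟨-, rfl⟩ | ⟨-, rfl⟩) <;> simp
      | add a b ha hb => exact Submodule.add_mem _ ha hb
    obtain ⟨a, b, h⟩ := Submodule.mem_span_pair.1 hy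
    exact ⟨a, b, h.symm⟩
  refine ⟨ψ, fun n => ?_⟩
  rw [hspan, Submodule.map_span, truncPolyGrading]
  congr 1
  ext y
  constructor
  · rintro ⟨_, ⟨h, rfl⟩ | ⟨h, rfl⟩, rfl⟩
    · exact Or.inl ⟨h, map_one ψ⟩
    · exact Or.inr ⟨h, hψ⟩
  · rintro (⟨h, rfl⟩ | ⟨h, rfl⟩)
    · exact ⟨1, Or.inl ⟨h, rfl⟩, map_one ψ⟩
    · exact ⟨_, Or.inr ⟨h, rfl⟩, hψ⟩

end

variable {C : Type u} [Category.{v} C] [Abelian C] [HasDerivedCategory.{w} C]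

open DerivedCategory in
/-- Dévissage: the bounded derived category is generated by the complexes concentrated in degree
zero. -/
theorem prop_of_isBoundedComplex (Q : ObjectProperty (DerivedCategory C)) [Q.IsTriangulated]
    [Q.IsClosedUnderIsomorphisms] (hQ : ∀ X : C, Q ((singleFunctor C 0).obj X))
    {F : DerivedCategory C} (hF : IsBoundedComplex F) : Q F := by
  -- An object with cohomology in the single degree a is a shift of a module.
  have hsingle : ∀ (G : DerivedCategory C) (a : ℤ) [G.IsGE a] [G.IsLE a], Q G := by
    intro G a _ _
    obtain ⟨Y, ⟨i⟩⟩ := exists_iso_singleFunctor_obj_of_isGE_of_isLE G a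
    refine Q.prop_of_iso (((singleFunctors C).shiftIso (-a) a 0 (by omega)).app Y ≪≫ i.symm) ?_
    exact Q.le_shift (-a) _ (hQ Y)
  -- Induction on the length of the interval containing the cohomology: the truncation triangle at a
  -- + 1 splits off the lowest degree.
  have key : ∀ (n : ℕ) (G : DerivedCategory C) (a : ℤ), G.IsGE a → G.IsLE (a + n) → Q G := by
    intro n
    induction n with
    | zero =>
      intro G a _ h
      have : G.IsLE a := by simpa using h
      exact hsingle G a
    | succ n ih =>
      intro G a _ h
      refine Q.ext_of_isTriangulatedClosed₂ _ (TStructure.t.triangleLTGE_distinguished (a + 1) G)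
        ?_ ?_
      · have h1 : ((TStructure.t.truncLT (a + 1)).obj G).IsGE a := inferInstance
        have h2 : ((TStructure.t.truncLT (a + 1)).obj G).IsLE a :=
          TStructure.t.isLE_truncLT_obj G (a + 1) a
        exact hsingle ((TStructure.t.truncLT (a + 1)).obj G) a
      · refine ih ((TStructure.t.truncGE (a + 1)).obj G) (a + 1) inferInstance ?_
        have h3 : G.IsLE (a + 1 + n) := by
          convert h using 1
          push_cast
          ring
        infer_instance
  obtain ⟨⟨a, ha⟩, ⟨b, hb⟩⟩ := hF
  -- If b < a, then `toNat` returns 0; this is harmless because the upper bound b may be weakened to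
  -- a.
  refine key (b - a).toNat F a ha ?_
  exact TStructure.t.isLE_of_le F b _ (by omega)

variable [Linear k C]

theorem isSpherical_of_dualObjects {E : DerivedCategory C} {d : ℕ} (hE : IsBoundedComplex E)
    (φ : ShiftedHom E E (d : ℤ) →ₗ[k] k) (hφ : LinearMap.ker φ = identitySubspace k E d)
    (hdual : ∀ X : C, dualObjects φ ((DerivedCategory.singleFunctor C 0).obj X))
    (hend : ∃ ψ : (⨁ n : ℤ, GradedEnd E n) ≃ₐ[k]
      (Polynomial k ⧸ Ideal.span {(Polynomial.X ^ 2 : Polynomial k)}),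
      ∀ n : ℤ, (LinearMap.range (DirectSum.lof k ℤ (GradedEnd E) n)).map ψ.toLinearMap =
        truncPolyGrading k d n) : IsSpherical k E d where
  bounded := hE
  finite_from _ hF := finite_hom_from (prop_of_isBoundedComplex (dualObjects φ) hdual hF)
  finite_to _ hF := finite_hom_to (prop_of_isBoundedComplex (dualObjects φ) hdual hF)
  endomorphisms := hend
  calabiYau _ hF i :=
    compositionPairing_nondegenerate hφ (prop_of_isBoundedComplex (dualObjects φ) hdual hF) i

end Spherical

/-! ### A criterion for sphericity in terms of a basis of graded endomorphisms. -/

section Master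

open Limits Pretriangulated

universe w v u

variable {k : Type*} [Field k]

section

variable {T : Type u} [Category.{v} T] [Preadditive T] [Linear k T]

theorem isDualAt_of_subsingleton {E X : T} (φ : (E ⟶ X) →ₗ[k] k) (G : T)
    (h₁ : ∀ g : E ⟶ G, g = 0) (h₂ : ∀ f : G ⟶ X, f = 0) : IsDualAt k φ G := by
  have i₁ : Subsingleton (E ⟶ G) := ⟨fun a b => (h₁ a).trans (h₁ b).symm⟩
  refine ⟨inferInstance, fun a b _ => (h₂ a).trans (h₂ b).symm, fun y => ⟨0, ?_⟩⟩
  ext g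
  simp [h₁ g]

/-- A pairing without left or right kernel is perfect as soon as one side is finite dimensional. -/
theorem isDualAt_of_separating {E X : T} (φ : (E ⟶ X) →ₗ[k] k) (G : T)
    (hfin : Module.Finite k (E ⟶ G))
    (h₁ : ∀ g : E ⟶ G, (∀ f : G ⟶ X, φ (g ≫ f) = 0) → g = 0)
    (h₂ : ∀ f : G ⟶ X, (∀ g : E ⟶ G, φ (g ≫ f) = 0) → f = 0) : IsDualAt k φ G := by
  refine ⟨hfin, ?_⟩
  have := LinearMap.IsPerfPair.of_injective (p := (homToDual k φ G).flip)
    ((injective_iff_map_eq_zero _).2 fun g hg => h₁ g fun f => LinearMap.congr_fun hg f)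
    ((injective_iff_map_eq_zero _).2 fun f hf => h₂ f fun g => LinearMap.congr_fun hf g)
  exact LinearMap.IsPerfPair.bijective_right (homToDual k φ G).flip

/-- Both spaces are lines, spanned by u and v, and these pair to a nonzero scalar. -/
theorem isDualAt_of_span {E X G : T} (φ : (E ⟶ X) →ₗ[k] k) (u : E ⟶ G) (v : G ⟶ X)
    (hu : ∀ g : E ⟶ G, ∃ c : k, g = c • u) (hv : ∀ f : G ⟶ X, ∃ c : k, f = c • v)
    (h : φ (u ≫ v) ≠ 0) : IsDualAt k φ G := by
  refine isDualAt_of_separating φ G ⟨⟨{u}, ?_⟩⟩ ?_ ?_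
  · rw [eq_top_iff]
    rintro g -
    obtain ⟨c, rfl⟩ := hu g
    simpa using Submodule.smul_mem _ c (Submodule.mem_span_singleton_self u)
  · intro g hg
    obtain ⟨c, rfl⟩ := hu g
    have := hg v
    simp only [Linear.smul_comp, map_smul, smul_eq_mul, mul_eq_zero, h, or_false] at this
    simp [this]
  · intro f hf
    obtain ⟨c, rfl⟩ := hv f
    have := hf u
    simp only [Linear.comp_smul, map_smul, smul_eq_mul, mul_eq_zero, h, or_false] at this
    simp [this]

end

section

variable {T : Type u} [Category.{v} T] [HasShift T ℤ]
  [Preadditive T] [Linear k T]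

variable (k) in
/-- The inclusion of `Hom^n(E, E)` into the graded endomorphism algebra. -/
noncomputable def gradedIncl (E : T) (n : ℤ) : ShiftedHom E E n →ₗ[k] (⨁ n : ℤ, GradedEnd E n) :=
  DirectSum.lof k ℤ (GradedEnd E) n

variable (k) in
/-- The projection of the graded endomorphism algebra onto `Hom^n(E, E)`. -/
noncomputable def gradedProj (E : T) (n : ℤ) : (⨁ n : ℤ, GradedEnd E n) →ₗ[k] ShiftedHom E E n :=
  DirectSum.component k ℤ (GradedEnd E) n

theorem gradedProj_gradedIncl {E : T} {n : ℤ} (y : ShiftedHom E E n) :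
    gradedProj k E n (gradedIncl k E n y) = y := DirectSum.component.lof_self k n (M := GradedEnd E) y

theorem gradedProj_gradedIncl_of_ne {E : T} {m n : ℤ} (h : n ≠ m) (y : ShiftedHom E E m) :
    gradedProj k E n (gradedIncl k E m y) = 0 := DirectSum.of_eq_of_ne (β := GradedEnd E) _ _ _ h

theorem gradedIncl_id (E : T) :
    gradedIncl k E 0 (ShiftedHom.mk₀ (0 : ℤ) rfl (𝟙 E)) = 1 := rfl

/-- For d = 0 the component is a multiple of the identity; for d ≠ 0 it vanishes. This lets the
cases d = 0 and d ≠ 0 be treated together below. -/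
theorem gradedProj_smul_one_mem {E : T} {d : ℤ} (a : k) :
    gradedProj k E d (a • (1 : ⨁ n : ℤ, GradedEnd E n)) ∈ identitySubspace k E d := by
  rw [map_smul, ← gradedIncl_id (k := k)]
  refine Submodule.smul_mem _ _ ?_
  by_cases hd : d = 0
  · subst hd
    rw [gradedProj_gradedIncl]
    exact Submodule.subset_span ⟨rfl, rfl⟩
  · rw [gradedProj_gradedIncl_of_ne hd]
    exact Submodule.zero_mem _

variable [∀ n : ℤ, (shiftFunctor T n).Additive] [∀ n : ℤ, (shiftFunctor T n).Linear k]

/-- Working modulo `identitySubspace` covers d = 0, where 1 and x share a degree, and d ≠ 0, where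
they lie in different degrees. The condition `h0` supplies the scalars in degree 0 only when d does
not already account for them. -/
theorem exists_algEquiv_gradedEnd_of_basis {E : T} {d : ℤ} (x : ShiftedHom E E d)
    (hxx : x.comp x rfl = 0) (hx : x ∉ identitySubspace k E d) (hE : 𝟙 E ≠ 0)
    (hd : ∀ y : ShiftedHom E E d, ∃ z ∈ identitySubspace k E d, ∃ b : k, y = z + b • x)
    (h0 : d ≠ 0 → ∀ y : E ⟶ E, ∃ c : k, y = c • 𝟙 E)
    (hn : ∀ n : ℤ, n ≠ 0 → n ≠ d → ∀ y : ShiftedHom E E n, y = 0) :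
    ∃ ψ : (⨁ n : ℤ, GradedEnd E n) ≃ₐ[k]
      (Polynomial k ⧸ Ideal.span {(Polynomial.X ^ 2 : Polynomial k)}),
    ∀ n : ℤ, (LinearMap.range (DirectSum.lof k ℤ (GradedEnd E) n)).map ψ.toLinearMap =
      truncPolyGrading k d n := by
  refine exists_algEquiv_gradedEnd (E := E) (d := d) x ?_ ?_ ?_
  · refine (DirectSum.of_mul_of (A := GradedEnd E) x x).trans ?_
    exact (congrArg _ hxx).trans (map_zero _)
  · intro a b hab
    change a • (1 : ⨁ n : ℤ, GradedEnd E n) + b • gradedIncl k E d x = 0 at hab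
    -- In degree d the relation puts b • x into the identity subspace, so a nonzero b would put x
    -- there.
    have hb : b = 0 := by
      by_contra hb
      apply hx
      have h1 := congrArg (gradedProj k E d) hab
      rw [map_add, map_smul _ b, gradedProj_gradedIncl, map_zero] at h1
      have h2 : b • x ∈ identitySubspace k E d := by
        rw [eq_neg_of_add_eq_zero_right h1]
        exact Submodule.neg_mem _ (gradedProj_smul_one_mem a)
      simpa [smul_smul, inv_mul_cancel₀ hb] using Submodule.smul_mem _ b⁻¹ h2
    refine ⟨?_, hb⟩
    by_contra ha
    rw [hb, zero_smul, add_zero, smul_eq_zero_iff_right ha, ← gradedIncl_id (k := k)] at hab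
    have h1 := congrArg (gradedProj k E 0) hab
    rw [gradedProj_gradedIncl, map_zero] at h1
    exact hE ((ShiftedHom.homEquiv (0 : ℤ) rfl).injective (by simpa using h1))
  · intro n
    change LinearMap.range (gradedIncl k E n) =
      Submodule.span k {y | (n = 0 ∧ y = 1) ∨ (n = d ∧ y = gradedIncl k E d x)}
    apply le_antisymm
    · rintro _ ⟨y, rfl⟩
      by_cases hnd : n = d
      · subst hnd
        obtain ⟨z, hz, b, rfl⟩ := hd y
        rw [map_add, map_smul]
        refine Submodule.add_mem _ ?_
          (Submodule.smul_mem _ _ (Submodule.subset_span (Or.inr ⟨rfl, rfl⟩)))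
        -- The identity subspace has a generator only when the degree is 0, and that generator is
        -- then the unit of the graded algebra.
        rw [← Submodule.mem_comap]
        refine (Submodule.span_le.2 ?_) hz
        rintro _ ⟨h, rfl⟩
        subst h
        exact Submodule.subset_span (Or.inl ⟨rfl, rfl⟩)
      · by_cases hn0 : n = 0
        · subst hn0
          obtain ⟨y, rfl⟩ := (ShiftedHom.homEquiv (0 : ℤ) rfl).surjective y
          obtain ⟨c, rfl⟩ := h0 (Ne.symm hnd) y
          have : ShiftedHom.homEquiv (0 : ℤ) rfl (c • 𝟙 E) =
            c • ShiftedHom.mk₀ (0 : ℤ) rfl (𝟙 E) := by simp [ShiftedHom.mk₀]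
          rw [this, map_smul]
          exact Submodule.smul_mem _ _ (Submodule.subset_span (Or.inl ⟨rfl, rfl⟩))
        · rw [hn n hn0 hnd y, map_zero]
          exact Submodule.zero_mem _
    · rw [Submodule.span_le]
      rintro _ (⟨rfl, rfl⟩ | ⟨rfl, rfl⟩)
      · exact ⟨_, rfl⟩
      · exact ⟨_, rfl⟩

end

/-- The line through x is a complement of p, so a form that vanishes on p but not at x has kernel
exactly p. -/
theorem exists_dual_ker_eq {M : Type*} [AddCommGroup M] [Module k M] {p : Submodule k M} {x : M}
    (hx : x ∉ p) (hspan : ∀ y : M, ∃ z ∈ p, ∃ b : k, y = z + b • x) :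
    ∃ φ : M →ₗ[k] k, LinearMap.ker φ = p ∧ φ x ≠ 0 := by
  obtain ⟨φ, hφx, hφp⟩ := Submodule.exists_dual_map_eq_bot_of_notMem hx inferInstance
  have hp : ∀ z ∈ p, φ z = 0 := fun z hz =>
    (Submodule.mem_bot k).1 (hφp ▸ Submodule.mem_map_of_mem hz)
  refine ⟨φ, le_antisymm (fun y hy => ?_) hp, hφx⟩
  obtain ⟨z, hz, b, rfl⟩ := hspan y
  have hb : b = 0 := by simpa [hp z hz, hφx] using hy
  simpa [hb] using hz

variable {C : Type u} [Category.{v} C] [Abelian C] [HasDerivedCategory.{w} C] [Linear k C]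

/-- Spherical objects from a generator `x` of the non-trivial part of the graded endomorphism
algebra. -/
theorem isSpherical_of_basis {E : DerivedCategory C} {d : ℕ} (hE : IsBoundedComplex E)
    (x : ShiftedHom E E (d : ℤ)) (hxx : x.comp x rfl = 0) (hx : x ∉ identitySubspace k E (d : ℤ))
    (hid : 𝟙 E ≠ 0)
    (hd : ∀ y : ShiftedHom E E (d : ℤ), ∃ z ∈ identitySubspace k E d, ∃ b : k, y = z + b • x)
    (h0 : (d : ℤ) ≠ 0 → ∀ y : E ⟶ E, ∃ c : k, y = c • 𝟙 E)
    (hn : ∀ n : ℤ, n ≠ 0 → n ≠ d → ∀ y : ShiftedHom E E n, y = 0)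
    (hdual : ∀ φ : ShiftedHom E E (d : ℤ) →ₗ[k] k, LinearMap.ker φ = identitySubspace k E d →
      φ x ≠ 0 → ∀ X : C, dualObjects φ ((DerivedCategory.singleFunctor C 0).obj X)) :
    IsSpherical k E d := by
  obtain ⟨φ, hφ, hφx⟩ := exists_dual_ker_eq hx hd
  exact isSpherical_of_dualObjects hE φ hφ (hdual φ hφ hφx)
    (exists_algEquiv_gradedEnd_of_basis x hxx hx hid hd h0 hn)

end Master

/-! ### Long exact Hom sequences in shifted degrees. -/

section LongExact

open Limits Pretriangulated

universe v u

variable {T : Type u} [Category.{v} T] [HasZeroObject T] [HasShift T ℤ]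
  [Preadditive T] [∀ n : ℤ, (shiftFunctor T n).Additive] [Pretriangulated T]
  (Δ : Triangle T) (hΔ : Δ ∈ distTriang T) {W : T}

include hΔ

theorem exists_eq_mor₃_comp {n m : ℤ} (h : n + 1 = m) (g : ShiftedHom Δ.obj₃ W m)
    (hg : Δ.mor₂ ≫ g = 0) :
    ∃ f : ShiftedHom Δ.obj₁ W n, g = ShiftedHom.comp (a := (1 : ℤ)) Δ.mor₃ f h := by
  obtain ⟨g', rfl⟩ := Triangle.yoneda_exact₃ Δ hΔ g hg
  -- Exactness gives a morphism out of the first object shifted by 1; identifying W[m] with W[n][1],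
  -- fullness of the shift removes that shift.
  refine ⟨(shiftFunctor T (1 : ℤ)).preimage (g' ≫ (shiftFunctorAdd' T n 1 m h).hom.app W), ?_⟩
  simp [ShiftedHom.comp]

theorem exists_eq_mor₁_comp {n m : ℤ} (h : n + 1 = m) (f : ShiftedHom Δ.obj₁ W n)
    (hf : ShiftedHom.comp (a := (1 : ℤ)) Δ.mor₃ f h = 0) :
    ∃ g : ShiftedHom Δ.obj₂ W n, f = Δ.mor₁ ≫ g := by
  have hf' : Δ.mor₃ ≫ f⟦(1 : ℤ)⟧' = 0 := by
    rw [← cancel_mono ((shiftFunctorAdd' T n 1 m h).inv.app W), zero_comp, Category.assoc]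
    exact hf
  obtain ⟨g, hg⟩ := Triangle.yoneda_exact₃ _ (rot_of_distTriang _ hΔ) (f⟦(1 : ℤ)⟧') hf'
  obtain ⟨g', rfl⟩ : ∃ g' : Δ.obj₂ ⟶ W⟦n⟧, g'⟦(1 : ℤ)⟧' = g :=
    (shiftFunctor T (1 : ℤ)).map_surjective g
  -- The third morphism of the rotated triangle is the negative of the shifted first one, hence the
  -- sign.
  refine ⟨-g', (shiftFunctor T (1 : ℤ)).map_injective (hg.trans ?_)⟩
  rw [Functor.map_comp, Functor.map_neg, Preadditive.comp_neg]
  exact Preadditive.neg_comp _ _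

theorem exists_eq_comp_mor₂ {n m : ℤ} (h : 1 + n = m) (g : ShiftedHom W Δ.obj₃ n)
    (hg : ShiftedHom.comp g (b := (1 : ℤ)) Δ.mor₃ h = 0) :
    ∃ f : ShiftedHom W Δ.obj₂ n, g = f ≫ Δ.mor₂⟦n⟧' := by
  have hg' : g ≫ Δ.mor₃⟦n⟧' = 0 := by
    rw [← cancel_mono ((shiftFunctorAdd' T 1 n m h).inv.app _), zero_comp, Category.assoc]
    exact hg
  obtain ⟨f, hf⟩ := Triangle.coyoneda_exact₃ _ (Δ.shift_distinguished hΔ n) g (by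
    change g ≫ (n.negOnePow • Δ.mor₃⟦n⟧' ≫ (shiftFunctorComm T 1 n).hom.app Δ.obj₁) = 0
    rw [Linear.comp_units_smul, reassoc_of% hg', zero_comp, smul_zero])
  -- Shifting a triangle by n multiplies its morphisms by (-1)^n; the sign is absorbed into the
  -- factor f.
  refine ⟨n.negOnePow • f, hf.trans ?_⟩
  exact (Linear.comp_units_smul _ _ _).trans (Linear.units_smul_comp _ _ _).symm

theorem exists_eq_comp_mor₁ {n : ℤ} (g : ShiftedHom W Δ.obj₂ n)
    (hg : g ≫ Δ.mor₂⟦n⟧' = 0) : ∃ f : ShiftedHom W Δ.obj₁ n, g = f ≫ Δ.mor₁⟦n⟧' := by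
  obtain ⟨f, hf⟩ := Triangle.coyoneda_exact₂ _ (Δ.shift_distinguished hΔ n) g (by
    change g ≫ (n.negOnePow • Δ.mor₂⟦n⟧') = 0
    rw [Linear.comp_units_smul, hg, smul_zero])
  refine ⟨n.negOnePow • f, hf.trans ?_⟩
  exact (Linear.comp_units_smul _ _ _).trans (Linear.units_smul_comp _ _ _).symm

end LongExact

/-! ### Abstract block data and reduction to the two projectives. -/

section Data

open Limits Pretriangulated DerivedCategory

universe w v u

/-- The projective resolutions of the simple objects `A = L(1)` and `S = L(s)` of a block of
category `𝓞` of `𝔰𝔩₂` by the indecomposable projective objects `V = P(1)` and `P = P(s)`. -/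
structure BlockData (k : Type*) [Field k] (C : Type u) [Category.{v} C] [Abelian C] [Linear k C] where
  (A S V P : C)
  (i : S ⟶ V)
  (π : V ⟶ A)
  (j : V ⟶ P)
  (q : P ⟶ S)
  i_π : i ≫ π = 0
  j_q : j ≫ q = 0
  shortExact_A : (ShortComplex.mk i π i_π).ShortExact
  shortExact_S : (ShortComplex.mk j q j_q).ShortExact
  projective_V : Projective V
  projective_P : Projective P
  end_V : ∀ f : V ⟶ V, ∃ c : k, f = c • 𝟙 V
  hom_V_P : ∀ f : V ⟶ P, ∃ c : k, f = c • j
  hom_P_V : ∀ f : P ⟶ V, ∃ c : k, f = c • (q ≫ i)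
  end_P : ∀ f : P ⟶ P, ∃ a b : k, f = a • 𝟙 P + b • (q ≫ i ≫ j)
  not_isZero_S : ¬ IsZero S
  devissage : ∀ Q : ObjectProperty C, (∀ X, IsZero X → Q X) → Q A → Q S → Q.IsClosedUnderIsomorphisms →
    (∀ X : ShortComplex C, X.ShortExact → Q X.X₁ → Q X.X₃ → Q X.X₂) → ∀ X, Q X

variable {k : Type*} [Field k] {C : Type u} [Category.{v} C] [Abelian C]
  [HasDerivedCategory.{w} C]

/-- Negative degrees vanish by the t-structure axiom, and positive degrees are Ext groups out of a
projective. -/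
theorem single_hom_eq_zero_of_projective {X Y : C} (hX : Projective X) {n : ℤ} (hn : n ≠ 0)
    (f : ShiftedHom ((singleFunctor C 0).obj X) ((singleFunctor C 0).obj Y) n) : f = 0 := by
  rcases lt_or_gt_of_ne hn with hn | hn
  · have := TStructure.t.isGE_shift ((singleFunctor C 0).obj Y) 0 n (-n) (by omega)
    exact TStructure.t.zero f 0 (-n) (by omega)
  · obtain ⟨m, rfl⟩ : ∃ m : ℕ, n = ((m + 1 : ℕ) : ℤ) := ⟨(n - 1).toNat, by omega⟩
    have : HasExt.{w} C := hasExt_of_hasDerivedCategory C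
    obtain ⟨e, rfl⟩ := Abelian.Ext.homEquiv.surjective f
    rw [Abelian.Ext.eq_zero_of_projective e]
    exact Abelian.Ext.zero_hom _ _ _

theorem single_hom_zero {X Y : C}
    (f : ShiftedHom ((singleFunctor C 0).obj X) ((singleFunctor C 0).obj Y) (0 : ℤ)) :
    ∃ g : X ⟶ Y, f = ShiftedHom.mk₀ (0 : ℤ) rfl ((singleFunctor C 0).map g) := by
  obtain ⟨f, rfl⟩ := (ShiftedHom.homEquiv (0 : ℤ) rfl).surjective f
  obtain ⟨g, rfl⟩ := (singleFunctor C 0).map_surjective f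
  exact ⟨g, rfl⟩

theorem isBoundedComplex_single (X : C) : IsBoundedComplex ((singleFunctor C 0).obj X) :=
  ⟨⟨0, inferInstance⟩, ⟨0, inferInstance⟩⟩

variable [Linear k C] (D : BlockData k C)

/-- S is the cone of V → P and A is the cone of S → V, so duality passes from the two projectives to
both simples, and by dévissage to every object. -/
theorem BlockData.dualObjects_single {E X : DerivedCategory C} (φ : (E ⟶ X) →ₗ[k] k)
    (hV : dualObjects φ ((singleFunctor C 0).obj D.V))
    (hP : dualObjects φ ((singleFunctor C 0).obj D.P)) (Y : C) :
    dualObjects φ ((singleFunctor C 0).obj Y) := by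
  have hS : dualObjects φ ((singleFunctor C 0).obj D.S) :=
    (dualObjects φ).ext_of_isTriangulatedClosed₃ _ D.shortExact_S.singleTriangle_distinguished hV hP
  have hA : dualObjects φ ((singleFunctor C 0).obj D.A) :=
    (dualObjects φ).ext_of_isTriangulatedClosed₃ _ D.shortExact_A.singleTriangle_distinguished hS hV
  exact D.devissage ((dualObjects φ).inverseImage (singleFunctor C 0))
    (fun X hX => (dualObjects φ).prop_of_isZero ((singleFunctor C 0).map_isZero hX)) hA hS inferInstance
    (fun X hX h₁ h₃ =>
      (dualObjects φ).ext_of_isTriangulatedClosed₂ _ hX.singleTriangle_distinguished h₁ h₃) Y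

end Data

/-! ### Morphisms in the block, and sphericity of P(s). -/

section Sphericity

open Limits Pretriangulated DerivedCategory

universe w v u

section

variable {k : Type*} [Field k] {T : Type u} [Category.{v} T] [HasShift T ℤ]
  [Preadditive T] [Linear k T]

theorem mem_identitySubspace {E : T} {d : ℤ} (h : d = 0) {f : ShiftedHom E E d} :
    f ∈ identitySubspace k E d ↔ ∃ c : k, c • ShiftedHom.mk₀ d h (𝟙 E) = f := by
  rw [← Submodule.mem_span_singleton, identitySubspace]
  simp [h]

theorem identitySubspace_eq_bot {E : T} {d : ℤ} (h : d ≠ 0) : identitySubspace k E d = ⊥ := by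
  simp [identitySubspace, h]

end

variable {k : Type*} [Field k] {C : Type u} [Category.{v} C] [Abelian C] [Linear k C]

namespace BlockData

variable (D : BlockData k C)

instance : Mono D.i := D.shortExact_A.mono_f
instance : Epi D.π := D.shortExact_A.epi_g
instance : Mono D.j := D.shortExact_S.mono_f
instance : Epi D.q := D.shortExact_S.epi_g

@[simp]
theorem i_comp_π : D.i ≫ D.π = 0 := D.i_π

@[simp]
theorem i_comp_π_assoc {X : C} (f : D.A ⟶ X) : D.i ≫ D.π ≫ f = 0 := by
  rw [← Category.assoc, i_comp_π, zero_comp]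

@[simp]
theorem j_comp_q : D.j ≫ D.q = 0 := D.j_q

@[simp]
theorem j_comp_q_assoc {X : C} (f : D.S ⟶ X) : D.j ≫ D.q ≫ f = 0 := by
  rw [← Category.assoc, j_comp_q, zero_comp]

/-- Cancelling the epimorphism q and then the monomorphism i j would force S to be zero. -/
theorem q_i_j_ne_zero : D.q ≫ D.i ≫ D.j ≠ 0 := fun h => by
  have h1 : D.i ≫ D.j = 0 := by rwa [← cancel_epi D.q, comp_zero]
  have h2 : 𝟙 D.S = 0 := by rw [← cancel_mono (D.i ≫ D.j), h1, comp_zero, comp_zero]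
  exact D.not_isZero_S ((IsZero.iff_id_eq_zero _).2 h2)

theorem i_ne_zero : D.i ≠ 0 := fun h => D.q_i_j_ne_zero (by simp [h])

theorem j_ne_zero : D.j ≠ 0 := fun h => D.q_i_j_ne_zero (by simp [h])

theorem hom_S_V (g : D.S ⟶ D.V) : ∃ c : k, g = c • D.i := by
  obtain ⟨c, hc⟩ := D.hom_P_V (D.q ≫ g)
  exact ⟨c, by rw [← cancel_epi D.q, hc, Linear.comp_smul]⟩

/-- The composite q g is a combination of the identity and q i j. Precomposing with j kills q g and
q i j, so the identity coefficient vanishes; then q cancels. -/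
theorem hom_S_P (g : D.S ⟶ D.P) : ∃ c : k, g = c • (D.i ≫ D.j) := by
  obtain ⟨a, b, hab⟩ := D.end_P (D.q ≫ g)
  have h1 := congrArg (D.j ≫ ·) hab
  simp only [j_comp_q_assoc, Preadditive.comp_add, Linear.comp_smul, Category.comp_id,
    smul_zero, add_zero] at h1
  have ha : a = 0 := (smul_eq_zero.1 h1.symm).resolve_right D.j_ne_zero
  exact ⟨b, by rw [← cancel_epi D.q, hab, ha, zero_smul, zero_add, Linear.comp_smul]⟩

/-- The composite π g is a scalar endomorphism of V killed by precomposition with the nonzero map i,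
so the scalar is 0. -/
theorem hom_A_V (g : D.A ⟶ D.V) : g = 0 := by
  obtain ⟨c, hc⟩ := D.end_V (D.π ≫ g)
  have h1 := congrArg (D.i ≫ ·) hc
  simp only [i_comp_π_assoc, Linear.comp_smul, Category.comp_id] at h1
  have hc0 : c = 0 := (smul_eq_zero.1 h1.symm).resolve_right D.i_ne_zero
  rw [← cancel_epi D.π, hc, hc0, zero_smul, comp_zero]

/-- The composite π g is a multiple of j killed by precomposition with q i, whereas q i j is
nonzero. -/
theorem hom_A_P (g : D.A ⟶ D.P) : g = 0 := by
  obtain ⟨c, hc⟩ := D.hom_V_P (D.π ≫ g)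
  have h1 := congrArg (D.q ≫ D.i ≫ ·) hc
  simp only [i_comp_π_assoc, comp_zero, Linear.comp_smul] at h1
  have hc0 : c = 0 := (smul_eq_zero.1 h1.symm).resolve_right D.q_i_j_ne_zero
  rw [← cancel_epi D.π, hc, hc0, zero_smul, comp_zero]

theorem hom_V_A (f : D.V ⟶ D.A) : ∃ c : k, f = c • D.π := by
  have := D.projective_V
  obtain ⟨c, hc⟩ := D.end_V (Projective.factorThru f D.π)
  exact ⟨c, by rw [← Projective.factorThru_comp f D.π, hc, Linear.smul_comp, Category.id_comp]⟩

/-- A lift along π to V is a multiple of q i, and i π = 0. -/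
theorem hom_P_A (f : D.P ⟶ D.A) : f = 0 := by
  have := D.projective_P
  obtain ⟨c, hc⟩ := D.hom_P_V (Projective.factorThru f D.π)
  rw [← Projective.factorThru_comp f D.π, hc, Linear.smul_comp, Category.assoc, i_comp_π,
    comp_zero, smul_zero]

theorem end_A (f : D.A ⟶ D.A) : ∃ c : k, f = c • 𝟙 D.A := by
  obtain ⟨c, hc⟩ := D.hom_V_A (D.π ≫ f)
  exact ⟨c, by rw [← cancel_epi D.π, hc, Linear.comp_smul, Category.comp_id]⟩

end BlockData

variable [HasDerivedCategory.{w} C]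

theorem single_hom_eq_mk₀ {X Y : C} {d : ℤ} (h : d = 0)
    (f : ShiftedHom ((singleFunctor C 0).obj X) ((singleFunctor C 0).obj Y) d) :
    ∃ g : X ⟶ Y, f = ShiftedHom.mk₀ d h ((singleFunctor C 0).map g) := by
  subst h
  exact single_hom_zero f

theorem shift_single_hom_eq_zero_of_projective (k : Type*) [Field k] {C : Type u} [Category.{v} C]
    [Abelian C] [Linear k C] [HasDerivedCategory.{w} C] {X Y : C} (hX : Projective X) {n d : ℤ} (hn : n ≠ d)
    (f : ((singleFunctor C 0).obj X)⟦n⟧ ⟶ ((singleFunctor C 0).obj Y)⟦d⟧) : f = 0 := by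
  obtain ⟨f, rfl⟩ := (shiftHomEquiv k _ _ (d - n) n d (by omega)).surjective f
  rw [single_hom_eq_zero_of_projective hX (by omega) f, map_zero]

namespace BlockData

variable (D : BlockData k C)

/-- Since P and G are both projective, the two Hom spaces to be compared vanish at every nonzero
shift; only the unshifted comparison remains. -/
theorem isDualAt_P {d : ℤ} (hd : d = 0) {G : C} (hG : Projective G)
    (φ : ShiftedHom ((singleFunctor C 0).obj D.P) ((singleFunctor C 0).obj D.P) d →ₗ[k] k)
    (h : IsDualAt k φ ((singleFunctor C 0).obj G)) :
    dualObjects φ ((singleFunctor C 0).obj G) := by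
  refine ⟨fun n => ?_, (Set.finite_singleton 0).subset fun n hn => ?_⟩
  · by_cases hn : n = 0
    · subst hn
      exact h.of_iso ((shiftFunctorZero _ ℤ).symm.app _)
    · exact isDualAt_of_subsingleton φ _
        (fun g => single_hom_eq_zero_of_projective D.projective_P hn g)
        (fun g => shift_single_hom_eq_zero_of_projective k hG (by omega) g)
  · by_contra h0
    exact hn ⟨fun a b => (single_hom_eq_zero_of_projective D.projective_P h0 a).trans
      (single_hom_eq_zero_of_projective D.projective_P h0 b).symm⟩

theorem isSpherical_P : IsSpherical k ((singleFunctor C 0).obj D.P) 0 := by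
  have hd : ((0 : ℕ) : ℤ) = 0 := rfl
  let ξ : D.P ⟶ D.P := D.q ≫ D.i ≫ D.j
  have hξ : ξ ≠ 0 := D.q_i_j_ne_zero
  have hξξ : ξ ≫ ξ = 0 := by simp [ξ]
  -- The degree is written `((0 : ℕ) : ℤ)`, the form in which sphericity states it for d = 0.
  let m {X Y : C} (f : X ⟶ Y) : ShiftedHom ((singleFunctor C 0).obj X) ((singleFunctor C 0).obj Y) ((0 : ℕ) : ℤ) :=
    ShiftedHom.mk₀ _ hd ((singleFunctor C 0).map f)
  have hm_inj : ∀ {X Y : C} (f g : X ⟶ Y), m f = m g → f = g := fun f g h =>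
    (singleFunctor C 0).map_injective ((ShiftedHom.homEquiv _ hd).injective h)
  have hm_add : ∀ {X Y : C} (f g : X ⟶ Y), m (f + g) = m f + m g := fun f g => by simp [m]
  have hm_smul : ∀ {X Y : C} (c : k) (f : X ⟶ Y), m (c • f) = c • m f := fun c f => by
    simp [m, Functor.map_smul]
  have hm_zero : ∀ {X Y : C}, m (0 : X ⟶ Y) = 0 := by simp [m]
  have hm_surj : ∀ {X Y : C} (y : ShiftedHom ((singleFunctor C 0).obj X) ((singleFunctor C 0).obj Y) ((0 : ℕ) : ℤ)), ∃ f, y = m f :=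
    fun y => single_hom_eq_mk₀ hd y
  have hm_id : m (𝟙 D.P) ∈ identitySubspace k ((singleFunctor C 0).obj D.P) ((0 : ℕ) : ℤ) :=
    (mem_identitySubspace hd).2 ⟨1, by simp [m]⟩
  have hm_comp : ∀ {X Y Z : C} (f : X ⟶ Y) (g : Y ⟶ Z), (singleFunctor C 0).map f ≫ m g = m (f ≫ g) := fun f g => by
    simp [m, ShiftedHom.mk₀]
  have hspan : ∀ y : ShiftedHom ((singleFunctor C 0).obj D.P) ((singleFunctor C 0).obj D.P) ((0 : ℕ) : ℤ),
      ∃ a b : k, y = a • m (𝟙 D.P) + b • m ξ := fun y => by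
    obtain ⟨f, rfl⟩ := hm_surj y
    obtain ⟨a, b, rfl⟩ := D.end_P f
    exact ⟨a, b, by rw [hm_add, hm_smul, hm_smul]⟩
  refine isSpherical_of_basis (isBoundedComplex_single D.P) (m ξ) ?_ ?_ ?_ ?_ ?_ ?_ ?_
  · refine (ShiftedHom.mk₀_comp_mk₀ _ _ rfl hd hd).trans ?_
    rw [← Functor.map_comp, hξξ, Functor.map_zero, ShiftedHom.mk₀_zero]
  · intro hmem
    obtain ⟨c, hc⟩ := (mem_identitySubspace hd).1 hmem
    have h1 : c • 𝟙 D.P = ξ := hm_inj _ _ (by rw [hm_smul, ← hc]; simp [m])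
    -- If ξ were the scalar c, then c ξ = ξ² = 0 and hence c = 0, contradicting ξ ≠ 0.
    have h2 : c • ξ = 0 := by rw [← hξξ, ← h1]; simp
    rw [(smul_eq_zero.1 h2).resolve_right hξ, zero_smul] at h1
    exact hξ h1.symm
  · intro h
    have h1 : 𝟙 D.P = 0 := (singleFunctor C 0).map_injective (by simpa using h)
    exact hξ (by rw [← Category.id_comp ξ, h1, zero_comp])
  · intro y
    obtain ⟨a, b, rfl⟩ := hspan y
    exact ⟨_, Submodule.smul_mem _ a hm_id, b, rfl⟩
  · exact fun h => absurd rfl h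
  · intro n hn _ y
    exact single_hom_eq_zero_of_projective D.projective_P hn y
  · intro φ hφ hφξ
    have hφ1 : φ (m (𝟙 D.P)) = 0 := by rwa [← LinearMap.mem_ker, hφ]
    refine D.dualObjects_single φ (D.isDualAt_P hd D.projective_V φ ?_)
      (D.isDualAt_P hd D.projective_P φ ?_)
    -- Hom(P, V) and Hom(V, P) are lines whose generators compose to ξ.
    · refine isDualAt_of_span φ ((singleFunctor C 0).map (D.q ≫ D.i)) (m D.j) ?_ ?_ ?_
      · intro g
        obtain ⟨g, rfl⟩ := (singleFunctor C 0).map_surjective g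
        obtain ⟨c, rfl⟩ := D.hom_P_V g
        exact ⟨c, (singleFunctor C 0).map_smul _ _⟩
      · intro f
        obtain ⟨f, rfl⟩ := hm_surj f
        obtain ⟨c, rfl⟩ := D.hom_V_P f
        exact ⟨c, hm_smul _ _⟩
      · rw [hm_comp, Category.assoc]
        exact hφξ
    -- In the basis given by the identity and ξ, the pairing on End(P) is antidiagonal, because φ
    -- kills the identity and ξ² = 0.
    · have hform : ∀ a b a' b' : k, φ ((singleFunctor C 0).map (a • 𝟙 D.P + b • ξ) ≫ m (a' • 𝟙 D.P + b' • ξ)) =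
          (a * b' + b * a') * φ (m ξ) := by
        intro a b a' b'
        rw [hm_comp]
        have : (a • 𝟙 D.P + b • ξ) ≫ (a' • 𝟙 D.P + b' • ξ) =
            (a * a') • 𝟙 D.P + (a * b' + b * a') • ξ := by
          simp only [Preadditive.comp_add, Preadditive.add_comp, Linear.comp_smul, Linear.smul_comp,
            hξξ, Category.comp_id, Category.id_comp, smul_add, smul_smul, smul_zero, add_smul]
          rw [mul_comm a' a, mul_comm b' a, mul_comm a' b]
          abel
        rw [this, hm_add, hm_smul, hm_smul, map_add, map_smul, map_smul, hφ1]
        simp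
      have hP : ∀ f : D.P ⟶ D.P, ∃ a b : k, f = a • 𝟙 D.P + b • ξ := D.end_P
      refine isDualAt_of_separating φ _ ?_ ?_ ?_
      · classical
        refine ⟨⟨{(singleFunctor C 0).map (𝟙 D.P), (singleFunctor C 0).map ξ}, ?_⟩⟩
        rw [eq_top_iff]
        rintro g -
        obtain ⟨g, rfl⟩ := (singleFunctor C 0).map_surjective g
        obtain ⟨a, b, rfl⟩ := hP g
        rw [(singleFunctor C 0).map_add, (singleFunctor C 0).map_smul, (singleFunctor C 0).map_smul]
        exact Submodule.add_mem _ (Submodule.smul_mem _ _ (Submodule.subset_span (by simp)))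
          (Submodule.smul_mem _ _ (Submodule.subset_span (by simp)))
      · intro g hg
        obtain ⟨g, rfl⟩ := (singleFunctor C 0).map_surjective g
        obtain ⟨a, b, rfl⟩ := hP g
        have h1 := hg (m ((1 : k) • 𝟙 D.P + (0 : k) • ξ))
        have h2 := hg (m ((0 : k) • 𝟙 D.P + (1 : k) • ξ))
        rw [hform] at h1 h2
        have hb : b = 0 := by simpa [hφξ] using h1
        have ha : a = 0 := by simpa [hφξ] using h2
        simp [ha, hb]
      · intro f hf
        obtain ⟨f, rfl⟩ := hm_surj f
        obtain ⟨a, b, rfl⟩ := hP f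
        have h1 := hf ((singleFunctor C 0).map ((1 : k) • 𝟙 D.P + (0 : k) • ξ))
        have h2 := hf ((singleFunctor C 0).map ((0 : k) • 𝟙 D.P + (1 : k) • ξ))
        rw [hform] at h1 h2
        have hb : b = 0 := by simpa [hφξ] using h1
        have ha : a = 0 := by simpa [hφξ] using h2
        rw [ha, hb, zero_smul, zero_smul, add_zero, hm_zero]

end BlockData

end Sphericity

/-! ### Ext computations for L(1), and its sphericity. -/

section SphericityTwo

open Limits Pretriangulated DerivedCategory

universe w v u

variable {k : Type*} [Field k] {C : Type u} [Category.{v} C] [Abelian C] [Linear k C]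
  [HasDerivedCategory.{w} C]

namespace BlockData

variable (D : BlockData k C)

/-- The connecting morphism `A ⟶ S[1]`. -/
noncomputable def δA : ShiftedHom ((singleFunctor C 0).obj D.A) ((singleFunctor C 0).obj D.S) (1 : ℤ) :=
  D.shortExact_A.singleδ

/-- The connecting morphism `S ⟶ V[1]`. -/
noncomputable def δS : ShiftedHom ((singleFunctor C 0).obj D.S) ((singleFunctor C 0).obj D.V) (1 : ℤ) :=
  D.shortExact_S.singleδ

theorem δA_comp_i : D.δA ≫ ((singleFunctor C 0).map D.i)⟦(1 : ℤ)⟧' = 0 :=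
  comp_distTriang_mor_zero₃₁ _ D.shortExact_A.singleTriangle_distinguished

theorem δS_comp_j : D.δS ≫ ((singleFunctor C 0).map D.j)⟦(1 : ℤ)⟧' = 0 :=
  comp_distTriang_mor_zero₃₁ _ D.shortExact_S.singleTriangle_distinguished

theorem exists_eq_δA_comp {W : DerivedCategory C} {n m : ℤ} (h : n + 1 = m)
    (g : ShiftedHom ((singleFunctor C 0).obj D.A) W m) (hg : (singleFunctor C 0).map D.π ≫ g = 0) :
    ∃ f : ShiftedHom ((singleFunctor C 0).obj D.S) W n, g = D.δA.comp f h :=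
  exists_eq_mor₃_comp _ D.shortExact_A.singleTriangle_distinguished h g hg

theorem exists_eq_δS_comp {W : DerivedCategory C} {n m : ℤ} (h : n + 1 = m)
    (g : ShiftedHom ((singleFunctor C 0).obj D.S) W m) (hg : (singleFunctor C 0).map D.q ≫ g = 0) :
    ∃ f : ShiftedHom ((singleFunctor C 0).obj D.V) W n, g = D.δS.comp f h :=
  exists_eq_mor₃_comp _ D.shortExact_S.singleTriangle_distinguished h g hg

theorem exists_eq_i_comp {W : DerivedCategory C} {n m : ℤ} (h : n + 1 = m)
    (f : ShiftedHom ((singleFunctor C 0).obj D.S) W n) (hf : D.δA.comp f h = 0) :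
    ∃ g : ShiftedHom ((singleFunctor C 0).obj D.V) W n, f = (singleFunctor C 0).map D.i ≫ g :=
  exists_eq_mor₁_comp _ D.shortExact_A.singleTriangle_distinguished h f hf

theorem exists_eq_j_comp {W : DerivedCategory C} {n m : ℤ} (h : n + 1 = m)
    (f : ShiftedHom ((singleFunctor C 0).obj D.V) W n) (hf : D.δS.comp f h = 0) :
    ∃ g : ShiftedHom ((singleFunctor C 0).obj D.P) W n, f = (singleFunctor C 0).map D.j ≫ g :=
  exists_eq_mor₁_comp _ D.shortExact_S.singleTriangle_distinguished h f hf

theorem exists_eq_comp_π {W : DerivedCategory C} {n m : ℤ} (h : 1 + n = m)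
    (g : ShiftedHom W ((singleFunctor C 0).obj D.A) n) (hg : g.comp D.δA h = 0) :
    ∃ f : ShiftedHom W ((singleFunctor C 0).obj D.V) n, g = f ≫ ((singleFunctor C 0).map D.π)⟦n⟧' :=
  exists_eq_comp_mor₂ _ D.shortExact_A.singleTriangle_distinguished h g hg

theorem exists_eq_comp_q {W : DerivedCategory C} {n m : ℤ} (h : 1 + n = m)
    (g : ShiftedHom W ((singleFunctor C 0).obj D.S) n) (hg : g.comp D.δS h = 0) :
    ∃ f : ShiftedHom W ((singleFunctor C 0).obj D.P) n, g = f ≫ ((singleFunctor C 0).map D.q)⟦n⟧' :=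
  exists_eq_comp_mor₂ _ D.shortExact_S.singleTriangle_distinguished h g hg

theorem exists_eq_comp_i {W : DerivedCategory C} {n : ℤ}
    (g : ShiftedHom W ((singleFunctor C 0).obj D.V) n) (hg : g ≫ ((singleFunctor C 0).map D.π)⟦n⟧' = 0) :
    ∃ f : ShiftedHom W ((singleFunctor C 0).obj D.S) n, g = f ≫ ((singleFunctor C 0).map D.i)⟦n⟧' :=
  exists_eq_comp_mor₁ _ D.shortExact_A.singleTriangle_distinguished g hg

/-- The generator of `Hom(A, V[2])`. -/
noncomputable def ε : ShiftedHom ((singleFunctor C 0).obj D.A) ((singleFunctor C 0).obj D.V) (2 : ℤ) :=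
  D.δA.comp D.δS (by norm_num)

/-- The generator of `Hom(A, A[2])`. -/
noncomputable def γ : ShiftedHom ((singleFunctor C 0).obj D.A) ((singleFunctor C 0).obj D.A) (2 : ℤ) :=
  D.ε ≫ ((singleFunctor C 0).map D.π)⟦(2 : ℤ)⟧'

theorem smul_mk₀_map {X Y : C} (c : k) (f : X ⟶ Y) :
    ShiftedHom.mk₀ (0 : ℤ) rfl ((singleFunctor C 0).map (c • f)) =
      c • ShiftedHom.mk₀ (0 : ℤ) rfl ((singleFunctor C 0).map f) := by
  simp [Functor.map_smul]

/-- Dimension shifting along V → P → S: outside degree 0 such a morphism comes from Hom^(n-1)(V, V),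
which vanishes for n ≠ 1. -/
theorem shiftedHom_S_V {n : ℤ} (h0 : n ≠ 0) (h1 : n ≠ 1)
    (g : ShiftedHom ((singleFunctor C 0).obj D.S) ((singleFunctor C 0).obj D.V) n) : g = 0 := by
  obtain ⟨f, rfl⟩ := D.exists_eq_δS_comp (n := n - 1) (by omega) g
    (single_hom_eq_zero_of_projective D.projective_P h0 _)
  rw [single_hom_eq_zero_of_projective D.projective_V (by omega) f, ShiftedHom.comp_zero]

theorem shiftedHom_S_V_one
    (g : ShiftedHom ((singleFunctor C 0).obj D.S) ((singleFunctor C 0).obj D.V) (1 : ℤ)) :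
    ∃ c : k, g = c • D.δS := by
  obtain ⟨f, rfl⟩ := D.exists_eq_δS_comp (n := 0) (by norm_num) g
    (single_hom_eq_zero_of_projective D.projective_P one_ne_zero _)
  obtain ⟨f, rfl⟩ := single_hom_zero f
  obtain ⟨c, rfl⟩ := D.end_V f
  refine ⟨c, ?_⟩
  rw [smul_mk₀_map, ShiftedHom.comp_smul, CategoryTheory.Functor.map_id, ShiftedHom.comp_mk₀_id]

/-- In degree 1 the morphism comes from Hom(V, P), spanned by j, and the connecting morphism is
killed by j. The other nonzero degrees vanish by projectivity of V. -/
theorem shiftedHom_S_P {n : ℤ} (h0 : n ≠ 0)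
    (g : ShiftedHom ((singleFunctor C 0).obj D.S) ((singleFunctor C 0).obj D.P) n) : g = 0 := by
  obtain ⟨f, rfl⟩ := D.exists_eq_δS_comp (n := n - 1) (by omega) g
    (single_hom_eq_zero_of_projective D.projective_P h0 _)
  by_cases h1 : n = 1
  · subst h1
    obtain ⟨f, rfl⟩ := single_hom_eq_mk₀ (by norm_num) f
    obtain ⟨c, rfl⟩ := D.hom_V_P f
    rw [ShiftedHom.comp_mk₀, Functor.map_smul, Functor.map_smul, Linear.comp_smul, δS_comp_j,
      smul_zero]
  · rw [single_hom_eq_zero_of_projective D.projective_V (by omega) f, ShiftedHom.comp_zero]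

/-- In degree 1 the candidates are multiples of the connecting morphism followed by i, which is
zero. In degrees other than 0, 1 and 2 they come from a vanishing Hom^(n-1)(S, V). -/
theorem shiftedHom_A_V {n : ℤ} (h2 : n ≠ 2)
    (g : ShiftedHom ((singleFunctor C 0).obj D.A) ((singleFunctor C 0).obj D.V) n) : g = 0 := by
  by_cases h0 : n = 0
  · subst h0
    obtain ⟨g, rfl⟩ := single_hom_zero g
    rw [D.hom_A_V g, Functor.map_zero, ShiftedHom.mk₀_zero]
  · obtain ⟨f, rfl⟩ := D.exists_eq_δA_comp (n := n - 1) (by omega) g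
      (single_hom_eq_zero_of_projective D.projective_V h0 _)
    by_cases h1 : n = 1
    · subst h1
      obtain ⟨f, rfl⟩ := single_hom_eq_mk₀ (by norm_num) f
      obtain ⟨c, rfl⟩ := D.hom_S_V f
      rw [ShiftedHom.comp_mk₀, Functor.map_smul, Functor.map_smul, Linear.comp_smul, δA_comp_i,
        smul_zero]
    · rw [D.shiftedHom_S_V (by omega) (by omega) f, ShiftedHom.comp_zero]

theorem shiftedHom_A_V_two
    (g : ShiftedHom ((singleFunctor C 0).obj D.A) ((singleFunctor C 0).obj D.V) (2 : ℤ)) :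
    ∃ c : k, g = c • D.ε := by
  obtain ⟨f, rfl⟩ := D.exists_eq_δA_comp (n := 1) (by norm_num) g
    (single_hom_eq_zero_of_projective D.projective_V two_ne_zero _)
  obtain ⟨c, rfl⟩ := D.shiftedHom_S_V_one f
  exact ⟨c, ShiftedHom.comp_smul _ _ _ _⟩

/-- In degree 1 a morphism S → P factors through i, which kills the connecting morphism; for n ≠ 0,
1 dimension shifting reduces to `shiftedHom_S_P`. -/
theorem shiftedHom_A_P {n : ℤ}
    (g : ShiftedHom ((singleFunctor C 0).obj D.A) ((singleFunctor C 0).obj D.P) n) : g = 0 := by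
  by_cases h0 : n = 0
  · subst h0
    obtain ⟨g, rfl⟩ := single_hom_zero g
    rw [D.hom_A_P g, Functor.map_zero, ShiftedHom.mk₀_zero]
  · obtain ⟨f, rfl⟩ := D.exists_eq_δA_comp (n := n - 1) (by omega) g
      (single_hom_eq_zero_of_projective D.projective_V h0 _)
    by_cases h1 : n = 1
    · subst h1
      obtain ⟨f, rfl⟩ := single_hom_eq_mk₀ (by norm_num) f
      obtain ⟨c, rfl⟩ := D.hom_S_P f
      rw [ShiftedHom.comp_mk₀, Functor.map_smul, Functor.map_smul, Linear.comp_smul,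
        Functor.map_comp, Functor.map_comp, ← Category.assoc, δA_comp_i, zero_comp, smul_zero]
    · rw [D.shiftedHom_S_P (by omega) f, ShiftedHom.comp_zero]

/-- As A is left orthogonal to P, Hom^n(A, S) embeds into Hom^(n+1)(A, V), which lives only in
degree 2. -/
theorem shiftedHom_A_S {n : ℤ} (h1 : n ≠ 1)
    (g : ShiftedHom ((singleFunctor C 0).obj D.A) ((singleFunctor C 0).obj D.S) n) : g = 0 := by
  obtain ⟨f, rfl⟩ := D.exists_eq_comp_q (m := 1 + n) rfl g (D.shiftedHom_A_V (by omega) _)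
  rw [D.shiftedHom_A_P f, zero_comp]

/-- If ε vanished, δS would factor through i followed by a degree 1 morphism V → V[1], hence be
zero. Then the identity of V would factor through j, but maps P → V are multiples of q i and j q =
0. -/
theorem ε_ne_zero : D.ε ≠ 0 := fun h => by
  obtain ⟨f, hf⟩ := D.exists_eq_i_comp (m := 2) (by norm_num) D.δS h
  have hδ : D.δS = 0 := by
    rw [hf, single_hom_eq_zero_of_projective D.projective_V one_ne_zero f, comp_zero]
  obtain ⟨g, hg⟩ := D.exists_eq_j_comp (n := 0) (m := 1) (by norm_num)
    (ShiftedHom.mk₀ (0 : ℤ) rfl ((singleFunctor C 0).map (𝟙 D.V)))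
    (by rw [hδ, ShiftedHom.zero_comp])
  obtain ⟨g, rfl⟩ := single_hom_zero g
  obtain ⟨c, rfl⟩ := D.hom_P_V g
  rw [ShiftedHom.mk₀, ShiftedHom.mk₀, ← Category.assoc, cancel_mono, ← Functor.map_comp] at hg
  have h1 := (singleFunctor C 0).map_injective hg
  simp only [Linear.comp_smul, j_comp_q_assoc, smul_zero] at h1
  exact D.i_ne_zero (by rw [← Category.comp_id D.i, h1, comp_zero])

/-- If ε were killed by π, it would factor through Hom²(A, S) = 0. -/
theorem γ_ne_zero : D.γ ≠ 0 := fun h => by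
  obtain ⟨f, hf⟩ := D.exists_eq_comp_i D.ε h
  apply D.ε_ne_zero
  rw [hf, D.shiftedHom_A_S (by norm_num) f, zero_comp]

/-- For n ≠ 0 the obstruction to lifting along π lies in Hom^(n+1)(A, S) = 0, so everything comes
from Hom^n(A, V). -/
theorem shiftedHom_A_A {n : ℤ} (h0 : n ≠ 0) (h2 : n ≠ 2)
    (g : ShiftedHom ((singleFunctor C 0).obj D.A) ((singleFunctor C 0).obj D.A) n) : g = 0 := by
  obtain ⟨f, rfl⟩ := D.exists_eq_comp_π (m := 1 + n) rfl g (D.shiftedHom_A_S (by omega) _)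
  rw [D.shiftedHom_A_V h2 f, zero_comp]

theorem shiftedHom_A_A_two
    (g : ShiftedHom ((singleFunctor C 0).obj D.A) ((singleFunctor C 0).obj D.A) (2 : ℤ)) :
    ∃ c : k, g = c • D.γ := by
  obtain ⟨f, rfl⟩ := D.exists_eq_comp_π (m := 3) (by norm_num) g
    (D.shiftedHom_A_S (by norm_num) _)
  obtain ⟨c, rfl⟩ := D.shiftedHom_A_V_two f
  exact ⟨c, Linear.smul_comp _ _ _ _ _ _⟩

/-- Only the shift by 2 contributes: there the generators are ε and π, with composite γ. -/
theorem dualObjects_A_V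
    (φ : ShiftedHom ((singleFunctor C 0).obj D.A) ((singleFunctor C 0).obj D.A) (2 : ℤ) →ₗ[k] k)
    (hφ : φ D.γ ≠ 0) : dualObjects φ ((singleFunctor C 0).obj D.V) := by
  refine ⟨fun n => ?_, (Set.finite_singleton 2).subset fun n hn => ?_⟩
  · by_cases hn : n = 2
    · subst hn
      refine isDualAt_of_span φ D.ε (((singleFunctor C 0).map D.π)⟦(2 : ℤ)⟧')
        D.shiftedHom_A_V_two (fun f => ?_) hφ
      obtain ⟨f, rfl⟩ := (shiftFunctor (DerivedCategory C) (2 : ℤ)).map_surjective f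
      obtain ⟨f, rfl⟩ := (singleFunctor C 0).map_surjective f
      obtain ⟨c, rfl⟩ := D.hom_V_A f
      exact ⟨c, by rw [Functor.map_smul, Functor.map_smul]⟩
    · exact isDualAt_of_subsingleton φ _ (fun g => D.shiftedHom_A_V hn g)
        (fun f => shift_single_hom_eq_zero_of_projective k D.projective_V hn f)
  · by_contra h2
    exact hn ⟨fun a b => (D.shiftedHom_A_V h2 a).trans (D.shiftedHom_A_V h2 b).symm⟩

theorem dualObjects_A_P
    (φ : ShiftedHom ((singleFunctor C 0).obj D.A) ((singleFunctor C 0).obj D.A) (2 : ℤ) →ₗ[k] k) :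
    dualObjects φ ((singleFunctor C 0).obj D.P) := by
  refine ⟨fun n => isDualAt_of_subsingleton φ _ (fun g => D.shiftedHom_A_P g) (fun f => ?_),
    (Set.finite_empty).subset fun n hn =>
      hn ⟨fun a b => (D.shiftedHom_A_P a).trans (D.shiftedHom_A_P b).symm⟩⟩
  by_cases hn : n = 2
  · subst hn
    obtain ⟨f, rfl⟩ := (shiftFunctor (DerivedCategory C) (2 : ℤ)).map_surjective f
    obtain ⟨f, rfl⟩ := (singleFunctor C 0).map_surjective f
    rw [D.hom_P_A f, Functor.map_zero, Functor.map_zero]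
  · exact shift_single_hom_eq_zero_of_projective k D.projective_P hn f

theorem isSpherical_A : IsSpherical k ((singleFunctor C 0).obj D.A) 2 := by
  have hbot : identitySubspace k ((singleFunctor C 0).obj D.A) ((2 : ℕ) : ℤ) = ⊥ :=
    identitySubspace_eq_bot (by norm_num)
  refine isSpherical_of_basis (isBoundedComplex_single D.A) D.γ ?_ ?_ ?_ ?_ ?_ ?_ ?_
  -- The square of γ lies in degree 4, where the endomorphisms vanish.
  · exact D.shiftedHom_A_A (by norm_num) (by norm_num) _
  · rw [hbot]
    exact D.γ_ne_zero
  · intro h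
    exact D.γ_ne_zero ((Category.id_comp D.γ).symm.trans (by rw [h, zero_comp]))
  · intro y
    obtain ⟨c, hc⟩ := D.shiftedHom_A_A_two y
    exact ⟨0, Submodule.zero_mem _, c, by rw [zero_add]; exact hc⟩
  · intro _ y
    obtain ⟨f, rfl⟩ := (singleFunctor C 0).map_surjective y
    obtain ⟨c, rfl⟩ := D.end_A f
    exact ⟨c, by rw [Functor.map_smul, CategoryTheory.Functor.map_id]⟩
  · exact fun n h0 h2 y => D.shiftedHom_A_A h0 h2 y
  · intro φ _ hφ
    exact D.dualObjects_single φ (D.dualObjects_A_V φ hφ) (D.dualObjects_A_P φ)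

end BlockData

end SphericityTwo

namespace SL2

/-! ### Modules over the enveloping algebra from three operators. -/

section Triple

attribute [local instance 100] LieRing.ofAssociativeRing

/-- Three endomorphisms of a vector space that satisfy the relations of `𝔰𝔩₂`. -/
structure Triple (M : Type) [AddCommGroup M] [Module ℂ M] where
  (E H F : Module.End ℂ M)
  H_mul_E : H * E = E * H + (2 : ℂ) • E
  H_mul_F : H * F = F * H - (2 : ℂ) • F
  E_mul_F : E * F = F * E + H

namespace Triple

variable {M : Type} [AddCommGroup M] [Module ℂ M] (t : Triple M)

/-- The representation of `𝔰𝔩₂` given by a triple of endomorphisms. -/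
def rep : sl2 →ₗ⁅ℂ⁆ Module.End ℂ M where
  toFun x := x.1 0 1 • t.E + x.1 0 0 • t.H + x.1 1 0 • t.F
  map_add' x y := by
    have hxy : ∀ i j, (x + y).1 i j = x.1 i j + y.1 i j := fun _ _ => rfl
    simp only [hxy]
    module
  map_smul' c x := by
    have hx : ∀ i j, (c • x).1 i j = c * x.1 i j := fun _ _ => rfl
    simp only [hx, RingHom.id_apply]
    module
  map_lie' {x y} := by
    -- The entry in position (1, 1) is eliminated by tracelessness, so three coordinates describe
    -- the matrix.
    have trace : ∀ z : sl2, z.1 1 1 = - z.1 0 0 := fun z => by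
      have := z.2
      rw [← add_eq_zero_iff_eq_neg']
      simpa [LieAlgebra.SpecialLinear.sl, Matrix.trace, Fin.sum_univ_two] using this
    have hx := trace x
    have hy := trace y
    simp only [LieSubalgebra.coe_bracket, Ring.lie_def, Matrix.sub_apply, Matrix.mul_apply,
      Fin.sum_univ_two, hx, hy, mul_add, add_mul, smul_mul_assoc, mul_smul_comm, t.H_mul_E,
      t.H_mul_F, t.E_mul_F]
    module

/-- The vector space `M`, with the `U(𝔰𝔩₂)`-module structure given by a triple. -/
def Carrier (_ : Triple M) : Type := M

instance : AddCommGroup t.Carrier := inferInstanceAs (AddCommGroup M)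

instance : Module ℂ t.Carrier := inferInstanceAs (Module ℂ M)

noncomputable instance : Module U t.Carrier :=
  Module.compHom M (UniversalEnvelopingAlgebra.lift ℂ t.rep).toRingHom

theorem smul_def (u : U) (x : t.Carrier) :
    u • x = (UniversalEnvelopingAlgebra.lift ℂ t.rep u : Module.End ℂ M) x := rfl

instance : IsScalarTower ℂ U t.Carrier where
  smul_assoc c u x := by
    rw [smul_def, map_smul]
    rfl

theorem ι_smul (y : sl2) (x : t.Carrier) :
    (UniversalEnvelopingAlgebra.ι ℂ y : U) • x = t.rep y x := by
  rw [smul_def, UniversalEnvelopingAlgebra.lift_ι_apply]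

/-- The elements of the underlying vector space, regarded as elements of the module. -/
def toCarrier : M ≃ₗ[ℂ] t.Carrier := LinearEquiv.refl ℂ M

theorem e_smul (x : M) : e • t.toCarrier x = t.toCarrier (t.E x) := by
  refine (t.ι_smul matE (t.toCarrier x)).trans ?_
  simp [rep, matE]
  rfl

theorem h_smul (x : M) : h • t.toCarrier x = t.toCarrier (t.H x) := by
  refine (t.ι_smul matH (t.toCarrier x)).trans ?_
  simp [rep, matH]
  rfl

theorem f_smul (x : M) : f • t.toCarrier x = t.toCarrier (t.F x) := by
  refine (t.ι_smul matF (t.toCarrier x)).trans ?_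
  simp [rep, matF]
  rfl

end Triple

variable {M : Type} [AddCommGroup M] [Module ℂ M] [Module U M] [IsScalarTower ℂ U M]
variable {N : Type} [AddCommGroup N] [Module ℂ N] [Module U N] [IsScalarTower ℂ U N]

/-- A linear map that commutes with `e`, `h` and `f` is `U(𝔰𝔩₂)`-linear. -/
def linearMapOfCommute (g : M →ₗ[ℂ] N) (he : ∀ x, g (e • x) = e • g x)
    (hh : ∀ x, g (h • x) = h • g x) (hf : ∀ x, g (f • x) = f • g x) : M →ₗ[U] N where
  toFun := g
  map_add' := g.map_add
  map_smul' u := by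
    have hu : u ∈ Algebra.adjoin ℂ (Set.range (UniversalEnvelopingAlgebra.ι ℂ : sl2 → U)) := by
      rw [adjoin_range_ι]; trivial
    simp only [RingHom.id_apply]
    induction hu using Algebra.adjoin_induction with
    | mem x hx =>
      obtain ⟨y, rfl⟩ := hx
      intro v
      rw [matrix_eq y]
      have h1 := he v
      have h2 := hh v
      have h3 := hf v
      simp only [e, h, f] at h1 h2 h3
      simp only [map_add, map_smul, add_smul, smul_assoc, h1, h2, h3]
    | algebraMap r =>
      intro v
      rw [algebraMap_smul, algebraMap_smul, map_smul]
    | add x y _ _ hx hy =>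
      intro v
      rw [add_smul, map_add, hx, hy, add_smul]
    | mul x y _ _ hx hy =>
      intro v
      rw [mul_smul, hx, hy, mul_smul]

@[simp]
theorem linearMapOfCommute_apply (g : M →ₗ[ℂ] N) (he hh hf) (x : M) :
    linearMapOfCommute g he hh hf x = g x := rfl

/-- A linear map out of the module given by a triple that commutes with the action of `𝔰𝔩₂`. -/
noncomputable def Triple.desc {M : Type} [AddCommGroup M] [Module ℂ M] (t : Triple M) (g : M →ₗ[ℂ] N)
    (he : ∀ x, g (t.E x) = e • g x) (hh : ∀ x, g (t.H x) = h • g x)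
    (hf : ∀ x, g (t.F x) = f • g x) : t.Carrier →ₗ[U] N :=
  linearMapOfCommute (g ∘ₗ t.toCarrier.symm.toLinearMap)
    (fun x => by obtain ⟨x, rfl⟩ := t.toCarrier.surjective x; simp [t.e_smul, he])
    (fun x => by obtain ⟨x, rfl⟩ := t.toCarrier.surjective x; simp [t.h_smul, hh])
    (fun x => by obtain ⟨x, rfl⟩ := t.toCarrier.surjective x; simp [t.f_smul, hf])

theorem Triple.desc_toCarrier {M : Type} [AddCommGroup M] [Module ℂ M] (t : Triple M) (g : M →ₗ[ℂ] N)
    (he hh hf) (x : M) : t.desc g he hh hf (t.toCarrier x) = g x := by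
  simp [desc]

theorem smul_comm_scalar (u : U) (c : ℂ) (x : M) : u • c • x = c • u • x :=
  smul_algebra_smul_comm c u x

theorem map_scalar (g : M →ₗ[U] N) (c : ℂ) (x : M) : g (c • x) = c • g x :=
  (g.restrictScalars ℂ).map_smul c x

/-- Induction on k with e f = f e + h; the coefficient sums the weights of the lower vectors. At k =
0 the truncated exponent is harmless because its coefficient is zero. -/
theorem e_smul_f_pow_smul {μ : ℂ} {n : N} (hn : n ∈ weightSpace N μ) (k : ℕ) :
    e • f ^ k • n = f ^ k • e • n + ((k : ℂ) * (μ - k + 1)) • f ^ (k - 1) • n := by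
  induction k with
  | zero => simp
  | succ k ih =>
    have hw := mem_weightSpace.1 (f_pow_smul_mem hn k)
    rw [pow_succ', mul_smul, ← mul_smul e f, e_mul_f, add_smul, mul_smul, ih, hw, smul_add,
      smul_comm_scalar, ← mul_smul f (f ^ k), ← pow_succ', add_assoc]
    congr 1
    rcases k with _ | k
    · simp
    · simp only [Nat.add_sub_cancel]
      rw [← mul_smul f (f ^ k), ← pow_succ', ← add_smul]
      congr 1
      push_cast
      ring

end Triple

/-! ### Explicit models of the Verma modules and the big projective. -/

section Verma

/-- The operator `f` of a Verma module in the basis `f ^ k v`. -/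
noncomputable def opF : Module.End ℂ (ℕ →₀ ℂ) :=
  Finsupp.linearCombination ℂ fun k => Finsupp.single (k + 1) 1

/-- The operator `h` of the Verma module of highest weight `μ` in the basis `f ^ k v`. -/
noncomputable def opH (μ : ℂ) : Module.End ℂ (ℕ →₀ ℂ) :=
  Finsupp.linearCombination ℂ fun k => Finsupp.single k (μ - 2 * k)

/-- The operator `e` of the Verma module of highest weight `μ` in the basis `f ^ k v`. -/
noncomputable def opE (μ : ℂ) : Module.End ℂ (ℕ →₀ ℂ) :=
  -- The truncated index at k = 0 carries the coefficient 0.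
  Finsupp.linearCombination ℂ fun k => Finsupp.single (k - 1) (k * (μ - k + 1))

@[simp]
theorem opF_single (k : ℕ) (c : ℂ) : opF (Finsupp.single k c) = Finsupp.single (k + 1) c := by
  simp only [opF, Finsupp.linearCombination_single, Finsupp.smul_single, smul_eq_mul, mul_one]

@[simp]
theorem opH_single (μ : ℂ) (k : ℕ) (c : ℂ) :
    opH μ (Finsupp.single k c) = Finsupp.single k (c * (μ - 2 * k)) := by
  simp only [opH, Finsupp.linearCombination_single, Finsupp.smul_single, smul_eq_mul]

@[simp]
theorem opE_single (μ : ℂ) (k : ℕ) (c : ℂ) :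
    opE μ (Finsupp.single k c) = Finsupp.single (k - 1) (c * (k * (μ - k + 1))) := by
  simp only [opE, Finsupp.linearCombination_single, Finsupp.smul_single, smul_eq_mul]

theorem opH_apply (μ : ℂ) (x : ℕ →₀ ℂ) (k : ℕ) : opH μ x k = (μ - 2 * k) * x k := by
  induction x using Finsupp.induction_linear with
  | zero => simp
  | add a b ha hb => simp [ha, hb, mul_add]
  | single n c =>
    rw [opH_single]
    by_cases hn : n = k
    · subst hn
      rw [Finsupp.single_eq_same, Finsupp.single_eq_same, mul_comm]
    · rw [Finsupp.single_eq_of_ne' hn, Finsupp.single_eq_of_ne' hn, mul_zero]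

/-- In coordinates, the relations of 𝔰𝔩₂ become polynomial identities that can be checked entry by
entry. -/
theorem opE_apply (μ : ℂ) (x : ℕ →₀ ℂ) (k : ℕ) :
    opE μ x k = (k + 1) * (μ - k) * x (k + 1) := by
  induction x using Finsupp.induction_linear with
  | zero => simp
  | add a b ha hb => simp [ha, hb, mul_add]
  | single n c =>
    rw [opE_single]
    rcases n with _ | n
    · rw [Finsupp.single_eq_of_ne' k.succ_ne_zero.symm, Nat.cast_zero, zero_mul, mul_zero,
        Finsupp.single_zero, mul_zero, Finsupp.zero_apply]
    · by_cases hn : n = k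
      · subst hn
        rw [Nat.add_sub_cancel, Finsupp.single_eq_same, Finsupp.single_eq_same]
        push_cast
        ring
      · rw [Nat.add_sub_cancel, Finsupp.single_eq_of_ne' hn, Finsupp.single_eq_of_ne' (by omega),
          mul_zero]

theorem opF_apply_succ (x : ℕ →₀ ℂ) (k : ℕ) : opF x (k + 1) = x k := by
  induction x using Finsupp.induction_linear with
  | zero => simp
  | add a b ha hb => simp [ha, hb]
  | single n c => simp [Finsupp.single_apply]

theorem opF_apply_zero (x : ℕ →₀ ℂ) : opF x 0 = 0 := by
  induction x using Finsupp.induction_linear with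
  | zero => simp
  | add a b ha hb => simp [ha, hb]
  | single n c => simp

theorem opH_mul_opE (μ : ℂ) : opH μ * opE μ = opE μ * opH μ + (2 : ℂ) • opE μ := by
  refine LinearMap.ext fun x => Finsupp.ext fun k => ?_
  simp only [Module.End.mul_apply, LinearMap.add_apply, LinearMap.smul_apply, Finsupp.add_apply,
    Finsupp.smul_apply, opH_apply, opE_apply, smul_eq_mul]
  push_cast
  ring

theorem opH_mul_opF (μ : ℂ) : opH μ * opF = opF * opH μ - (2 : ℂ) • opF := by
  refine LinearMap.ext fun x => Finsupp.ext fun k => ?_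
  rcases k with _ | k <;>
  · simp only [Module.End.mul_apply, LinearMap.sub_apply, LinearMap.smul_apply, Finsupp.sub_apply,
      Finsupp.smul_apply, opH_apply, opF_apply_zero, opF_apply_succ, smul_eq_mul]
    push_cast
    ring

theorem opE_mul_opF (μ : ℂ) : opE μ * opF = opF * opE μ + opH μ := by
  refine LinearMap.ext fun x => Finsupp.ext fun k => ?_
  rcases k with _ | k <;>
  · simp only [Module.End.mul_apply, LinearMap.add_apply, Finsupp.add_apply,
      opH_apply, opE_apply, opF_apply_zero, opF_apply_succ]
    push_cast
    ring

/-- The Verma module of highest weight `μ`. -/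
noncomputable def vermaTriple (μ : ℂ) : Triple (ℕ →₀ ℂ) where
  E := opE μ
  H := opH μ
  F := opF
  H_mul_E := opH_mul_opE μ
  H_mul_F := opH_mul_opF μ
  E_mul_F := opE_mul_opF μ

/-- The underlying space of the Verma module of highest weight `μ`. -/
abbrev Verma (μ : ℂ) : Type := (vermaTriple μ).Carrier

/-- The operator `e` of the big projective module in the basis `f ^ k e v`, `f ^ k v`. -/
noncomputable def bigE : Module.End ℂ ((ℕ →₀ ℂ) × (ℕ →₀ ℂ)) :=
  -- The summand `snd` records the term f^k e v of e f^k v, which is absent for a highest weight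
  -- vector.
  ((opE 0 ∘ₗ LinearMap.fst ℂ _ _) + LinearMap.snd ℂ _ _).prod (opE (-2) ∘ₗ LinearMap.snd ℂ _ _)

/-- The big projective module in the basis `f ^ k e v`, `f ^ k v`, where the generator `v` has
weight `-2` and satisfies `e² v = 0`. -/
noncomputable def bigTriple : Triple ((ℕ →₀ ℂ) × (ℕ →₀ ℂ)) where
  E := bigE
  H := (opH 0).prodMap (opH (-2))
  F := opF.prodMap opF
  H_mul_E := by
    refine LinearMap.ext fun ⟨a, b⟩ => Prod.ext ?_ ?_
    -- The extra summand of e satisfies the relation because the operators h of highest weight 0 and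
    -- -2 differ by the scalar 2.
    · have h1 := LinearMap.congr_fun (opH_mul_opE 0) a
      simp [bigE] at h1 ⊢
      rw [h1]
      ext k
      simp [opH_apply]
      ring
    · simpa [bigE] using LinearMap.congr_fun (opH_mul_opE (-2)) b
  H_mul_F := by
    refine LinearMap.ext fun ⟨a, b⟩ => Prod.ext ?_ ?_
    · simpa using LinearMap.congr_fun (opH_mul_opF 0) a
    · simpa using LinearMap.congr_fun (opH_mul_opF (-2)) b
  E_mul_F := by
    refine LinearMap.ext fun ⟨a, b⟩ => Prod.ext ?_ ?_
    · have h1 := LinearMap.congr_fun (opE_mul_opF 0) a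
      simp [bigE] at h1 ⊢
      rw [h1]
      abel
    · simpa [bigE] using LinearMap.congr_fun (opE_mul_opF (-2)) b

/-- The underlying space of the big projective module. -/
abbrev Big : Type := bigTriple.Carrier

end Verma

/-! ### Generators and universal properties. -/

section Universal

variable {N : Type} [AddCommGroup N] [Module ℂ N] [Module U N] [IsScalarTower ℂ U N]

/-- The finitely supported functions on `ℕ`, regarded as elements of a Verma module. -/
noncomputable abbrev vermaMk (μ : ℂ) : (ℕ →₀ ℂ) ≃ₗ[ℂ] Verma μ := (vermaTriple μ).toCarrier

/-- The elements of the underlying vector space of the big projective module. -/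
noncomputable abbrev bigMk : ((ℕ →₀ ℂ) × (ℕ →₀ ℂ)) ≃ₗ[ℂ] Big := bigTriple.toCarrier

/-- The highest weight vector of a Verma module. -/
noncomputable def vermaVec (μ : ℂ) : Verma μ := vermaMk μ (Finsupp.single 0 1)

/-- The generator of the big projective module. -/
noncomputable def bigVec : Big := bigMk (0, Finsupp.single 0 1)

theorem verma_e_smul (μ : ℂ) (x : ℕ →₀ ℂ) : e • vermaMk μ x = vermaMk μ (opE μ x) :=
  (vermaTriple μ).e_smul x

theorem verma_h_smul (μ : ℂ) (x : ℕ →₀ ℂ) : h • vermaMk μ x = vermaMk μ (opH μ x) :=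
  (vermaTriple μ).h_smul x

theorem verma_f_smul (μ : ℂ) (x : ℕ →₀ ℂ) : f • vermaMk μ x = vermaMk μ (opF x) :=
  (vermaTriple μ).f_smul x

theorem big_e_smul (a b : ℕ →₀ ℂ) : e • bigMk (a, b) = bigMk (opE 0 a + b, opE (-2) b) :=
  bigTriple.e_smul (a, b)

theorem big_h_smul (a b : ℕ →₀ ℂ) : h • bigMk (a, b) = bigMk (opH 0 a, opH (-2) b) :=
  bigTriple.h_smul (a, b)

theorem big_f_smul (a b : ℕ →₀ ℂ) : f • bigMk (a, b) = bigMk (opF a, opF b) :=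
  bigTriple.f_smul (a, b)

theorem f_pow_smul_vermaVec (μ : ℂ) (k : ℕ) :
    f ^ k • vermaVec μ = vermaMk μ (Finsupp.single k 1) := by
  induction k with
  | zero => rw [pow_zero, one_smul]; rfl
  | succ k ih => rw [pow_succ', mul_smul, ih, verma_f_smul, opF_single]

theorem f_pow_smul_bigVec (k : ℕ) : f ^ k • bigVec = bigMk (0, Finsupp.single k 1) := by
  induction k with
  | zero => rw [pow_zero, one_smul]; rfl
  | succ k ih => rw [pow_succ', mul_smul, ih, big_f_smul, opF_single, map_zero]

theorem e_smul_bigVec : e • bigVec = bigMk (Finsupp.single 0 1, 0) := by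
  rw [bigVec, big_e_smul, map_zero, opE_single]
  simp

theorem f_pow_smul_e_smul_bigVec (k : ℕ) :
    f ^ k • e • bigVec = bigMk (Finsupp.single k 1, 0) := by
  induction k with
  | zero => rw [pow_zero, one_smul, e_smul_bigVec]
  | succ k ih => rw [pow_succ', mul_smul, ih, big_f_smul, opF_single, map_zero]

theorem vermaVec_mem (μ : ℂ) : vermaVec μ ∈ weightSpace (Verma μ) μ := by
  rw [mem_weightSpace, vermaVec, verma_h_smul, opH_single, ← map_smul, Finsupp.smul_single]
  simp

theorem bigVec_mem : bigVec ∈ weightSpace Big (-2) := by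
  rw [mem_weightSpace, bigVec, big_h_smul, opH_single, map_zero, ← map_smul, Prod.smul_mk,
    Finsupp.smul_single]
  simp

theorem e_smul_vermaVec (μ : ℂ) : e • vermaVec μ = 0 := by
  rw [vermaVec, verma_e_smul, opE_single, Nat.cast_zero, zero_mul, mul_zero, Finsupp.single_zero,
    map_zero]

theorem e_smul_e_smul_bigVec : e • e • bigVec = 0 := by
  rw [e_smul_bigVec, big_e_smul, map_zero, opE_single, Nat.cast_zero, zero_mul, mul_zero,
    Finsupp.single_zero, add_zero]
  exact map_zero _

theorem verma_induction {μ : ℂ} {p : Verma μ → Prop} (h0 : p 0)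
    (hadd : ∀ x y, p x → p y → p (x + y)) (hbasis : ∀ (c : ℂ) (k : ℕ), p (c • f ^ k • vermaVec μ))
    (x : Verma μ) : p x := by
  obtain ⟨x, rfl⟩ := (vermaMk μ).surjective x
  induction x using Finsupp.induction_linear with
  | zero => simpa using h0
  | add a b ha hb => simpa using hadd _ _ ha hb
  | single k c =>
    have hk := hbasis c k
    rwa [f_pow_smul_vermaVec, ← map_smul, Finsupp.smul_single, smul_eq_mul, mul_one] at hk

theorem big_induction {p : Big → Prop} (h0 : p 0)
    (hadd : ∀ x y, p x → p y → p (x + y)) (hbasis : ∀ (c : ℂ) (k : ℕ), p (c • f ^ k • bigVec))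
    (hbasis' : ∀ (c : ℂ) (k : ℕ), p (c • f ^ k • e • bigVec)) (x : Big) : p x := by
  obtain ⟨⟨a, b⟩, rfl⟩ := bigMk.surjective x
  have ha : p (bigMk (a, 0)) := by
    induction a using Finsupp.induction_linear with
    | zero => exact (map_zero bigMk).symm ▸ h0
    | add a b ha hb =>
      have hab := hadd _ _ ha hb
      rwa [← map_add, Prod.mk_add_mk, add_zero] at hab
    | single k c =>
      have hk := hbasis' c k
      rwa [f_pow_smul_e_smul_bigVec, ← map_smul, Prod.smul_mk, Finsupp.smul_single, smul_eq_mul,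
        mul_one, smul_zero] at hk
  have hb : p (bigMk (0, b)) := by
    induction b using Finsupp.induction_linear with
    | zero => exact (map_zero bigMk).symm ▸ h0
    | add a b ha hb =>
      have hab := hadd _ _ ha hb
      rwa [← map_add, Prod.mk_add_mk, add_zero] at hab
    | single k c =>
      have hk := hbasis c k
      rwa [f_pow_smul_bigVec, ← map_smul, Prod.smul_mk, Finsupp.smul_single, smul_eq_mul,
        mul_one, smul_zero] at hk
  have hab := hadd _ _ ha hb
  rwa [← map_add, Prod.mk_add_mk, add_zero, zero_add] at hab

theorem verma_hom_ext {μ : ℂ} {g g' : Verma μ →ₗ[U] N} (hg : g (vermaVec μ) = g' (vermaVec μ)) :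
    g = g' := by
  refine LinearMap.ext fun x => ?_
  induction x using verma_induction with
  | h0 => simp
  | hadd x y hx hy => simp [hx, hy]
  | hbasis c k => simp only [map_scalar, map_smul, hg]

theorem big_hom_ext {g g' : Big →ₗ[U] N} (hg : g bigVec = g' bigVec) : g = g' := by
  refine LinearMap.ext fun x => ?_
  induction x using big_induction with
  | h0 => simp
  | hadd x y hx hy => simp [hx, hy]
  | hbasis c k => simp only [map_scalar, map_smul, hg]
  | hbasis' c k => simp only [map_scalar, map_smul, hg]

/-- The linear map that sends the basis `f ^ k v` to `f ^ k n`. -/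
noncomputable def fPowMap (n : N) : (ℕ →₀ ℂ) →ₗ[ℂ] N :=
  Finsupp.linearCombination ℂ fun k => f ^ k • n

theorem fPowMap_single (n : N) (k : ℕ) (c : ℂ) : fPowMap n (Finsupp.single k c) = c • f ^ k • n := by
  simp [fPowMap]

theorem fPowMap_opF (n : N) (x : ℕ →₀ ℂ) : fPowMap n (opF x) = f • fPowMap n x := by
  induction x using Finsupp.induction_linear with
  | zero => simp
  | add a b ha hb => simp [ha, hb]
  | single k c =>
    rw [opF_single, fPowMap_single, fPowMap_single, smul_comm_scalar, ← mul_smul, ← pow_succ']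

theorem fPowMap_opH {μ : ℂ} {n : N} (hn : n ∈ weightSpace N μ) (x : ℕ →₀ ℂ) :
    fPowMap n (opH μ x) = h • fPowMap n x := by
  induction x using Finsupp.induction_linear with
  | zero => simp
  | add a b ha hb => simp [ha, hb]
  | single k c =>
    rw [opH_single, fPowMap_single, fPowMap_single, smul_comm_scalar,
      mem_weightSpace.1 (f_pow_smul_mem hn k), mul_smul]

/-- The defect of e-linearity is the map built from e • n. It vanishes for a highest weight vector,
and for the big projective it is exactly the second component of the lift. -/
theorem fPowMap_opE {μ : ℂ} {n : N} (hn : n ∈ weightSpace N μ) (x : ℕ →₀ ℂ) :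
    e • fPowMap n x = fPowMap (e • n) x + fPowMap n (opE μ x) := by
  induction x using Finsupp.induction_linear with
  | zero => simp
  | add a b ha hb =>
    simp only [map_add, smul_add, ha, hb]
    abel
  | single k c =>
    rw [opE_single, fPowMap_single, fPowMap_single, fPowMap_single, smul_comm_scalar,
      e_smul_f_pow_smul hn, smul_add, ← mul_smul c]

theorem fPowMap_zero (x : ℕ →₀ ℂ) : fPowMap (0 : N) x = 0 := by
  simp [fPowMap, Finsupp.linearCombination_apply]

/-- The universal property of Verma modules. -/
noncomputable def vermaLift {μ : ℂ} (n : N) (hn : n ∈ weightSpace N μ) (he : e • n = 0) :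
    Verma μ →ₗ[U] N :=
  (vermaTriple μ).desc (fPowMap n)
    (fun x => by rw [fPowMap_opE hn, he, fPowMap_zero, zero_add]; rfl)
    (fPowMap_opH hn) (fPowMap_opF n)

theorem vermaLift_mk {μ : ℂ} (n : N) (hn : n ∈ weightSpace N μ) (he : e • n = 0) (x : ℕ →₀ ℂ) :
    vermaLift n hn he (vermaMk μ x) = fPowMap n x :=
  (vermaTriple μ).desc_toCarrier _ _ _ _ _

theorem vermaLift_vec {μ : ℂ} (n : N) (hn : n ∈ weightSpace N μ) (he : e • n = 0) :
    vermaLift n hn he (vermaVec μ) = n := by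
  rw [vermaVec, vermaLift_mk, fPowMap_single]
  simp

/-- The universal property of the big projective module. -/
noncomputable def bigLift (n : N) (hn : n ∈ weightSpace N (-2)) (he : e • e • n = 0) :
    Big →ₗ[U] N :=
  have hen : e • n ∈ weightSpace N 0 := by simpa using e_smul_mem hn
  bigTriple.desc ((fPowMap (e • n)).coprod (fPowMap n))
    (fun ⟨a, b⟩ => by
      refine Eq.trans (b := (fPowMap (e • n)) (opE 0 a + b) + (fPowMap n) (opE (-2) b)) rfl ?_
      simp only [LinearMap.coprod_apply, smul_add, fPowMap_opE hn, fPowMap_opE hen, he,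
        fPowMap_zero, map_add, zero_add]
      abel)
    (fun ⟨a, b⟩ => by
      refine Eq.trans (b := (fPowMap (e • n)) (opH 0 a) + (fPowMap n) (opH (-2) b)) rfl ?_
      simp only [LinearMap.coprod_apply, smul_add, fPowMap_opH hn, fPowMap_opH hen])
    (fun ⟨a, b⟩ => by
      refine Eq.trans (b := (fPowMap (e • n)) (opF a) + (fPowMap n) (opF b)) rfl ?_
      simp only [LinearMap.coprod_apply, smul_add, fPowMap_opF])

theorem bigLift_vec (n : N) (hn : n ∈ weightSpace N (-2)) (he : e • e • n = 0) :
    bigLift n hn he bigVec = n := by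
  rw [bigLift, bigVec, Triple.desc_toCarrier]
  simp [fPowMap_single]

end Universal

/-! ### The maps between the Verma modules and the big projective. -/

section Maps

/-- The inclusion of the dominant Verma module into the big projective module. -/
noncomputable def vermaToBig : Verma 0 →ₗ[U] Big :=
  (vermaTriple 0).desc (bigMk.toLinearMap ∘ₗ LinearMap.inl ℂ (ℕ →₀ ℂ) (ℕ →₀ ℂ))
    (fun x => ((big_e_smul x 0).trans (by simp [vermaTriple])).symm)
    (fun x => ((big_h_smul x 0).trans (by simp [vermaTriple])).symm)
    (fun x => ((big_f_smul x 0).trans (by simp [vermaTriple])).symm)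

theorem vermaToBig_mk (x : ℕ →₀ ℂ) : vermaToBig (vermaMk 0 x) = bigMk (x, 0) :=
  Triple.desc_toCarrier _ _ _ _ _ _

/-- The projection of the big projective module onto the antidominant Verma module. -/
noncomputable def bigToVerma : Big →ₗ[U] Verma (-2) :=
  bigTriple.desc ((vermaMk (-2)).toLinearMap ∘ₗ LinearMap.snd ℂ (ℕ →₀ ℂ) (ℕ →₀ ℂ))
    (fun ⟨_, b⟩ => (verma_e_smul _ b).symm)
    (fun ⟨_, b⟩ => (verma_h_smul _ b).symm)
    (fun ⟨_, b⟩ => (verma_f_smul _ b).symm)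

theorem bigToVerma_mk (a b : ℕ →₀ ℂ) : bigToVerma (bigMk (a, b)) = vermaMk (-2) b :=
  Triple.desc_toCarrier _ _ _ _ _ _

/-- The inclusion of the antidominant Verma module into the dominant one. -/
noncomputable def vermaToVerma : Verma (-2) →ₗ[U] Verma 0 :=
  vermaLift (f • vermaVec 0) (by simpa using f_smul_mem (vermaVec_mem 0)) (by
    -- The vector f v is singular: the coefficient k (μ - k + 1) vanishes at k = 1, μ = 0.
    rw [← pow_one f, f_pow_smul_vermaVec, verma_e_smul, opE_single]
    simp)

theorem vermaToVerma_vec : vermaToVerma (vermaVec (-2)) = f • vermaVec 0 := vermaLift_vec _ _ _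

theorem vermaToVerma_mk (x : ℕ →₀ ℂ) : vermaToVerma (vermaMk (-2) x) = vermaMk 0 (opF x) := by
  rw [vermaToVerma, vermaLift_mk]
  induction x using Finsupp.induction_linear with
  | zero => simp
  | add a b ha hb => simp only [map_add, ha, hb]
  | single k c =>
    rw [fPowMap_single, ← mul_smul, ← pow_succ, f_pow_smul_vermaVec, opF_single, ← map_smul,
      Finsupp.smul_single, smul_eq_mul, mul_one]

theorem vermaToBig_vec : vermaToBig (vermaVec 0) = e • bigVec := by
  rw [e_smul_bigVec, vermaVec, vermaToBig_mk]

theorem bigToVerma_vec : bigToVerma bigVec = vermaVec (-2) := bigToVerma_mk _ _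

theorem vermaToBig_injective : Function.Injective vermaToBig := fun x y hxy => by
  obtain ⟨x, rfl⟩ := (vermaMk 0).surjective x
  obtain ⟨y, rfl⟩ := (vermaMk 0).surjective y
  rw [vermaToBig_mk, vermaToBig_mk] at hxy
  have h1 : x = y := congrArg Prod.fst (bigMk.injective hxy)
  rw [h1]

theorem bigToVerma_surjective : Function.Surjective bigToVerma := fun x => by
  obtain ⟨x, rfl⟩ := (vermaMk (-2)).surjective x
  exact ⟨bigMk (0, x), bigToVerma_mk _ _⟩

theorem vermaToVerma_injective : Function.Injective vermaToVerma := fun x y hxy => by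
  obtain ⟨x, rfl⟩ := (vermaMk (-2)).surjective x
  obtain ⟨y, rfl⟩ := (vermaMk (-2)).surjective y
  rw [vermaToVerma_mk, vermaToVerma_mk] at hxy
  congr 1
  refine Finsupp.ext fun k => ?_
  rw [← opF_apply_succ, (vermaMk 0).injective hxy, opF_apply_succ]

theorem exact_vermaToBig_bigToVerma : Function.Exact vermaToBig bigToVerma := fun x => by
  obtain ⟨⟨a, b⟩, rfl⟩ := bigMk.surjective x
  rw [bigToVerma_mk]
  constructor
  · intro hb
    rw [(vermaMk (-2)).injective (hb.trans (map_zero (vermaMk (-2))).symm)]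
    exact ⟨vermaMk 0 a, vermaToBig_mk a⟩
  · rintro ⟨y, hy⟩
    obtain ⟨y, rfl⟩ := (vermaMk 0).surjective y
    rw [vermaToBig_mk] at hy
    have h1 : 0 = b := congrArg Prod.snd (bigMk.injective hy)
    rw [← h1, map_zero]

end Maps

theorem dotAction_one : dotAction 1 0 = 0 := by simp [dotAction]

theorem dotAction_s : dotAction s 0 = -2 := by
  simp [dotAction, s]
  norm_num

theorem dotAction_eq (w : W) : dotAction w 0 = 0 ∨ dotAction w 0 = -2 := by
  rcases Int.units_eq_one_or (Equiv.Perm.sign w) with hw | hw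
  · exact Or.inl (by simp [dotAction, hw])
  · exact Or.inr (by simp [dotAction, hw]; norm_num)

/-! ### Weight spaces of the explicit modules. -/

section Weights

theorem verma_apply_of_mem {μ ν : ℂ} {x : ℕ →₀ ℂ} (hx : vermaMk μ x ∈ weightSpace (Verma μ) ν)
    (k : ℕ) : (μ - 2 * k - ν) * x k = 0 := by
  rw [mem_weightSpace, verma_h_smul, ← map_smul] at hx
  have h1 := DFunLike.congr_fun ((vermaMk μ).injective hx) k
  rw [opH_apply, Finsupp.smul_apply, smul_eq_mul] at h1
  linear_combination h1

theorem big_apply_of_mem {ν : ℂ} {a b : ℕ →₀ ℂ} (hx : bigMk (a, b) ∈ weightSpace Big ν)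
    (k : ℕ) : (0 - 2 * k - ν) * a k = 0 ∧ (-2 - 2 * k - ν) * b k = 0 := by
  rw [mem_weightSpace, big_h_smul, ← map_smul] at hx
  have h1 := DFunLike.congr_fun (congrArg Prod.fst (bigMk.injective hx)) k
  have h2 := DFunLike.congr_fun (congrArg Prod.snd (bigMk.injective hx)) k
  simp only [Prod.smul_mk, opH_apply, Finsupp.smul_apply, smul_eq_mul] at h1 h2
  exact ⟨by linear_combination h1, by linear_combination h2⟩

theorem verma_exists_of_mem {μ ν : ℂ} {x : Verma μ} (hx : x ∈ weightSpace (Verma μ) ν)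
    (hx0 : x ≠ 0) : ∃ k : ℕ, ν = μ - 2 * k := by
  obtain ⟨x, rfl⟩ := (vermaMk μ).surjective x
  obtain ⟨k, hk⟩ := Finsupp.ne_iff.1 (show x ≠ 0 by rintro rfl; exact hx0 (map_zero _))
  refine ⟨k, ?_⟩
  have h1 := (mul_eq_zero.1 (verma_apply_of_mem hx k)).resolve_right hk
  linear_combination -h1

theorem verma_eq_of_mem {μ : ℂ} {m : ℕ} {x : Verma μ}
    (hx : x ∈ weightSpace (Verma μ) (μ - 2 * m)) : ∃ c : ℂ, x = c • f ^ m • vermaVec μ := by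
  obtain ⟨x, rfl⟩ := (vermaMk μ).surjective x
  refine ⟨x m, ?_⟩
  rw [f_pow_smul_vermaVec, ← map_smul, Finsupp.smul_single, smul_eq_mul, mul_one]
  congr 1
  refine Finsupp.ext fun k => ?_
  by_cases hk : m = k
  · subst hk
    rw [Finsupp.single_eq_same]
  · rw [Finsupp.single_eq_of_ne' hk]
    refine (mul_eq_zero.1 (verma_apply_of_mem hx k)).resolve_left fun h1 => hk ?_
    have h2 : (m : ℂ) = k := by linear_combination h1 / 2
    exact_mod_cast h2

/-- Basis vectors have weights -2k and -2 - 2k, none of which equals 2. This is what makes e locally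
nilpotent. -/
theorem big_eq_zero_of_mem {x : Big} (hx : x ∈ weightSpace Big 2) : x = 0 := by
  obtain ⟨⟨a, b⟩, rfl⟩ := bigMk.surjective x
  have ha : a = 0 := Finsupp.ext fun k =>
    (mul_eq_zero.1 (big_apply_of_mem hx k).1).resolve_left fun h1 => by
      have h2 : ((k + 1 : ℕ) : ℂ) = 0 := by push_cast; linear_combination -h1 / 2
      exact absurd h2 (Nat.cast_ne_zero.2 (Nat.succ_ne_zero k))
  have hb : b = 0 := Finsupp.ext fun k =>
    (mul_eq_zero.1 (big_apply_of_mem hx k).2).resolve_left fun h1 => by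
      have h2 : ((k + 2 : ℕ) : ℂ) = 0 := by push_cast; linear_combination -h1 / 2
      exact absurd h2 (Nat.cast_ne_zero.2 (Nat.succ_ne_zero (k + 1)))
  rw [ha, hb]
  exact map_zero bigMk

theorem big_eq_of_mem_zero {x : Big} (hx : x ∈ weightSpace Big 0) : ∃ c : ℂ, x = c • e • bigVec := by
  obtain ⟨⟨a, b⟩, rfl⟩ := bigMk.surjective x
  refine ⟨a 0, ?_⟩
  have hb : b = 0 := Finsupp.ext fun k =>
    (mul_eq_zero.1 (big_apply_of_mem hx k).2).resolve_left fun h1 => by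
      have h2 : ((k + 1 : ℕ) : ℂ) = 0 := by push_cast; linear_combination -h1 / 2
      exact absurd h2 (Nat.cast_ne_zero.2 (Nat.succ_ne_zero k))
  have ha : a = Finsupp.single 0 (a 0) := Finsupp.ext fun k => by
    rcases k with _ | k
    · rw [Finsupp.single_eq_same]
    · rw [Finsupp.single_eq_of_ne' k.succ_ne_zero.symm]
      refine (mul_eq_zero.1 (big_apply_of_mem hx (k + 1)).1).resolve_left fun h1 => ?_
      have h2 : ((k + 1 : ℕ) : ℂ) = 0 := by push_cast at *; linear_combination -h1 / 2
      exact absurd h2 (Nat.cast_ne_zero.2 (Nat.succ_ne_zero k))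
  rw [e_smul_bigVec, ← map_smul, Prod.smul_mk, Finsupp.smul_single, smul_eq_mul, mul_one, ← ha, hb,
    smul_zero]

theorem big_eq_of_mem_neg_two {x : Big} (hx : x ∈ weightSpace Big (-2)) :
    ∃ c d : ℂ, x = c • bigVec + d • f • e • bigVec := by
  obtain ⟨⟨a, b⟩, rfl⟩ := bigMk.surjective x
  refine ⟨b 0, a 1, ?_⟩
  have hb : b = Finsupp.single 0 (b 0) := Finsupp.ext fun k => by
    rcases k with _ | k
    · rw [Finsupp.single_eq_same]
    · rw [Finsupp.single_eq_of_ne' k.succ_ne_zero.symm]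
      refine (mul_eq_zero.1 (big_apply_of_mem hx (k + 1)).2).resolve_left fun h1 => ?_
      have h2 : ((k + 1 : ℕ) : ℂ) = 0 := by push_cast at *; linear_combination -h1 / 2
      exact absurd h2 (Nat.cast_ne_zero.2 (Nat.succ_ne_zero k))
  have ha : a = Finsupp.single 1 (a 1) := Finsupp.ext fun k => by
    by_cases hk : 1 = k
    · subst hk
      rw [Finsupp.single_eq_same]
    · rw [Finsupp.single_eq_of_ne' hk]
      refine (mul_eq_zero.1 (big_apply_of_mem hx k).1).resolve_left fun h1 => hk ?_
      have h2 : ((1 : ℕ) : ℂ) = k := by push_cast; linear_combination h1 / 2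
      exact_mod_cast h2
  have h1 := f_pow_smul_e_smul_bigVec 1
  rw [pow_one] at h1
  rw [h1, bigVec, ← map_smul, ← map_smul, ← map_add, Prod.smul_mk, Prod.smul_mk, Prod.mk_add_mk,
    Finsupp.smul_single, Finsupp.smul_single, smul_eq_mul, smul_eq_mul, mul_one, mul_one, ← ha, ← hb,
    smul_zero, smul_zero, zero_add, add_zero]

theorem iSup_weightSpace_big : ⨆ μ, weightSpace Big μ = ⊤ := by
  rw [eq_top_iff]
  intro x _
  induction x using big_induction with
  | h0 => exact Submodule.zero_mem _
  | hadd x y hx hy => exact Submodule.add_mem _ (hx trivial) (hy trivial)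
  | hbasis c k =>
    exact Submodule.smul_mem _ _ (Submodule.mem_iSup_of_mem _ (f_pow_smul_mem bigVec_mem k))
  | hbasis' c k =>
    exact Submodule.smul_mem _ _ (Submodule.mem_iSup_of_mem _
      (f_pow_smul_mem (e_smul_mem bigVec_mem) k))

theorem exists_e_pow_smul_big_eq_zero (x : Big) : ∃ K : ℕ, e ^ K • x = 0 := by
  have hpow : ∀ (K L : ℕ) (x : Big), e ^ K • x = 0 → e ^ (K + L) • x = 0 := fun K L x hx => by
    rw [add_comm, pow_add, mul_smul, hx, smul_zero]
  induction x using big_induction with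
  | h0 => exact ⟨0, smul_zero _⟩
  | hadd x y hx hy =>
    obtain ⟨K, hK⟩ := hx
    obtain ⟨L, hL⟩ := hy
    exact ⟨K + L, by rw [smul_add, hpow K L x hK, add_comm K L, hpow L K y hL, add_zero]⟩
  | hbasis c k =>
    -- The exponent is chosen so that the result has weight (-2 - 2k) + 2(k + 2) = 2.
    refine ⟨k + 2, ?_⟩
    have h0 : e ^ (k + 2) • f ^ k • bigVec = 0 := big_eq_zero_of_mem (by
      convert e_pow_smul_mem (f_pow_smul_mem bigVec_mem k) (k + 2) using 2
      push_cast
      ring)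
    rw [smul_comm_scalar, h0, smul_zero]
  | hbasis' c k =>
    -- Since e v has weight 0, one power of e fewer reaches weight 2.
    refine ⟨k + 1, ?_⟩
    have h0 : e ^ (k + 1) • f ^ k • e • bigVec = 0 := big_eq_zero_of_mem (by
      convert e_pow_smul_mem (f_pow_smul_mem (e_smul_mem bigVec_mem) k) (k + 1) using 2
      push_cast
      ring)
    rw [smul_comm_scalar, h0, smul_zero]

theorem span_bigVec : Submodule.span U {bigVec} = ⊤ := by
  rw [eq_top_iff]
  intro x _
  have hv := Submodule.mem_span_singleton_self (R := U) bigVec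
  induction x using big_induction with
  | h0 => exact Submodule.zero_mem _
  | hadd x y hx hy => exact Submodule.add_mem _ (hx trivial) (hy trivial)
  | hbasis c k => exact Submodule.smul_of_tower_mem _ c (Submodule.smul_mem _ _ hv)
  | hbasis' c k =>
    exact Submodule.smul_of_tower_mem _ c (Submodule.smul_mem _ _ (Submodule.smul_mem _ _ hv))

end Weights

/-! ### The Casimir element and membership in the principal block. -/

section Casimir

/-- The Casimir element. -/
noncomputable def casimir : U := (4 : ℂ) • (f * e) + h * h + (2 : ℂ) • h

/-- The Casimir element acts as 4 times the nilpotent endomorphism that maps `Big` onto the Verma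
module of highest weight -2 and then back in through that of highest weight 0; its square is
therefore zero. -/
theorem casimir_smul_big (a b : ℕ →₀ ℂ) : casimir • bigMk (a, b) = bigMk ((4 : ℂ) • opF b, 0) := by
  simp only [casimir, add_smul, smul_assoc, mul_smul, big_e_smul, big_f_smul, big_h_smul, ← map_smul,
    ← map_add, Prod.smul_mk, Prod.mk_add_mk]
  congr 2 <;> refine Finsupp.ext fun k => ?_ <;> rcases k with _ | k <;>
    simp only [Finsupp.add_apply, Finsupp.smul_apply, opH_apply, opF_apply_zero, opF_apply_succ,
      opE_apply, smul_eq_mul, Finsupp.zero_apply] <;> push_cast <;> ring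

theorem casimir_smul_casimir_smul_big (x : Big) : casimir • casimir • x = 0 := by
  obtain ⟨⟨a, b⟩, rfl⟩ := bigMk.surjective x
  rw [casimir_smul_big, casimir_smul_big, map_zero, smul_zero]
  exact map_zero bigMk

variable {N : Type} [AddCommGroup N] [Module ℂ N] [Module U N] [IsScalarTower ℂ U N]

theorem casimir_smul_of_mem {μ : ℂ} {n : N} (hn : n ∈ weightSpace N μ) (he : e • n = 0) :
    casimir • n = (μ * (μ + 2)) • n := by
  rw [mem_weightSpace] at hn
  simp only [casimir, add_smul, smul_assoc, mul_smul, he, smul_zero, hn, smul_comm_scalar]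
  module

/-- The last nonzero vector among the e^k n is a highest weight vector. -/
theorem exists_hasHighestWeightVector_add {μ : ℂ} {n : N} (hn : n ∈ weightSpace N μ) (hn0 : n ≠ 0)
    (hnil : ∃ K : ℕ, e ^ K • n = 0) : ∃ k : ℕ, HasHighestWeightVector N (μ + 2 * k) := by
  classical
  have hpos : Nat.find hnil ≠ 0 := fun h0 => hn0 (by
    have := Nat.find_spec hnil
    rwa [h0, pow_zero, one_smul] at this)
  obtain ⟨k, hk⟩ := Nat.exists_eq_succ_of_ne_zero hpos
  refine ⟨k, e ^ k • n, Nat.find_min hnil (by omega), e_pow_smul_mem hn k, ?_⟩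
  rw [← mul_smul, ← pow_succ', ← Nat.succ_eq_add_one, ← hk]
  exact Nat.find_spec hnil

theorem exists_weight_vector [Nontrivial N] (hsup : ⨆ μ, weightSpace N μ = ⊤) :
    ∃ μ, ∃ n ∈ weightSpace N μ, n ≠ 0 := by
  by_contra! hcon
  refine top_ne_bot (α := Submodule ℂ N) ?_
  rw [← hsup, iSup_eq_bot]
  exact fun μ => (Submodule.eq_bot_iff _).2 (hcon μ)

theorem exists_hasHighestWeightVector [Nontrivial N] (hsup : ⨆ μ, weightSpace N μ = ⊤)
    (hnil : ∀ n : N, ∃ K : ℕ, e ^ K • n = 0) : ∃ μ, HasHighestWeightVector N μ := by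
  obtain ⟨μ, n, hn, hn0⟩ := exists_weight_vector hsup
  obtain ⟨k, hk⟩ := exists_hasHighestWeightVector_add hn hn0 (hnil n)
  exact ⟨_, hk⟩

/-- The composition factors are found by infinitesimal character: a highest weight μ occurring in a
subquotient satisfies (μ (μ + 2))² = 0, so μ is 0 or -2. -/
theorem isInPrincipalBlock_big : IsInPrincipalBlock Big where
  finitely_generated := ⟨⟨{bigVec}, by simpa using span_bigVec⟩⟩
  weight_decomposition := isInternal_iff.2 iSup_weightSpace_big
  locally_n_finite x := by
    obtain ⟨K, hK⟩ := exists_e_pow_smul_big_eq_zero x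
    have hfin : (Set.range fun k : ℕ => e ^ k • x).Finite := by
      refine (((Set.finite_Iio K).image fun k : ℕ => e ^ k • x).union
        (Set.finite_singleton 0)).subset ?_
      rintro _ ⟨k, rfl⟩
      by_cases hk : k < K
      · exact Or.inl ⟨k, hk, rfl⟩
      · right
        obtain ⟨j, rfl⟩ := Nat.exists_eq_add_of_le (not_lt.1 hk)
        refine Set.mem_singleton_iff.2 ?_
        simp only [add_comm K, pow_add, mul_smul, hK, smul_zero]
    exact FiniteDimensional.span_of_finite ℂ hfin
  composition_factors N K hNK := by
    have := hNK.nontrivial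
    obtain ⟨μ, q, hq0, hq, heq⟩ := exists_hasHighestWeightVector (N := N ⧸ K)
      (iSup_weightSpace_of_surjective (iSup_weightSpace_of_injective iSup_weightSpace_big N.subtype
        N.injective_subtype) K.mkQ K.mkQ_surjective) (fun q => by
        obtain ⟨n, rfl⟩ := K.mkQ_surjective q
        obtain ⟨m, hm⟩ := exists_e_pow_smul_big_eq_zero (n : Big)
        refine ⟨m, ?_⟩
        rw [← map_smul, show e ^ m • n = 0 from Subtype.ext hm, map_zero])
    have hcas : casimir • casimir • q = 0 := by
      obtain ⟨n, rfl⟩ := K.mkQ_surjective q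
      rw [← map_smul, ← map_smul, show casimir • casimir • n = 0 from
        Subtype.ext (casimir_smul_casimir_smul_big n), map_zero]
    rw [casimir_smul_of_mem hq heq, smul_comm_scalar, casimir_smul_of_mem hq heq, ← mul_smul,
      smul_eq_zero] at hcas
    have hμ : μ = 0 ∨ μ + 2 = 0 := by simpa using hcas.resolve_right hq0
    rcases hμ with rfl | hμ
    · exact ⟨1, q, hq0, by rwa [dotAction_one], heq⟩
    · exact ⟨s, q, hq0, by rwa [dotAction_s, ← eq_neg_of_add_eq_zero_left hμ], heq⟩

theorem isInPrincipalBlock_verma_zero : IsInPrincipalBlock (Verma 0) :=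
  isInPrincipalBlock_big.of_injective vermaToBig vermaToBig_injective

theorem isInPrincipalBlock_verma_neg_two : IsInPrincipalBlock (Verma (-2)) :=
  isInPrincipalBlock_big.of_surjective bigToVerma bigToVerma_surjective

end Casimir

/-! ### Highest weights occurring in the principal block. -/

section HighestWeights

variable {N : Type} [AddCommGroup N] [Module ℂ N] [Module U N] [IsScalarTower ℂ U N]

theorem iSup_weightSpace_verma (μ : ℂ) : ⨆ ν, weightSpace (Verma μ) ν = ⊤ := by
  rw [eq_top_iff]
  intro x _
  induction x using verma_induction with
  | h0 => exact Submodule.zero_mem _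
  | hadd x y hx hy => exact Submodule.add_mem _ (hx trivial) (hy trivial)
  | hbasis c k =>
    exact Submodule.smul_mem _ _ (Submodule.mem_iSup_of_mem _ (f_pow_smul_mem (vermaVec_mem μ) k))

theorem vermaLift_surjective [IsSimpleModule U N] {μ : ℂ} {n : N} (hn : n ∈ weightSpace N μ)
    (he : e • n = 0) (hn0 : n ≠ 0) : Function.Surjective (vermaLift n hn he) := by
  refine (LinearMap.surjective_or_eq_zero _).resolve_right fun h0 => hn0 ?_
  rw [← vermaLift_vec n hn he, h0, LinearMap.zero_apply]

theorem exists_eq_sub_of_hasHighestWeightVector [IsSimpleModule U N] {μ ν : ℂ}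
    (hμ : HasHighestWeightVector N μ) {n : N} (hn : n ∈ weightSpace N ν) (hn0 : n ≠ 0) :
    ∃ k : ℕ, ν = μ - 2 * k := by
  obtain ⟨m, hm0, hm, hem⟩ := hμ
  obtain ⟨x, hx, hxn⟩ := exists_lift_weightSpace (iSup_weightSpace_verma μ) _
    (vermaLift_surjective hm hem hm0) hn
  exact verma_exists_of_mem hx (by rintro rfl; exact hn0 (by rw [← hxn, map_zero]))

/-- Each of the two weights lies below the other by a nonnegative even integer, because a simple
module is a quotient of either Verma module. -/
theorem HasHighestWeightVector.eq [IsSimpleModule U N] {μ ν : ℂ}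
    (hμ : HasHighestWeightVector N μ) (hν : HasHighestWeightVector N ν) : μ = ν := by
  obtain ⟨k, hk⟩ := exists_eq_sub_of_hasHighestWeightVector hμ hν.choose_spec.2.1 hν.choose_spec.1
  obtain ⟨l, hl⟩ := exists_eq_sub_of_hasHighestWeightVector hν hμ.choose_spec.2.1 hμ.choose_spec.1
  have h1 : ((k + l : ℕ) : ℂ) = (0 : ℕ) := by
    push_cast
    linear_combination (hk + hl) / 2
  have h2 : k = 0 := by
    have := Nat.cast_injective h1
    omega
  rw [hk, h2]
  simp

/-- The cyclic submodule generated by the vector has a maximal proper submodule, which cannot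
contain the generator. The vector thus survives in a simple subquotient, whose highest weight is
known. -/
theorem IsInPrincipalBlock.weight_eq (hN : IsInPrincipalBlock N) {μ : ℂ}
    (hμ : HasHighestWeightVector N μ) : μ = 0 ∨ μ = -2 := by
  obtain ⟨n, hn0, hn, hen⟩ := hμ
  let N₁ : Submodule U N := Submodule.span U {n}
  let n₁ : N₁ := ⟨n, Submodule.mem_span_singleton_self n⟩
  have hspan : Submodule.span U {n₁} = ⊤ := by
    rw [eq_top_iff]
    rintro ⟨x, hx⟩ -
    obtain ⟨u, rfl⟩ := Submodule.mem_span_singleton.1 hx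
    exact Submodule.mem_span_singleton.2 ⟨u, rfl⟩
  have hfin : Module.Finite U N₁ := Module.Finite.of_fg (Submodule.fg_span_singleton n)
  have hnt : Nontrivial N₁ := ⟨n₁, 0, fun h0 => hn0 (congrArg Subtype.val h0)⟩
  obtain ⟨K, hK, -⟩ := (eq_top_or_exists_le_coatom (⊥ : Submodule U N₁)).resolve_left bot_ne_top
  have hsimple := isSimpleModule_iff_isCoatom.2 hK
  obtain ⟨w, hw⟩ := hN.composition_factors N₁ K hsimple
  have hn₁ : n₁ ∈ weightSpace N₁ μ := by
    rw [mem_weightSpace] at *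
    exact Subtype.ext hn
  have hμ : HasHighestWeightVector (N₁ ⧸ K) μ := by
    refine ⟨K.mkQ n₁, fun h0 => hK.1 ?_, map_mem_weightSpace _ hn₁, ?_⟩
    · rw [Submodule.mkQ_apply, Submodule.Quotient.mk_eq_zero] at h0
      rw [eq_top_iff, ← hspan]
      exact Submodule.span_le.2 (Set.singleton_subset_iff.2 h0)
    · rw [← map_smul, show e • n₁ = 0 from Subtype.ext hen, map_zero]
  rw [hμ.eq hw]
  exact dotAction_eq w

theorem IsInPrincipalBlock.exists_e_pow_smul_eq_zero (hN : IsInPrincipalBlock N) {μ : ℂ} {n : N}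
    (hn : n ∈ weightSpace N μ) : ∃ K : ℕ, e ^ K • n = 0 := by
  obtain ⟨K, hK⟩ := SL2.exists_e_pow_smul_eq_zero hn (hN.locally_n_finite n)
  exact ⟨K, hK K le_rfl⟩

/-- Otherwise applying e repeatedly would end at a highest weight 2 + 2k, which is neither 0 nor -2.
This vanishing is the source of projectivity below. -/
theorem IsInPrincipalBlock.eq_zero_of_mem_two (hN : IsInPrincipalBlock N) {n : N}
    (hn : n ∈ weightSpace N 2) : n = 0 := by
  by_contra hn0
  obtain ⟨k, hk⟩ := exists_hasHighestWeightVector_add hn hn0 (hN.exists_e_pow_smul_eq_zero hn)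
  rcases hN.weight_eq hk with h1 | h1
  · have h2 : ((k + 1 : ℕ) : ℂ) = 0 := by push_cast; linear_combination h1 / 2
    exact absurd h2 (Nat.cast_ne_zero.2 (Nat.succ_ne_zero k))
  · have h2 : ((k + 2 : ℕ) : ℂ) = 0 := by push_cast; linear_combination h1 / 2
    exact absurd h2 (Nat.cast_ne_zero.2 (Nat.succ_ne_zero (k + 1)))

theorem IsInPrincipalBlock.e_smul_eq_zero (hN : IsInPrincipalBlock N) {n : N}
    (hn : n ∈ weightSpace N 0) : e • n = 0 :=
  hN.eq_zero_of_mem_two (by simpa using e_smul_mem hn)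

theorem IsInPrincipalBlock.e_smul_e_smul_eq_zero (hN : IsInPrincipalBlock N) {n : N}
    (hn : n ∈ weightSpace N (-2)) : e • e • n = 0 :=
  hN.e_smul_eq_zero (by simpa using e_smul_mem hn)

theorem IsInPrincipalBlock.hasHighestWeightVector [Nontrivial N] (hN : IsInPrincipalBlock N) :
    HasHighestWeightVector N 0 ∨ HasHighestWeightVector N (-2) := by
  obtain ⟨μ, n, hn, hn0⟩ := exists_weight_vector (isInternal_iff.1 hN.weight_decomposition)
  obtain ⟨k, hk⟩ := exists_hasHighestWeightVector_add hn hn0 (hN.exists_e_pow_smul_eq_zero hn)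
  rcases hN.weight_eq hk with h1 | h1
  · exact Or.inl (h1 ▸ hk)
  · exact Or.inr (h1 ▸ hk)

end HighestWeights

/-! ### Homomorphisms between the projectives, and lifting. -/

section Homs

/-- The highest weight vector generates and its weight space is a line. Scalars pass through
`algebraMap ℂ U`, so that the formula uses only the U-action and can be read in `O₀`. -/
theorem verma_end (g : Verma 0 →ₗ[U] Verma 0) : ∃ c : ℂ, ∀ x, g x = algebraMap ℂ U c • x := by
  have h1 : g (vermaVec 0) ∈ weightSpace (Verma 0) (0 - 2 * (0 : ℕ)) := by
    simpa using map_mem_weightSpace g (vermaVec_mem 0)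
  obtain ⟨c, hc⟩ := verma_eq_of_mem h1
  have h2 : g = c • LinearMap.id := verma_hom_ext (by simpa using hc)
  exact ⟨c, fun x => by rw [h2, algebraMap_smul]; rfl⟩

theorem verma_big_hom (g : Verma 0 →ₗ[U] Big) :
    ∃ c : ℂ, ∀ x, g x = algebraMap ℂ U c • vermaToBig x := by
  obtain ⟨c, hc⟩ := big_eq_of_mem_zero (map_mem_weightSpace g (vermaVec_mem 0))
  have h2 : g = c • vermaToBig := verma_hom_ext (by simpa [vermaToBig_vec] using hc)
  exact ⟨c, fun x => by rw [h2, algebraMap_smul]; rfl⟩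

theorem big_verma_hom (g : Big →ₗ[U] Verma 0) :
    ∃ c : ℂ, ∀ x, g x = algebraMap ℂ U c • vermaToVerma (bigToVerma x) := by
  have h1 : g bigVec ∈ weightSpace (Verma 0) (0 - 2 * (1 : ℕ)) := by
    simpa using map_mem_weightSpace g bigVec_mem
  obtain ⟨c, hc⟩ := verma_eq_of_mem h1
  have h2 : g = c • vermaToVerma.comp bigToVerma :=
    big_hom_ext (by simpa [bigToVerma_vec, vermaToVerma_vec] using hc)
  exact ⟨c, fun x => by rw [h2, algebraMap_smul]; rfl⟩

/-- The generator maps into the weight -2 space, which is spanned by v and f e v; the latter is the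
image of v under the nilpotent endomorphism. -/
theorem big_end (g : Big →ₗ[U] Big) : ∃ a b : ℂ, ∀ x,
    g x = algebraMap ℂ U a • x +
      algebraMap ℂ U b • vermaToBig (vermaToVerma (bigToVerma x)) := by
  obtain ⟨a, b, hab⟩ := big_eq_of_mem_neg_two (map_mem_weightSpace g bigVec_mem)
  have h2 : g = a • LinearMap.id + b • vermaToBig.comp (vermaToVerma.comp bigToVerma) :=
    big_hom_ext (by simpa [bigToVerma_vec, vermaToVerma_vec, vermaToBig_vec] using hab)
  exact ⟨a, b, fun x => by rw [h2, algebraMap_smul, algebraMap_smul]; rfl⟩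

variable {N : Type} [AddCommGroup N] [Module ℂ N] [Module U N] [IsScalarTower ℂ U N]
variable {N' : Type} [AddCommGroup N'] [Module ℂ N'] [Module U N'] [IsScalarTower ℂ U N']

/-- A weight 0 preimage of the image of the generator exists, and e kills it because the block has
no weight 2 vectors. -/
theorem IsInPrincipalBlock.exists_verma_lift (hN : IsInPrincipalBlock N) (g : N →ₗ[U] N')
    (hg : Function.Surjective g) (φ : Verma 0 →ₗ[U] N') : ∃ ψ : Verma 0 →ₗ[U] N, g ∘ₗ ψ = φ := by
  obtain ⟨n, hn, hgn⟩ := exists_lift_weightSpace (isInternal_iff.1 hN.weight_decomposition) g hg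
    (map_mem_weightSpace φ (vermaVec_mem 0))
  exact ⟨vermaLift n hn (hN.e_smul_eq_zero hn),
    verma_hom_ext (by rw [LinearMap.comp_apply, vermaLift_vec, hgn])⟩

/-- A weight -2 preimage of the image of the generator automatically satisfies the relation e² n =
0, again for want of weight 2 vectors. -/
theorem IsInPrincipalBlock.exists_big_lift (hN : IsInPrincipalBlock N) (g : N →ₗ[U] N')
    (hg : Function.Surjective g) (φ : Big →ₗ[U] N') : ∃ ψ : Big →ₗ[U] N, g ∘ₗ ψ = φ := by
  obtain ⟨n, hn, hgn⟩ := exists_lift_weightSpace (isInternal_iff.1 hN.weight_decomposition) g hg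
    (map_mem_weightSpace φ bigVec_mem)
  exact ⟨bigLift n hn (hN.e_smul_e_smul_eq_zero hn),
    big_hom_ext (by rw [LinearMap.comp_apply, bigLift_vec, hgn])⟩

end Homs

/-! ### Simple modules and superfluity of the kernel of the big projective. -/

section Simples

variable {T : Type} [AddCommGroup T] [Module ℂ T] [Module U T] [IsScalarTower ℂ U T]

theorem vermaVec_ne_zero (μ : ℂ) : vermaVec μ ≠ 0 := fun h0 => by
  have h1 := (vermaMk μ).injective (h0.trans (map_zero (vermaMk μ)).symm)
  simp at h1

theorem bigVec_ne_zero : bigVec ≠ 0 := fun h0 =>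
  vermaVec_ne_zero (-2) (by rw [← bigToVerma_vec, h0, map_zero])

theorem eq_top_of_vermaVec_mem {μ : ℂ} {B : Submodule U (Verma μ)} (hB : vermaVec μ ∈ B) :
    B = ⊤ := by
  rw [eq_top_iff]
  intro x _
  induction x using verma_induction with
  | h0 => exact Submodule.zero_mem _
  | hadd x y hx hy => exact Submodule.add_mem _ (hx trivial) (hy trivial)
  | hbasis c k => exact Submodule.smul_of_tower_mem _ c (Submodule.smul_mem _ _ hB)

/-- A nonzero submodule lies in the block, so it has a highest weight vector of weight 0 or -2.
Weight 0 does not occur here, and weight -2 gives a multiple of the generator. -/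
theorem isSimpleModule_verma_neg_two : IsSimpleModule U (Verma (-2)) := by
  rw [isSimpleModule_iff]
  refine @IsSimpleOrder.mk _ _ _ (Submodule.nontrivial_iff U |>.2
    ⟨vermaVec (-2), 0, vermaVec_ne_zero _⟩) fun B => ?_
  by_cases hB : B = ⊥
  · exact Or.inl hB
  right
  have hnt : Nontrivial B := Submodule.nontrivial_iff_ne_bot.2 hB
  have hb := (isInPrincipalBlock_verma_neg_two.of_injective B.subtype
    B.injective_subtype).hasHighestWeightVector
  have hmem : ∀ {μ : ℂ} {b : B}, b ∈ weightSpace B μ → b ≠ 0 →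
      (b : Verma (-2)) ∈ weightSpace (Verma (-2)) μ ∧ (b : Verma (-2)) ≠ 0 := fun hb hb0 =>
    ⟨map_mem_weightSpace B.subtype hb, fun h0 => hb0 (Subtype.ext h0)⟩
  rcases hb with ⟨b, hb0, hb, -⟩ | ⟨b, hb0, hb, -⟩
  · obtain ⟨k, hk⟩ := verma_exists_of_mem (hmem hb hb0).1 (hmem hb hb0).2
    have h2 : ((k + 1 : ℕ) : ℂ) = 0 := by push_cast; linear_combination hk / 2
    exact absurd h2 (Nat.cast_ne_zero.2 (Nat.succ_ne_zero k))
  · obtain ⟨hb, hb0⟩ := hmem hb hb0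
    obtain ⟨c, hc⟩ := verma_eq_of_mem (μ := -2) (m := 0) (by simpa using hb)
    rw [pow_zero, one_smul] at hc
    have hc0 : c ≠ 0 := by
      rintro rfl
      exact hb0 (hc.trans (zero_smul _ _))
    refine eq_top_of_vermaVec_mem ?_
    have h3 := B.smul_of_tower_mem c⁻¹ b.2
    rwa [hc, inv_smul_smul₀ hc0] at h3

theorem exists_equiv_verma_neg_two [IsSimpleModule U T] (hT : HasHighestWeightVector T (-2)) :
    Nonempty (Verma (-2) ≃ₗ[U] T) := by
  obtain ⟨t, ht0, ht, het⟩ := hT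
  have := isSimpleModule_verma_neg_two
  refine ⟨LinearEquiv.ofBijective (vermaLift t ht het)
    ((LinearMap.bijective_or_eq_zero _).resolve_right fun h0 => ht0 ?_)⟩
  rw [← vermaLift_vec t ht het, h0, LinearMap.zero_apply]

theorem verma_zero_decomposition (x : Verma 0) :
    ∃ (c : ℂ) (y : Verma (-2)), x = c • vermaVec 0 + vermaToVerma y := by
  induction x using verma_induction with
  | h0 => exact ⟨0, 0, by rw [zero_smul, map_zero, add_zero]⟩
  | hadd x y hx hy =>
    obtain ⟨c, x', rfl⟩ := hx
    obtain ⟨d, y', rfl⟩ := hy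
    exact ⟨c + d, x' + y', by rw [add_smul, map_add]; abel⟩
  | hbasis c k =>
    rcases k with _ | k
    · exact ⟨c, 0, by rw [pow_zero, one_smul, map_zero, add_zero]⟩
    · exact ⟨0, c • f ^ k • vermaVec (-2), by
        rw [map_scalar, map_smul, vermaToVerma_vec, pow_succ, mul_smul, zero_smul, zero_add]⟩

/-- The simple module of highest weight `0` is the cokernel of the inclusion of Verma modules. -/
theorem exists_exact_of_hasHighestWeightVector_zero [IsSimpleModule U T]
    (hT : HasHighestWeightVector T 0) :
    ∃ p : Verma 0 →ₗ[U] T, Function.Surjective p ∧ Function.Exact vermaToVerma p := by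
  obtain ⟨t, ht0, ht, het⟩ := id hT
  refine ⟨vermaLift t ht het, vermaLift_surjective ht het ht0, ?_⟩
  -- If nonzero, f t would be a highest weight vector of weight -2, contradicting uniqueness of the
  -- highest weight of a simple module.
  have hft : f • t = 0 := by
    by_contra hft
    have h1 : HasHighestWeightVector T (-2) := by
      refine ⟨f • t, hft, by simpa using f_smul_mem ht, ?_⟩
      rw [← mul_smul, e_mul_f, add_smul, mul_smul, het, smul_zero, mem_weightSpace.1 ht, zero_smul,
        add_zero]
    have h2 := hT.eq h1
    norm_num at h2
  have hcomp : vermaLift t ht het ∘ₗ vermaToVerma = 0 := verma_hom_ext (by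
    rw [LinearMap.comp_apply, vermaToVerma_vec, map_smul, vermaLift_vec, hft, LinearMap.zero_apply])
  intro x
  constructor
  · intro hx
    obtain ⟨c, y, rfl⟩ := verma_zero_decomposition x
    have h1 : vermaLift t ht het (vermaToVerma y) = 0 := LinearMap.congr_fun hcomp y
    rw [map_add, map_scalar, vermaLift_vec, h1, add_zero, smul_eq_zero] at hx
    exact ⟨y, by rw [hx.resolve_right ht0, zero_smul, zero_add]⟩
  · rintro ⟨y, rfl⟩
    exact LinearMap.congr_fun hcomp y

theorem exists_simple_quotient_verma_zero : ∃ K : Submodule U (Verma 0),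
    IsSimpleModule U (Verma 0 ⧸ K) ∧ HasHighestWeightVector (Verma 0 ⧸ K) 0 := by
  have := isInPrincipalBlock_verma_zero.finitely_generated
  have : Nontrivial (Verma 0) := ⟨vermaVec 0, 0, vermaVec_ne_zero 0⟩
  obtain ⟨K, hK, -⟩ :=
    (eq_top_or_exists_le_coatom (⊥ : Submodule U (Verma 0))).resolve_left bot_ne_top
  refine ⟨K, isSimpleModule_iff_isCoatom.2 hK, K.mkQ (vermaVec 0), fun h0 => hK.1 ?_,
    map_mem_weightSpace _ (vermaVec_mem 0), ?_⟩
  · rw [Submodule.mkQ_apply, Submodule.Quotient.mk_eq_zero] at h0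
    exact eq_top_of_vermaVec_mem h0
  · rw [← map_smul, e_smul_vermaVec, map_zero]

/-- The range contains a weight -2 vector of the form v + d f e v. As e kills f e v, the range
contains e v, hence f e v, hence the generator v. -/
theorem surjective_of_bigToVerma_comp_surjective {N : Type} [AddCommGroup N] [Module U N]
    (g : N →ₗ[U] Big) (hg : Function.Surjective (bigToVerma ∘ₗ g)) : Function.Surjective g := by
  let B := LinearMap.range g
  have hB : Function.Surjective (bigToVerma ∘ₗ B.subtype) := fun y => by
    obtain ⟨x, hx⟩ := hg y
    exact ⟨⟨g x, x, rfl⟩, hx⟩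
  obtain ⟨⟨b, hbB⟩, hb, hbv⟩ := exists_lift_weightSpace
    (iSup_weightSpace_of_injective iSup_weightSpace_big B.subtype B.injective_subtype) _ hB
    (vermaVec_mem (-2))
  obtain ⟨c, d, rfl⟩ := big_eq_of_mem_neg_two (map_mem_weightSpace B.subtype hb)
  have hc : c = 1 := by
    have h1 : (c • vermaVec (-2) : Verma (-2)) = vermaVec (-2) := by
      refine Eq.trans ?_ hbv
      rw [LinearMap.comp_apply, Submodule.subtype_apply, map_add, map_scalar, map_scalar,
        map_smul, map_smul, bigToVerma_vec, e_smul_vermaVec, smul_zero, smul_zero, add_zero]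
    have h2 : ((c - 1) • vermaVec (-2) : Verma (-2)) = 0 := by rw [sub_smul, h1, one_smul, sub_self]
    exact sub_eq_zero.1 ((smul_eq_zero.1 h2).resolve_right (vermaVec_ne_zero _))
  subst hc
  have hfe : e • f • e • bigVec = 0 := by
    have h1 : e • bigVec ∈ weightSpace Big 0 := by simpa using e_smul_mem bigVec_mem
    rw [← mul_smul e f, e_mul_f, add_smul, mul_smul, e_smul_e_smul_bigVec, smul_zero,
      mem_weightSpace.1 h1, zero_smul, add_zero]
  have heb := B.smul_mem e hbB
  rw [smul_add, one_smul, smul_comm_scalar, hfe, smul_zero, add_zero] at heb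
  have hv := B.sub_mem hbB (B.smul_of_tower_mem d (B.smul_mem f heb))
  rw [add_sub_cancel_right, one_smul] at hv
  refine LinearMap.range_eq_top.1 (eq_top_iff.2 ?_)
  rw [← span_bigVec]
  exact Submodule.span_le.2 (Set.singleton_subset_iff.2 hv)

end Simples

/-! ### The modules as objects of the block, and uniqueness of P(s). -/

section Objects

open Limits
open scoped ModuleCat

variable {N : Type} [AddCommGroup N] [Module ℂ N] [Module U N] [IsScalarTower ℂ U N]

theorem principalBlock_of_linearEquiv (hN : IsInPrincipalBlock N) (X : ModuleCat.{0} U)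
    (g : X ≃ₗ[U] N) : principalBlock X :=
  IsInPrincipalBlock.of_injective hN g.toLinearMap g.injective

/-- A module that belongs to the principal block, as an object of the category `𝓞₀`. -/
def ofModule (hN : IsInPrincipalBlock N) : O₀ where
  obj := ModuleCat.of U N
  property := principalBlock_of_linearEquiv hN _ (LinearEquiv.refl U N)

/-- A homomorphism of modules in the principal block, as a morphism of the category `𝓞₀`. -/
def ofLinearMap {X Y : O₀} (g : X.obj →ₗ[U] Y.obj) : X ⟶ Y :=
  ObjectProperty.homMk (ModuleCat.ofHom g)

theorem hom_ext_apply {X Y : O₀} {g g' : X ⟶ Y} (hg : ∀ x, g.hom.hom x = g'.hom.hom x) : g = g' :=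
  ObjectProperty.hom_ext _ (ModuleCat.hom_ext (LinearMap.ext hg))

theorem comp_apply {X Y Z : O₀} (g : X ⟶ Y) (g' : Y ⟶ Z) (x : X.obj) :
    (g ≫ g').hom.hom x = g'.hom.hom (g.hom.hom x) := rfl

theorem surjective_of_epi {X Y : O₀} (g : X ⟶ Y) [Epi g] : Function.Surjective g.hom.hom := by
  have := principalBlock.preservesEpimorphisms_ι_of_isNormalMonoCategory
  exact (ModuleCat.epi_iff_surjective _).1 (inferInstanceAs (Epi (principalBlock.ι.map g)))

theorem epi_of_surjective {X Y : O₀} (g : X ⟶ Y) (hg : Function.Surjective g.hom.hom) : Epi g :=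
  principalBlock.ι.epi_of_epi_map ((ModuleCat.epi_iff_surjective _).2 hg)

theorem mono_of_injective {X Y : O₀} (g : X ⟶ Y) (hg : Function.Injective g.hom.hom) : Mono g :=
  principalBlock.ι.mono_of_mono_map ((ModuleCat.mono_iff_injective _).2 hg)

theorem shortExact_of_exact {S : ShortComplex O₀} (hf : Function.Injective S.f.hom.hom)
    (hfg : Function.Exact S.f.hom.hom S.g.hom.hom) (hg : Function.Surjective S.g.hom.hom) :
    S.ShortExact := by
  have := mono_of_injective S.f hf
  have := epi_of_surjective S.g hg
  refine ShortComplex.ShortExact.mk (ShortComplex.exact_of_f_is_kernel S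
    -- A morphism killed by the second map takes values in the range of the first, which injectivity
    -- allows to be inverted.
    (KernelFork.IsLimit.ofι' _ _ fun {W} k hk => ?_))
  let l := LinearEquiv.ofInjective S.f.hom.hom hf
  have hmem : ∀ x, k.hom.hom x ∈ LinearMap.range S.f.hom.hom := fun x =>
    (hfg _).1 (by rw [← comp_apply, hk]; rfl)
  refine ⟨ofLinearMap (l.symm.toLinearMap ∘ₗ k.hom.hom.codRestrict _ hmem), hom_ext_apply fun x => ?_⟩
  have h1 := l.apply_symm_apply ⟨k.hom.hom x, hmem x⟩
  exact congrArg Subtype.val h1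

theorem isZero_of_subsingleton (X : O₀) [Subsingleton X.obj] : IsZero X := by
  rw [IsZero.iff_id_eq_zero]
  exact hom_ext_apply fun x => Subsingleton.elim _ _

/-- An isomorphism of modules in the principal block, as an isomorphism in the category `𝓞₀`. -/
def isoOfLinearEquiv {X Y : O₀} (g : X.obj ≃ₗ[U] Y.obj) : X ≅ Y where
  hom := ofLinearMap g.toLinearMap
  inv := ofLinearMap g.symm.toLinearMap
  hom_inv_id := hom_ext_apply fun x => g.symm_apply_apply x
  inv_hom_id := hom_ext_apply fun x => g.apply_symm_apply x

/-- The dominant Verma module as an object of `𝓞₀`. -/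
noncomputable def vermaZero : O₀ := ofModule isInPrincipalBlock_verma_zero

/-- The antidominant Verma module as an object of `𝓞₀`. -/
noncomputable def vermaNegTwo : O₀ := ofModule isInPrincipalBlock_verma_neg_two

/-- The big projective module as an object of `𝓞₀`. -/
noncomputable def big : O₀ := ofModule isInPrincipalBlock_big

/-- `vermaToBig` as a morphism of `𝓞₀`. -/
noncomputable def vermaZeroToBig : vermaZero ⟶ big := ofLinearMap vermaToBig

/-- `bigToVerma` as a morphism of `𝓞₀`. -/
noncomputable def bigToVermaNegTwo : big ⟶ vermaNegTwo := ofLinearMap bigToVerma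

/-- `vermaToVerma` as a morphism of `𝓞₀`. -/
noncomputable def vermaNegTwoToVermaZero : vermaNegTwo ⟶ vermaZero := ofLinearMap vermaToVerma

instance projective_vermaZero : Projective vermaZero where
  factors {E X} φ g _ := by
    obtain ⟨ψ, hψ⟩ := IsInPrincipalBlock.exists_verma_lift E.property g.hom.hom (surjective_of_epi g)
      φ.hom.hom
    exact ⟨ofLinearMap ψ, hom_ext_apply fun x => LinearMap.congr_fun hψ x⟩

instance projective_big : Projective big where
  factors {E X} φ g _ := by
    obtain ⟨ψ, hψ⟩ := IsInPrincipalBlock.exists_big_lift E.property g.hom.hom (surjective_of_epi g)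
      φ.hom.hom
    exact ⟨ofLinearMap ψ, hom_ext_apply fun x => LinearMap.congr_fun hψ x⟩

instance : Epi bigToVermaNegTwo := epi_of_surjective _ bigToVerma_surjective

theorem hasHighestWeightVector_ofModule (hN : IsInPrincipalBlock N) {μ : ℂ}
    (hμ : HasHighestWeightVector N μ) : HasHighestWeightVector (ofModule hN).obj μ :=
  hμ.of_equiv (M' := (ofModule hN).obj) (LinearEquiv.refl U N)

theorem isSimpleObject_vermaNegTwo : IsSimpleObject s vermaNegTwo := by
  refine ⟨isSimpleModule_verma_neg_two, hasHighestWeightVector_ofModule _ ?_⟩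
  rw [dotAction_s]
  exact ⟨_, vermaVec_ne_zero _, vermaVec_mem _, e_smul_vermaVec _⟩

theorem exists_isSimpleObject_one : ∃ L : O₀, IsSimpleObject 1 L := by
  obtain ⟨K, hK, hw⟩ := exists_simple_quotient_verma_zero
  refine ⟨ofModule (isInPrincipalBlock_verma_zero.of_surjective K.mkQ K.mkQ_surjective), hK,
    hasHighestWeightVector_ofModule _ ?_⟩
  rwa [dotAction_one]

theorem IsSimpleObject.exists_iso {L : O₀} (hL : IsSimpleObject s L) :
    Nonempty (vermaNegTwo ≅ L) := by
  obtain ⟨hL, hw⟩ := hL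
  rw [dotAction_s] at hw
  obtain ⟨g⟩ := exists_equiv_verma_neg_two hw
  exact ⟨isoOfLinearEquiv g⟩

theorem IsSimpleObject.exists_shortExact {L : O₀} (hL : IsSimpleObject 1 L) :
    ∃ (p : vermaZero ⟶ L) (hp : vermaNegTwoToVermaZero ≫ p = 0),
      (ShortComplex.mk vermaNegTwoToVermaZero p hp).ShortExact := by
  obtain ⟨hL, hw⟩ := hL
  rw [dotAction_one] at hw
  obtain ⟨p, hp, hex⟩ := exists_exact_of_hasHighestWeightVector_zero hw
  exact ⟨ofLinearMap p, hom_ext_apply fun x => hex.apply_apply_eq_zero x,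
    shortExact_of_exact vermaToVerma_injective hex hp⟩

/-- Both objects are cokernels of the same inclusion of Verma modules. -/
theorem IsSimpleObject.nonempty_iso {L L' : O₀} (hL : IsSimpleObject 1 L)
    (hL' : IsSimpleObject 1 L') : Nonempty (L ≅ L') := by
  obtain ⟨p, hp, hS⟩ := hL.exists_shortExact
  obtain ⟨p', hp', hS'⟩ := hL'.exists_shortExact
  have := hS.epi_g
  have := hS'.epi_g
  exact ⟨IsColimit.coconePointUniqueUpToIso hS.exact.gIsCokernel hS'.exact.gIsCokernel⟩

theorem not_isZero_big : ¬ IsZero big := fun h0 => bigVec_ne_zero (by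
  have h1 := h0.eq_of_src (𝟙 big) 0
  exact congrArg (fun g : big ⟶ big => g.hom.hom bigVec) h1)

/-- One of the two summands maps nontrivially, hence onto, the simple quotient. By superfluity its
inclusion is an epimorphism, so the other summand is zero. -/
theorem indecomposable_big : Indecomposable big := by
  refine ⟨not_isZero_big, fun Y Z α => ?_⟩
  have hsimple : IsSimpleModule U vermaNegTwo.obj := isSimpleModule_verma_neg_two
  have hepi : ∀ {X : O₀} (g : X ⟶ big), g ≫ bigToVermaNegTwo ≠ 0 → Epi g := fun g hg => by
    refine epi_of_surjective _ (surjective_of_bigToVerma_comp_surjective g.hom.hom ?_)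
    exact (LinearMap.surjective_or_eq_zero (g ≫ bigToVermaNegTwo).hom.hom).resolve_right
      fun h0 => hg (hom_ext_apply fun x => LinearMap.congr_fun h0 x)
  by_cases hY : (biprod.inl ≫ α.inv) ≫ bigToVermaNegTwo = 0
  · by_cases hZ : (biprod.inr ≫ α.inv) ≫ bigToVermaNegTwo = 0
    · exfalso
      have h0 : bigToVermaNegTwo = 0 := by
        rw [← cancel_epi α.inv]
        refine biprod.hom_ext' _ _ ?_ ?_
        · simpa using hY
        · simpa using hZ
      refine vermaVec_ne_zero (-2) ?_
      rw [← bigToVerma_vec]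
      exact congrArg (fun g : big ⟶ vermaNegTwo => g.hom.hom bigVec) h0
    · left
      have := hepi _ hZ
      have : Epi (biprod.inr : Z ⟶ Y ⊞ Z) := by
        have h1 : (biprod.inr : Z ⟶ Y ⊞ Z) = (biprod.inr ≫ α.inv) ≫ α.hom := by simp
        rw [h1]
        infer_instance
      rw [IsZero.iff_id_eq_zero, ← biprod.inl_fst (X := Y) (Y := Z),
        (cancel_epi (biprod.inr : Z ⟶ Y ⊞ Z)).1 (show biprod.inr ≫ biprod.fst = biprod.inr ≫ 0 by
          simp), comp_zero]
  · right
    have := hepi _ hY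
    have : Epi (biprod.inl : Y ⟶ Y ⊞ Z) := by
      have h1 : (biprod.inl : Y ⟶ Y ⊞ Z) = (biprod.inl ≫ α.inv) ≫ α.hom := by simp
      rw [h1]
      infer_instance
    rw [IsZero.iff_id_eq_zero, ← biprod.inr_snd (X := Y) (Y := Z),
      (cancel_epi (biprod.inl : Y ⟶ Y ⊞ Z)).1 (show biprod.inl ≫ biprod.snd = biprod.inl ≫ 0 by
        simp), comp_zero]

theorem isIndecomposableProjective_big : IsIndecomposableProjective s big :=
  ⟨inferInstance, indecomposable_big, vermaNegTwo, isSimpleObject_vermaNegTwo, bigToVermaNegTwo,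
    inferInstance⟩

/-- The surjection from P to the simple object lifts to a map P → `big`, which is onto by
superfluity and splits by projectivity of `big`. Indecomposability of P kills the kernel. -/
theorem IsIndecomposableProjective.exists_iso {P : O₀} (hP : IsIndecomposableProjective s P) :
    Nonempty (big ≅ P) := by
  obtain ⟨hproj, hind, L, hL, p, hp⟩ := hP
  obtain ⟨α⟩ := hL.exists_iso
  let g : P ⟶ big := Projective.factorThru (p ≫ α.inv) bigToVermaNegTwo
  have hg : g ≫ bigToVermaNegTwo = p ≫ α.inv := Projective.factorThru_comp _ _
  have hepi : Epi g := by
    refine epi_of_surjective _ (surjective_of_bigToVerma_comp_surjective g.hom.hom ?_)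
    have : Epi (g ≫ bigToVermaNegTwo) := by rw [hg]; infer_instance
    exact surjective_of_epi (g ≫ bigToVermaNegTwo)
  have hS : (ShortComplex.mk (kernel.ι g) g (kernel.condition g)).ShortExact :=
    ShortComplex.ShortExact.mk (ShortComplex.exact_of_f_is_kernel _ (kernelIsKernel g))
  have hmono : Mono g := by
    have hker := (hind.2 _ _ hS.splittingOfProjective.isoBinaryBiproduct).resolve_right
      not_isZero_big
    exact Preadditive.mono_of_kernel_zero (hker.eq_of_src _ _)
  have : IsIso g := isIso_of_mono_of_epi g
  exact ⟨(asIso g).symm⟩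

end Objects

/-! ### Dimensions of weight spaces under inclusions. -/

section Devissage

variable {M : Type} [AddCommGroup M] [Module ℂ M] [Module U M] [IsScalarTower ℂ U M]
variable {M' : Type} [AddCommGroup M'] [Module ℂ M'] [Module U M'] [IsScalarTower ℂ U M']

theorem finrank_weightSpace_le (hM : IsInCategoryO M) (g : M' →ₗ[U] M)
    (hg : Function.Injective g) (μ : ℂ) :
    Module.finrank ℂ (weightSpace M' μ) ≤ Module.finrank ℂ (weightSpace M μ) := by
  have := finiteDimensional_weightSpace hM μ
  rw [(Submodule.equivMapOfInjective (g.restrictScalars ℂ) hg (weightSpace M' μ)).finrank_eq]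
  exact Submodule.finrank_mono (map_weightSpace_le g μ)

theorem finrank_weightSpace_lt (hM : IsInCategoryO M) (g : M' →ₗ[U] M)
    (hg : Function.Injective g) {μ : ℂ} {v : M} (hv : v ∈ weightSpace M μ)
    (hvg : v ∉ LinearMap.range g) :
    Module.finrank ℂ (weightSpace M' μ) < Module.finrank ℂ (weightSpace M μ) := by
  have := finiteDimensional_weightSpace hM μ
  rw [(Submodule.equivMapOfInjective (g.restrictScalars ℂ) hg (weightSpace M' μ)).finrank_eq]
  refine Submodule.finrank_lt_finrank_of_lt (lt_of_le_of_ne (map_weightSpace_le g μ) fun h0 => hvg ?_)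
  rw [← h0] at hv
  obtain ⟨x, -, hx⟩ := hv
  exact ⟨x, hx⟩

end Devissage

/-! ### Dévissage by simple quotients, and assembly of the block data. -/

section Blocks

open Limits
open scoped ModuleCat

/-- The sum of the dimensions in weights 0 and -2 measures length. It drops strictly because the
highest weight vector of a simple quotient lifts to a weight vector outside the kernel. -/
theorem exists_shortExact_simple (X : O₀) [Nontrivial X.obj] :
    ∃ S : ShortComplex O₀, S.ShortExact ∧ S.X₂ = X ∧
      (IsSimpleObject 1 S.X₃ ∨ IsSimpleObject s S.X₃) ∧
      Module.finrank ℂ (weightSpace S.X₁.obj 0) + Module.finrank ℂ (weightSpace S.X₁.obj (-2)) <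
        Module.finrank ℂ (weightSpace X.obj 0) + Module.finrank ℂ (weightSpace X.obj (-2)) := by
  have hX : IsInPrincipalBlock X.obj := X.property
  have := hX.finitely_generated
  obtain ⟨K, hK, -⟩ :=
    (eq_top_or_exists_le_coatom (⊥ : Submodule U X.obj)).resolve_left bot_ne_top
  have hsimple : IsSimpleModule U (X.obj ⧸ K) := isSimpleModule_iff_isCoatom.2 hK
  let X₁ : O₀ := ofModule (hX.of_injective K.subtype K.injective_subtype)
  let X₃ : O₀ := ofModule (hX.of_surjective K.mkQ K.mkQ_surjective)
  let i : X₁.obj →ₗ[U] X.obj := K.subtype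
  let p : X.obj →ₗ[U] X₃.obj := K.mkQ
  have hi : Function.Injective i := K.injective_subtype
  have hp : Function.Surjective p := K.mkQ_surjective
  have hip : Function.Exact i p := LinearMap.exact_subtype_mkQ K
  have hsimple₃ : IsSimpleModule U X₃.obj := hsimple
  have hw : HasHighestWeightVector X₃.obj 0 ∨ HasHighestWeightVector X₃.obj (-2) := by
    have := hsimple₃.nontrivial
    exact IsInPrincipalBlock.hasHighestWeightVector X₃.property
  have hlt : ∀ {μ : ℂ}, HasHighestWeightVector X₃.obj μ →
      Module.finrank ℂ (weightSpace X₁.obj μ) < Module.finrank ℂ (weightSpace X.obj μ) := by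
    rintro μ ⟨q, hq0, hq, -⟩
    obtain ⟨v, hv, hvq⟩ := exists_lift_weightSpace (isInternal_iff.1 hX.weight_decomposition) p hp hq
    refine finrank_weightSpace_lt hX.toIsInCategoryO i hi hv fun hvi => hq0 ?_
    rw [← hvq]
    exact (hip v).2 hvi
  refine ⟨ShortComplex.mk (ofLinearMap i) (ofLinearMap p)
    (hom_ext_apply fun x => hip.apply_apply_eq_zero x), shortExact_of_exact hi hip hp, rfl, ?_, ?_⟩
  · rcases hw with hw | hw
    · exact Or.inl ⟨hsimple₃, by rwa [dotAction_one]⟩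
    · exact Or.inr ⟨hsimple₃, by rwa [dotAction_s]⟩
  · rcases hw with hw | hw
    · exact add_lt_add_of_lt_of_le (hlt hw) (finrank_weightSpace_le hX.toIsInCategoryO i hi _)
    · exact add_lt_add_of_le_of_lt (finrank_weightSpace_le hX.toIsInCategoryO i hi _) (hlt hw)

theorem devissage {A : O₀} (hA : IsSimpleObject 1 A) (Q : ObjectProperty O₀)
    (hQ0 : ∀ X, IsZero X → Q X) (hQA : Q A) (hQS : Q vermaNegTwo)
    (_ : Q.IsClosedUnderIsomorphisms)
    (hQ : ∀ X : ShortComplex O₀, X.ShortExact → Q X.X₁ → Q X.X₃ → Q X.X₂) (X : O₀) : Q X := by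
  induction hn : Module.finrank ℂ (weightSpace X.obj 0) + Module.finrank ℂ (weightSpace X.obj (-2))
    using Nat.strong_induction_on generalizing X with
  | _ n ih =>
    rcases subsingleton_or_nontrivial X.obj with _ | _
    · exact hQ0 _ (isZero_of_subsingleton X)
    · obtain ⟨S, hS, rfl, hS₃, hlt⟩ := exists_shortExact_simple X
      refine hQ S hS (ih _ (hn ▸ hlt) _ rfl) ?_
      rcases hS₃ with h3 | h3
      · exact Q.prop_of_iso (hA.nonempty_iso h3).some hQA
      · exact Q.prop_of_iso h3.exists_iso.some hQS

theorem exists_blockData {A P : O₀} (hA : IsSimpleObject 1 A)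
    (hP : IsIndecomposableProjective s P) : ∃ D : BlockData ℂ O₀, D.A = A ∧ D.P = P := by
  obtain ⟨p, hp, hSA⟩ := hA.exists_shortExact
  obtain ⟨α⟩ := hP.exists_iso
  -- The sequence is transported along the isomorphism from `big` to the given P, so that the block
  -- data contain P itself.
  have hjq : (vermaZeroToBig ≫ α.hom) ≫ α.inv ≫ bigToVermaNegTwo = 0 := by
    rw [Category.assoc, α.hom_inv_id_assoc]
    exact hom_ext_apply fun x => exact_vermaToBig_bigToVerma.apply_apply_eq_zero x
  have hw : vermaZeroToBig ≫ bigToVermaNegTwo = 0 := by simpa using hjq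
  have hSS : (ShortComplex.mk vermaZeroToBig bigToVermaNegTwo hw).ShortExact :=
    shortExact_of_exact vermaToBig_injective exact_vermaToBig_bigToVerma bigToVerma_surjective
  refine ⟨{
    A := A
    S := vermaNegTwo
    V := vermaZero
    P := P
    i := vermaNegTwoToVermaZero
    π := p
    j := vermaZeroToBig ≫ α.hom
    q := α.inv ≫ bigToVermaNegTwo
    i_π := hp
    j_q := hjq
    shortExact_A := hSA
    shortExact_S := ShortComplex.shortExact_of_iso
      (ShortComplex.isoMk (S₁ := ShortComplex.mk _ _ hw) (S₂ := ShortComplex.mk _ _ hjq)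
        (Iso.refl _) α (Iso.refl _) (by simp) (by simp)) hSS
    projective_V := inferInstance
    projective_P := hP.1
    end_V := fun g => ?_
    hom_V_P := fun g => ?_
    hom_P_V := fun g => ?_
    end_P := fun g => ?_
    not_isZero_S := fun h0 => ?_
    devissage := devissage hA }, rfl, rfl⟩
  · obtain ⟨c, hc⟩ := verma_end g.hom.hom
    exact ⟨c, hom_ext_apply hc⟩
  · obtain ⟨c, hc⟩ := verma_big_hom (g ≫ α.inv).hom.hom
    refine ⟨c, ?_⟩
    -- Moving the isomorphism to the other side reduces the claim to maps into the explicit model.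
    rw [← Linear.smul_comp, ← Iso.comp_inv_eq]
    exact hom_ext_apply hc
  · obtain ⟨c, hc⟩ := big_verma_hom (α.hom ≫ g).hom.hom
    refine ⟨c, ?_⟩
    rw [Category.assoc, ← Linear.comp_smul, Iso.eq_inv_comp]
    exact hom_ext_apply hc
  · obtain ⟨a, b, hab⟩ := big_end (α.hom ≫ g ≫ α.inv).hom.hom
    refine ⟨a, b, ?_⟩
    have key : α.hom ≫ g ≫ α.inv = a • 𝟙 big +
        b • (bigToVermaNegTwo ≫ vermaNegTwoToVermaZero ≫ vermaZeroToBig) := hom_ext_apply hab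
    have h1 : g = α.inv ≫ (α.hom ≫ g ≫ α.inv) ≫ α.hom := by simp
    rw [h1, key]
    simp
  · refine vermaVec_ne_zero (-2) ?_
    exact congrArg (fun g : vermaNegTwo ⟶ vermaNegTwo => g.hom.hom (vermaVec (-2)))
      (h0.eq_of_src (𝟙 vermaNegTwo) 0)

end Blocks

end SL2

theorem mainTheorem9 [HasDerivedCategory.{w₀} SL2.O₀] :
    ((∃ P : SL2.O₀, SL2.IsIndecomposableProjective SL2.s P) ∧
      ∀ P : SL2.O₀, SL2.IsIndecomposableProjective SL2.s P →
        IsSpherical ℂ (SL2.asComplex.{w₀} P) 0) ∧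
    ((∃ L : SL2.O₀, SL2.IsSimpleObject 1 L) ∧
      ∀ L : SL2.O₀, SL2.IsSimpleObject 1 L →
        IsSpherical ℂ (SL2.asComplex.{w₀} L) 2) := by
  refine ⟨⟨⟨_, SL2.isIndecomposableProjective_big⟩, fun P hP => ?_⟩,
    ⟨SL2.exists_isSimpleObject_one, fun L hL => ?_⟩⟩
  -- Any choice of L(1) completes the block data around the given P.
  · obtain ⟨L, hL⟩ := SL2.exists_isSimpleObject_one
    obtain ⟨D, -, rfl⟩ := SL2.exists_blockData hL hP
    exact D.isSpherical_P
  · obtain ⟨D, rfl, -⟩ := SL2.exists_blockData hL SL2.isIndecomposableProjective_big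
    exact D.isSpherical_A
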